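/- Let $n\ge 2$ and let $\theta$ be a real antisymmetric $n\times n$ matrix with columns $\theta_1,\dots,\theta_n$. On $L^2(\mathbb T^n)$, $\mathbb T^n=\mathbb R^n/2\pi\mathbb Z^n$, with normalized measure, let $(U_j\xi)(x)=e^{ix_j}\xi(x+\pi\theta_j)$, $(V_s\xi)(x)=\xi(x+s)$, $U^k=U_1^{k_1}\cdots U_n^{k_n}$ $(k\in\mathbb Z^n)$, $\alpha_s(T)=V_sTV_s^{-1}$ and $\tau(T)=\langle T1,1\rangle$. Let $A_\theta$ be the $C^*$-algebra generated by $U_1,\dots,U_n$, and $\mathscr A_\theta=\{u\in A_\theta:\ s\mapsto\alpha_s(u)\text{ is }C^\infty\}$ with the topology of the seminorms $\|\delta^\alpha u\|$, $\alpha\in\mathbb N_0^n$, where $\delta_j(u)=\frac1i\partial_{s_j}\alpha_s(u)|_{s=0}$. Let $\mathscr A_\theta'$ be its topological dual, into which $\mathscr A_\theta$ embeds by $\langle u,v\rangle=\tau(uv)$; let $\mathscr H_\theta$ be the Hilbert space completion of $\mathrm{span}\{U^k\}$ for the inner product $\tau(uv^*)$. Elements of $\mathscr A_\theta'$ and $\mathscr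 H_\theta$ are identified with their Fourier series $\sum u_kU^k$, where $u_k=\langle u,(U^k)^*\rangle$ on $\mathscr A_\theta'$ and $u_k=\langle u,U^k\rangle_{\mathscr H_\theta}$ on $\mathscr H_\theta$. For $s\in\mathbb R$ let $\Lambda^su=\sum(1+|k|^2)^{s/2}u_kU^k$ and let $\mathscr H_\theta^{(s)}=\{u\in\mathscr A_\theta':\Lambda^su\in\mathscr H_\theta\}$ with the norm $\|u\|_s=\|\Lambda^su\|_{\mathscr H_\theta}$. For $m\in\mathbb R$ let $\mathbb S^m(\mathbb R^n;\mathscr A_\theta)$ be the space of all $\rho\in C^\infty(\mathbb R^n;\mathscr A_\theta)$ such that $\sup_\xi(1+|\xi|)^{-m+|\beta|}\|\delta^\alpha\partial_\xi^\beta\rho(\xi)\|<\infty$ for all multi-indices $\alpha,\beta$, with the locally convex topology generated by these seminorms. For $\rho\in\mathbb S^m(\mathbb R^n;\mathscr A_\theta)$ and $u\in\mathscr A_\theta$ let $$P_\rho u=(2\pi)^{-n}\iint e^{is\cdot\xi}\rho(\xi)\alpha_{-s}(u)\,ds\,d\xi ,$$ an $\mathscr A_\theta$-valued oscillating integral: it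 is the element of $\mathscr A_\theta$ such that, for all $\varphi\in\mathscr A_\theta'$ and all $\chi\in C_c^\infty(\mathbb R^n\times\mathbb R^n)$ with $\chi(0,0)=1$, $$\varphi(P_\rho u)=\lim_{\epsilon\to0^+}(2\pi)^{-n}\iint e^{is\cdot\xi}\chi(\epsilon s,\epsilon\xi)\,\varphi\big(\rho(\xi)\alpha_{-s}(u)\big)\,ds\,d\xi .$$ Let $m\in\mathbb R$. The oscillating integral $P_\rho u$ exists for all $\rho\in\mathbb S^m(\mathbb R^n;\mathscr A_\theta)$ and $u\in\mathscr A_\theta$, and the following holds. 1. For every $s\in\mathbb R$ and every $\rho\in\mathbb S^m(\mathbb R^n;\mathscr A_\theta)$, the operator $P_\rho$ extends uniquely from $\mathscr A_\theta$ (which is contained in $\mathscr H_\theta^{(s+m)}$) to a continuous linear map $P_\rho:\mathscr H_\theta^{(s+m)}\to\mathscr H_\theta^{(s)}$. This provides a continuous linear map $\rho\mapsto P_\rho$ from $\mathbb S^m(\mathbb R^n;\mathscr A_\theta)$ to $\mathscr L(\mathscr H_\theta^{(s+m)},\mathscr H_\theta^{(s)})$ with its operator norm topology. 2. If $m<0$,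 then for every $\rho\in\mathbb S^m(\mathbb R^n;\mathscr A_\theta)$ the operator $P_\rho$ extends uniquely to a bounded operator on $\mathscr H_\theta$, and this operator is compact. -/

import Mathlib

noncomputable section

open scoped ContDiff Topology InnerProductSpace ENNReal
open MeasureTheory Filter

namespace NCTorus

/-- `ℝⁿ` with its Euclidean norm. -/
abbrev Eucl (n : ℕ) := EuclideanSpace ℝ (Fin n)

/-- The normalized measure of the torus. The torus `ℝⁿ / 2πℤⁿ` is realized as `(ℝ / ℤ)ⁿ` through
`x = 2πy`; the normalized Lebesgue measure `(2π)⁻ⁿ dx` becomes the Haar probability measure. -/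
abbrev haar (n : ℕ) : Measure (UnitAddTorus (Fin n)) :=
  Measure.pi fun _ => (AddCircle.haarAddCircle : Measure UnitAddCircle)

/-- The Hilbert space `L²(𝕋ⁿ)`. -/
abbrev L2 (n : ℕ) : Type := Lp ℂ 2 (haar n)

/-- The C⋆-algebra of bounded operators on `L²(𝕋ⁿ)` (the star is the adjoint). -/
abbrev Op (n : ℕ) := L2 n →L[ℂ] L2 n

variable {n : ℕ}

/-- The class of `s ∈ ℝⁿ` in `ℝⁿ / 2πℤⁿ`. -/
def toTorus (s : Eucl n) : UnitAddTorus (Fin n) :=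
  fun j => ((s j / (2 * Real.pi) : ℝ) : UnitAddCircle)

theorem toTorus_zero : toTorus (0 : Eucl n) = 0 := by
  ext j; simp [toTorus]

theorem toTorus_add (s t : Eucl n) : toTorus (s + t) = toTorus s + toTorus t := by
  ext j; simp [toTorus, add_div]

theorem measurePreserving_translate (s : Eucl n) :
    MeasurePreserving (fun x => x + toTorus s) (haar n) (haar n) :=
  measurePreserving_add_right (haar n) (toTorus s)

/-- `(V_s ξ)(x) = ξ(x + s)`. -/
def translateₗᵢ (s : Eucl n) : L2 n →ₗᵢ[ℂ] L2 n :=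
  Lp.compMeasurePreservingₗᵢ ℂ (fun x => x + toTorus s) (measurePreserving_translate s)

theorem translateₗᵢ_coeFn (s : Eucl n) (f : L2 n) :
    translateₗᵢ s f =ᵐ[haar n] fun x => f (x + toTorus s) :=
  Lp.coeFn_compMeasurePreserving f (measurePreserving_translate s)

theorem translateₗᵢ_add (s t : Eucl n) (f : L2 n) :
    translateₗᵢ s (translateₗᵢ t f) = translateₗᵢ (s + t) f := by
  apply Lp.ext
  have h1 := translateₗᵢ_coeFn s (translateₗᵢ t f)
  have h2 := (measurePreserving_translate s).quasiMeasurePreserving.ae (translateₗᵢ_coeFn t f)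
  have h3 := translateₗᵢ_coeFn (s + t) f
  filter_upwards [h1, h2, h3] with x h1 h2 h3
  rw [h1, h2, h3, toTorus_add, add_assoc]

theorem translateₗᵢ_zero (f : L2 n) : translateₗᵢ 0 f = f := by
  apply Lp.ext
  filter_upwards [translateₗᵢ_coeFn 0 f] with x h1
  rw [h1, toTorus_zero, add_zero]

/-- `V_s` as a unitary map; its inverse is `V_{-s}`. -/
def translateEquiv (s : Eucl n) : L2 n ≃ₗᵢ[ℂ] L2 n where
  toLinearEquiv := LinearEquiv.ofLinearMap (translateₗᵢ s).toLinearMap (translateₗᵢ (-s)).toLinearMap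
    (by ext1 f; simp [translateₗᵢ_add, translateₗᵢ_zero])
    (by ext1 f; simp [translateₗᵢ_add, translateₗᵢ_zero])
  norm_map' f := (translateₗᵢ s).norm_map f

theorem norm_mFourier_apply (k : Fin n → ℤ) (x : UnitAddTorus (Fin n)) :
    ‖UnitAddTorus.mFourier k x‖ = 1 := by
  simp only [UnitAddTorus.mFourier, ContinuousMap.coe_mk, norm_prod, fourier_apply,
    Circle.norm_coe, Finset.prod_const_one]

theorem memLp_char_mul (k : Fin n → ℤ) (f : L2 n) :
    MemLp (fun x => UnitAddTorus.mFourier k x * f x) 2 (haar n) :=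
  (Lp.memLp f).of_le
    ((UnitAddTorus.mFourier k).continuous.aestronglyMeasurable.mul (Lp.aestronglyMeasurable f))
    (Eventually.of_forall fun x => by simp [norm_mFourier_apply])

/-- Multiplication by the character `x ↦ e^{i k·x}`. -/
def mulCharₗᵢ (k : Fin n → ℤ) : L2 n →ₗᵢ[ℂ] L2 n where
  toFun f := (memLp_char_mul k f).toLp _
  map_add' f g := by
    apply Lp.ext
    filter_upwards [(memLp_char_mul k (f + g)).coeFn_toLp, (memLp_char_mul k f).coeFn_toLp,
      (memLp_char_mul k g).coeFn_toLp, Lp.coeFn_add f g, Lp.coeFn_add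
        ((memLp_char_mul k f).toLp _) ((memLp_char_mul k g).toLp _)] with x h1 h2 h3 h4 h5
    rw [h1, h5, Pi.add_apply, h2, h3, h4, Pi.add_apply, mul_add]
  map_smul' c f := by
    apply Lp.ext
    filter_upwards [(memLp_char_mul k (c • f)).coeFn_toLp, (memLp_char_mul k f).coeFn_toLp,
      Lp.coeFn_smul c f, Lp.coeFn_smul c ((memLp_char_mul k f).toLp _)] with x h1 h2 h3 h4
    rw [h1, RingHom.id_apply, h4, Pi.smul_apply, h2, h3, Pi.smul_apply, smul_eq_mul, smul_eq_mul,
      mul_left_comm]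
  norm_map' f := by
    change ‖(memLp_char_mul k f).toLp _‖ = ‖f‖
    rw [Lp.norm_toLp, Lp.norm_def]
    congr 1
    exact eLpNorm_congr_norm_ae (Eventually.of_forall fun x => by simp [norm_mFourier_apply])

theorem mulCharₗᵢ_coeFn (k : Fin n → ℤ) (f : L2 n) :
    mulCharₗᵢ k f =ᵐ[haar n] fun x => UnitAddTorus.mFourier k x * f x :=
  (memLp_char_mul k f).coeFn_toLp

theorem mulCharₗᵢ_add (k l : Fin n → ℤ) (f : L2 n) :
    mulCharₗᵢ k (mulCharₗᵢ l f) = mulCharₗᵢ (k + l) f := by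
  apply Lp.ext
  filter_upwards [mulCharₗᵢ_coeFn k (mulCharₗᵢ l f), mulCharₗᵢ_coeFn l f,
    mulCharₗᵢ_coeFn (k + l) f] with x h1 h2 h3
  rw [h1, h2, h3, UnitAddTorus.mFourier_add, mul_assoc]

theorem mulCharₗᵢ_zero (f : L2 n) : mulCharₗᵢ 0 f = f := by
  apply Lp.ext
  filter_upwards [mulCharₗᵢ_coeFn 0 f] with x h1
  rw [h1, UnitAddTorus.mFourier_zero, ContinuousMap.one_apply, one_mul]

/-- Multiplication by the character `x ↦ e^{i k·x}` as a unitary map. -/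
def mulCharEquiv (k : Fin n → ℤ) : L2 n ≃ₗᵢ[ℂ] L2 n where
  toLinearEquiv := LinearEquiv.ofLinearMap (mulCharₗᵢ k).toLinearMap (mulCharₗᵢ (-k)).toLinearMap
    (by ext1 f; simp [mulCharₗᵢ_add, mulCharₗᵢ_zero])
    (by ext1 f; simp [mulCharₗᵢ_add, mulCharₗᵢ_zero])
  norm_map' f := (mulCharₗᵢ k).norm_map f

theorem translateₗᵢ_mulCharₗᵢ (s : Eucl n) (j : Fin n) (f : L2 n) :
    translateₗᵢ s (mulCharₗᵢ (Pi.single j 1) f) =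
      Complex.exp (Complex.I * s j) • mulCharₗᵢ (Pi.single j 1) (translateₗᵢ s f) := by
  apply Lp.ext
  filter_upwards [translateₗᵢ_coeFn s (mulCharₗᵢ (Pi.single j 1) f),
    (measurePreserving_translate s).quasiMeasurePreserving.ae (mulCharₗᵢ_coeFn (Pi.single j 1) f),
    Lp.coeFn_smul (Complex.exp (Complex.I * s j)) (mulCharₗᵢ (Pi.single j 1) (translateₗᵢ s f)),
    mulCharₗᵢ_coeFn (Pi.single j 1) (translateₗᵢ s f), translateₗᵢ_coeFn s f] with x h1 h2 h3 h4 h5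
  have h : UnitAddTorus.mFourier (Pi.single j 1) (x + toTorus s) =
      Complex.exp (Complex.I * s j) * UnitAddTorus.mFourier (Pi.single j 1) x := by
    rw [UnitAddTorus.mFourier_single, UnitAddTorus.mFourier_single, Pi.add_apply]
    rw [fourier_one, fourier_one, AddCircle.toCircle_add, Circle.coe_mul, mul_comm]
    congr 1
    rw [toTorus, AddCircle.toCircle_apply_mk, Circle.coe_exp]
    congr 1
    have : (Real.pi : ℂ) ≠ 0 := by exact_mod_cast Real.pi_ne_zero
    push_cast
    field_simp
  rw [h1, h2, h3, Pi.smul_apply, h4, h5, h, smul_eq_mul, mul_assoc]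

/-- The translation `(V_s ξ)(x) = ξ(x + s)` as a unitary operator. -/
def V (s : Eucl n) : unitary (Op n) := Unitary.linearIsometryEquiv.symm (translateEquiv s)

/-- The unitary `(U_j ξ)(x) = e^{i x_j} ξ(x + π θ_j)`, where `θ_j` is the `j`-th column of `θ`. -/
def U (θ : Matrix (Fin n) (Fin n) ℝ) (j : Fin n) : unitary (Op n) :=
  Unitary.linearIsometryEquiv.symm (mulCharEquiv (Pi.single j 1)) *
    V (Real.pi • WithLp.toLp 2 (fun i => θ i j))

/-- `U^k = U_1^{k_1} ⋯ U_n^{k_n}` for `k ∈ ℤⁿ`. -/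
def Upow (θ : Matrix (Fin n) (Fin n) ℝ) (k : Fin n → ℤ) : unitary (Op n) :=
  (List.ofFn fun j => U θ j ^ k j).prod

/-- The action `α_s(T) = V_s T V_s⁻¹` of `ℝⁿ` on bounded operators. -/
def alpha (s : Eucl n) : Op n ≃⋆ₐ[ℂ] Op n := Unitary.conjStarAlgAut ℂ (Op n) (V s)

theorem V_add (s t : Eucl n) : V (s + t) = V s * V t := by
  rw [V, V, V, ← map_mul]
  congr 1
  ext1 f
  exact (translateₗᵢ_add s t f).symm

theorem V_zero : V (0 : Eucl n) = 1 := by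
  rw [V, ← map_one Unitary.linearIsometryEquiv.symm]
  congr 1
  ext1 f
  exact translateₗᵢ_zero f

theorem alpha_add (s t : Eucl n) (T : Op n) : alpha (s + t) T = alpha s (alpha t T) := by
  rw [alpha, V_add, map_mul]; rfl

theorem alpha_zero (T : Op n) : alpha 0 T = T := by
  rw [alpha, V_zero, map_one]; rfl

theorem alpha_U (θ : Matrix (Fin n) (Fin n) ℝ) (s : Eucl n) (j : Fin n) :
    alpha s (U θ j : Op n) = Complex.exp (Complex.I * s j) • (U θ j : Op n) := by
  set t : Eucl n := Real.pi • WithLp.toLp 2 (fun i => θ i j) with ht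
  have h : (V s : Op n) * (U θ j : Op n) =
      Complex.exp (Complex.I * s j) • ((U θ j : Op n) * (V s : Op n)) := by
    ext1 f
    change translateₗᵢ s (mulCharₗᵢ (Pi.single j 1) (translateₗᵢ t f)) =
      Complex.exp (Complex.I * s j) • mulCharₗᵢ (Pi.single j 1) (translateₗᵢ t (translateₗᵢ s f))
    rw [translateₗᵢ_mulCharₗᵢ, translateₗᵢ_add, translateₗᵢ_add, add_comm]
  rw [alpha, Unitary.conjStarAlgAut_apply, h, smul_mul_assoc, mul_assoc]
  simp

/-- The noncommutative torus `A_θ`: the C⋆-algebra generated by `U_1, …, U_n`. -/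
def ncTorus (θ : Matrix (Fin n) (Fin n) ℝ) : StarSubalgebra ℂ (Op n) :=
  (StarAlgebra.adjoin ℂ (Set.range fun j => (U θ j : Op n))).topologicalClosure

theorem U_mem_ncTorus (θ : Matrix (Fin n) (Fin n) ℝ) (j : Fin n) : (U θ j : Op n) ∈ ncTorus θ :=
  StarSubalgebra.le_topologicalClosure _ (StarAlgebra.subset_adjoin ℂ _ ⟨j, rfl⟩)

theorem continuous_alpha (s : Eucl n) : Continuous (alpha s : Op n → Op n) := by
  change Continuous fun T : Op n => (V s : Op n) * T * (star (V s) : Op n)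
  fun_prop

theorem alpha_mem_ncTorus (θ : Matrix (Fin n) (Fin n) ℝ) (s : Eucl n) {T : Op n}
    (hT : T ∈ ncTorus θ) : alpha s T ∈ ncTorus θ := by
  have h1 : StarAlgebra.adjoin ℂ (Set.range fun j => (U θ j : Op n)) ≤
      (ncTorus θ).comap (alpha s : Op n →⋆ₐ[ℂ] Op n) := by
    rw [StarAlgebra.adjoin_le_iff]
    rintro _ ⟨j, rfl⟩
    change alpha s (U θ j : Op n) ∈ ncTorus θ
    rw [alpha_U]
    exact (ncTorus θ).smul_mem (U_mem_ncTorus θ j) _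
  have h2 : IsClosed (((ncTorus θ).comap (alpha s : Op n →⋆ₐ[ℂ] Op n) : StarSubalgebra ℂ (Op n))
      : Set (Op n)) :=
    (StarSubalgebra.isClosed_topologicalClosure _).preimage (continuous_alpha s)
  exact StarSubalgebra.topologicalClosure_minimal h1 h2 hT

theorem contDiff_star_op : ContDiff ℝ ∞ (star : Op n → Op n) := by
  have h : IsBoundedLinearMap ℝ (star : Op n → Op n) :=
    { map_add := star_add
      map_smul := fun c T => by
        have h1 : ∀ S : Op n, c • S = (c : ℂ) • S := fun S => rfl
        rw [h1, h1, star_smul]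
        congr 1
        exact Complex.conj_ofReal c
      bound := ⟨1, one_pos, fun T => by
        rw [one_mul]
        exact (ContinuousLinearMap.adjoint.norm_map T).le⟩ }
  exact h.contDiff

/-- The smooth noncommutative torus: all `u ∈ A_θ` such that `s ↦ α_s(u)` is `C^∞`. -/
def smoothSubalgebra (θ : Matrix (Fin n) (Fin n) ℝ) : StarSubalgebra ℂ (Op n) where
  carrier := {u | u ∈ ncTorus θ ∧ ContDiff ℝ ∞ fun s : Eucl n => alpha s u}
  mul_mem' := fun ⟨h1, h2⟩ ⟨h3, h4⟩ => ⟨mul_mem h1 h3, by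
    simp only [map_mul]
    exact h2.mul h4⟩
  add_mem' := fun ⟨h1, h2⟩ ⟨h3, h4⟩ => ⟨add_mem h1 h3, by
    simp only [map_add]
    exact h2.add h4⟩
  algebraMap_mem' c := ⟨(ncTorus θ).algebraMap_mem c, by
    simp only [AlgHomClass.commutes]
    exact contDiff_const⟩
  star_mem' := fun ⟨h1, h2⟩ => ⟨star_mem h1, by
    simp only [map_star]
    exact contDiff_star_op.comp h2⟩

theorem U_mem_smooth (θ : Matrix (Fin n) (Fin n) ℝ) (j : Fin n) :
    (U θ j : Op n) ∈ smoothSubalgebra θ := by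
  refine ⟨U_mem_ncTorus θ j, ?_⟩
  simp only [alpha_U]
  have h : ContDiff ℝ ∞ fun s : Eucl n => Complex.exp (Complex.I * s j) :=
    ContDiff.cexp (contDiff_const.mul
      (Complex.ofRealCLM.contDiff.comp (EuclideanSpace.proj j : Eucl n →L[ℝ] ℝ).contDiff))
  exact h.smul contDiff_const

theorem Upow_mem_smooth (θ : Matrix (Fin n) (Fin n) ℝ) (k : Fin n → ℤ) :
    (Upow θ k : Op n) ∈ smoothSubalgebra θ := by
  let G : Subgroup (unitary (Op n)) :=
    { carrier := {u | (u : Op n) ∈ smoothSubalgebra θ}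
      mul_mem' := fun {x y} h1 h2 =>
        (mul_mem h1 h2 : (x : Op n) * (y : Op n) ∈ smoothSubalgebra θ)
      one_mem' := (smoothSubalgebra θ).one_mem
      inv_mem' := fun {x} h => (star_mem h : star (x : Op n) ∈ smoothSubalgebra θ) }
  change Upow θ k ∈ G
  refine G.list_prod_mem fun x hx => ?_
  obtain ⟨j, rfl⟩ := List.mem_ofFn.1 hx
  exact G.zpow_mem (U_mem_smooth θ j) _

theorem alpha_mem_smooth (θ : Matrix (Fin n) (Fin n) ℝ) (t : Eucl n) {u : Op n}
    (hu : u ∈ smoothSubalgebra θ) : alpha t u ∈ smoothSubalgebra θ := by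
  refine ⟨alpha_mem_ncTorus θ t hu.1, ?_⟩
  have h : (fun s : Eucl n => alpha s (alpha t u)) = (fun s => alpha s u) ∘ fun s => s + t := by
    ext1 s
    exact (alpha_add s t u).symm
  rw [h]
  exact hu.2.comp (contDiff_id.add contDiff_const)

/-- `δ_j(u) = (1/i) ∂_{s_j} α_s(u)` at `s = 0`. -/
def deltaOp (j : Fin n) (u : Op n) : Op n :=
  -Complex.I • lineDeriv ℝ (fun s : Eucl n => alpha s u) 0 (EuclideanSpace.single j 1)

theorem hasLineDerivAt_alpha {θ : Matrix (Fin n) (Fin n) ℝ} {u : Op n}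
    (hu : u ∈ smoothSubalgebra θ) (s v : Eucl n) :
    HasLineDerivAt ℝ (fun s : Eucl n => alpha s u) (fderiv ℝ (fun s : Eucl n => alpha s u) s v)
      s v :=
  (hu.2.differentiable (by simp) s).hasFDerivAt.hasLineDerivAt v

theorem alpha_deltaOp {θ : Matrix (Fin n) (Fin n) ℝ} {u : Op n}
    (hu : u ∈ smoothSubalgebra θ) (j : Fin n) (s : Eucl n) :
    alpha s (deltaOp j u) = -Complex.I •
      fderiv ℝ (fun s : Eucl n => alpha s u) s (EuclideanSpace.single j 1) := by
  rw [deltaOp, map_smul]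
  congr 1
  rw [(hasLineDerivAt_alpha hu 0 _).lineDeriv]
  set e : Eucl n := EuclideanSpace.single j 1
  have h1 := (hasLineDerivAt_alpha hu 0 e).tendsto_slope_zero
  have h2 := (hasLineDerivAt_alpha hu s e).tendsto_slope_zero
  have h3 := ((continuous_alpha s).tendsto _).comp h1
  refine tendsto_nhds_unique h3 (h2.congr fun t => ?_)
  have h4 : ∀ (c : ℝ) (T : Op n), alpha s (c • T) = c • alpha s T :=
    fun c T => map_smul (alpha s) (c : ℂ) T
  simp only [Function.comp_apply, h4, map_sub, ← alpha_add, zero_add, add_zero]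

theorem deltaOp_mem_smooth {θ : Matrix (Fin n) (Fin n) ℝ} {u : Op n}
    (hu : u ∈ smoothSubalgebra θ) (j : Fin n) : deltaOp j u ∈ smoothSubalgebra θ := by
  constructor
  · refine (ncTorus θ).smul_mem ?_ _
    rw [(hasLineDerivAt_alpha hu 0 _).lineDeriv]
    set e : Eucl n := EuclideanSpace.single j 1
    have h1 := (hasLineDerivAt_alpha hu 0 e).tendsto_slope_zero
    refine (StarSubalgebra.isClosed_topologicalClosure _).mem_of_tendsto h1
      (Eventually.of_forall fun t => ?_)
    exact (ncTorus θ).smul_mem (sub_mem (alpha_mem_ncTorus θ _ hu.1)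
      (alpha_mem_ncTorus θ _ hu.1)) ((t⁻¹ : ℝ) : ℂ)
  · simp only [alpha_deltaOp hu]
    have h : ContDiff ℝ ∞ fun s : Eucl n =>
        fderiv ℝ (fun s : Eucl n => alpha s u) s (EuclideanSpace.single j 1) :=
      (hu.2.fderiv_right (m := ∞) (by simp)).clm_apply contDiff_const
    exact h.const_smul (-Complex.I)

/-- The smooth noncommutative torus as a type of its own; it carries its Fréchet topology (below),
not the topology of the operator norm. -/
def SmoothTorus (θ : Matrix (Fin n) (Fin n) ℝ) : Type := smoothSubalgebra θ

namespace SmoothTorus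

variable {θ : Matrix (Fin n) (Fin n) ℝ}

instance : Ring (SmoothTorus θ) := inferInstanceAs (Ring (smoothSubalgebra θ))
instance : StarRing (SmoothTorus θ) := inferInstanceAs (StarRing (smoothSubalgebra θ))
instance : Algebra ℂ (SmoothTorus θ) := inferInstanceAs (Algebra ℂ (smoothSubalgebra θ))

/-- The inclusion of the smooth noncommutative torus into the bounded operators. -/
def toOp : SmoothTorus θ →ₗ[ℂ] Op n := (smoothSubalgebra θ).toSubalgebra.toSubmodule.subtype

theorem toOp_mem (u : SmoothTorus θ) : toOp u ∈ smoothSubalgebra θ := u.2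

theorem toOp_injective : Function.Injective (toOp (θ := θ)) := Subtype.val_injective

/-- The derivation `δ_j` of the smooth noncommutative torus. -/
def delta (j : Fin n) : SmoothTorus θ →ₗ[ℂ] SmoothTorus θ where
  toFun u := ⟨deltaOp j (toOp u), deltaOp_mem_smooth u.2 j⟩
  map_add' u v := toOp_injective (by
    change deltaOp j (toOp u + toOp v) = deltaOp j (toOp u) + deltaOp j (toOp v)
    rw [deltaOp, deltaOp, deltaOp, ← smul_add]
    congr 1
    rw [(hasLineDerivAt_alpha (toOp_mem u) 0 _).lineDeriv,
      (hasLineDerivAt_alpha (toOp_mem v) 0 _).lineDeriv]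
    simp only [map_add]
    exact HasLineDerivAt.lineDeriv (HasDerivAt.add (hasLineDerivAt_alpha (toOp_mem u) 0 _)
      (hasLineDerivAt_alpha (toOp_mem v) 0 _)))
  map_smul' c u := toOp_injective (by
    change deltaOp j (c • toOp u) = c • deltaOp j (toOp u)
    rw [deltaOp, deltaOp, smul_comm c]
    congr 1
    rw [(hasLineDerivAt_alpha (toOp_mem u) 0 _).lineDeriv]
    simp only [map_smul]
    exact HasLineDerivAt.lineDeriv
      (HasDerivAt.const_smul c (hasLineDerivAt_alpha (toOp_mem u) 0 _)))

/-- The word `1…1 2…2 ⋯ n…n` in which `j` is repeated `β_j` times. -/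
def word (β : Fin n → ℕ) : List (Fin n) :=
  (List.finRange n).flatMap fun j => List.replicate (β j) j

/-- `δ^β = δ_1^{β_1} ⋯ δ_n^{β_n}`. -/
def deltaPow (β : Fin n → ℕ) : SmoothTorus θ →ₗ[ℂ] SmoothTorus θ :=
  ((word β).map delta).prod

/-- The seminorms `u ↦ ‖δ^β(u)‖`, in the operator norm. -/
def seminorms (θ : Matrix (Fin n) (Fin n) ℝ) :
    SeminormFamily ℂ (SmoothTorus θ) (Fin n → ℕ) :=
  fun β => (normSeminorm ℂ (Op n)).comp (toOp ∘ₗ deltaPow β)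

/-- The locally convex topology generated by the seminorms `‖δ^β(u)‖`. -/
instance : TopologicalSpace (SmoothTorus θ) := (seminorms θ).moduleFilterBasis.topology

theorem withSeminorms (θ : Matrix (Fin n) (Fin n) ℝ) : WithSeminorms (seminorms θ) := ⟨rfl⟩

instance : IsTopologicalAddGroup (SmoothTorus θ) := (withSeminorms θ).topologicalAddGroup
instance : ContinuousSMul ℂ (SmoothTorus θ) := (withSeminorms θ).continuousSMul

theorem seminorms_zero_apply (u : SmoothTorus θ) : seminorms θ 0 u = ‖toOp u‖ := by
  have h : word (0 : Fin n → ℕ) = [] := by simp [word]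
  change ‖toOp (deltaPow 0 u)‖ = ‖toOp u‖
  rw [deltaPow, h]
  rfl

instance : T1Space (SmoothTorus θ) :=
  (withSeminorms θ).T1_of_separating fun u hu => ⟨0, by
    rw [seminorms_zero_apply, norm_ne_zero_iff]
    exact fun h => hu (toOp_injective (h.trans (map_zero _).symm))⟩

instance : T2Space (SmoothTorus θ) := inferInstance

theorem continuous_toOp : Continuous (toOp (θ := θ)) := by
  refine WithSeminorms.continuous_of_isBounded (withSeminorms θ) (norm_withSeminorms ℂ (Op n)) _ ?_
  refine fun _ => ⟨{0}, 1, fun u => ?_⟩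
  rw [Finset.sup_singleton, one_smul]
  exact (seminorms_zero_apply u).ge

/-- The action `α_s` on the smooth noncommutative torus. -/
def act (s : Eucl n) (u : SmoothTorus θ) : SmoothTorus θ := ⟨alpha s (toOp u), alpha_mem_smooth θ s u.2⟩

/-- `U^k` as an element of the smooth noncommutative torus. -/
def monomial (θ : Matrix (Fin n) (Fin n) ℝ) (k : Fin n → ℤ) : SmoothTorus θ :=
  ⟨Upow θ k, Upow_mem_smooth θ k⟩

end SmoothTorus

/-- The state `τ(T) = ⟨T 1, 1⟩`. -/
def tau : Op n →L[ℂ] ℂ :=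
  (innerSL ℂ (Lp.const 2 (haar n) (1 : ℂ))).comp
    (ContinuousLinearMap.apply ℂ (L2 n) (Lp.const 2 (haar n) (1 : ℂ)))

theorem tau_apply (T : Op n) :
    tau T = ⟪Lp.const 2 (haar n) (1 : ℂ), T (Lp.const 2 (haar n) (1 : ℂ))⟫_ℂ := rfl

/-- The span `𝒜_θ⁰` of the unitaries `U^k`, to be normed by `⟨u, v⟩ = τ(u v⋆)`. -/
def PolyTorus (θ : Matrix (Fin n) (Fin n) ℝ) : Type :=
  Submodule.span ℂ (Set.range fun k => (Upow θ k : Op n))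

namespace PolyTorus

variable {θ : Matrix (Fin n) (Fin n) ℝ}

instance : AddCommGroup (PolyTorus θ) := inferInstanceAs (AddCommGroup (Submodule.span ℂ _))
instance : Module ℂ (PolyTorus θ) := inferInstanceAs (Module ℂ (Submodule.span ℂ _))

/-- The inclusion of the span into the bounded operators. -/
def toOp : PolyTorus θ →ₗ[ℂ] Op n := (Submodule.span ℂ _).subtype

/-- The pre-inner product `τ(u v⋆)`, linear in `u` and conjugate linear in `v`. Mathlib's inner
products are conjugate linear in the first variable, so it is `inner v u`. -/
@[reducible] def core (θ : Matrix (Fin n) (Fin n) ℝ) : PreInnerProductSpace.Core ℂ (PolyTorus θ) where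
  inner u v := tau (toOp v * star (toOp u))
  conj_inner_symm u v := by
    rw [tau_apply, tau_apply, inner_conj_symm, ← ContinuousLinearMap.adjoint_inner_left,
      ← ContinuousLinearMap.star_eq_adjoint, star_mul, star_star]
  re_inner_nonneg u := by
    rw [tau_apply, mul_apply_eq_comp, ← ContinuousLinearMap.adjoint_inner_left,
      ← ContinuousLinearMap.star_eq_adjoint]
    exact inner_self_nonneg
  add_left u v w := by rw [map_add, star_add, mul_add, map_add]
  smul_left u v c := by rw [map_smul, star_smul, mul_smul_comm, map_smul]; rfl

instance : SeminormedAddCommGroup (PolyTorus θ) :=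
  InnerProductSpace.Core.toSeminormedAddCommGroup (c := core θ)
instance : InnerProductSpace ℂ (PolyTorus θ) := InnerProductSpace.ofCore (core θ)

theorem inner_def (u v : PolyTorus θ) : ⟪u, v⟫_ℂ = tau (toOp v * star (toOp u)) := rfl

/-- Elements of the span. -/
def ofMem {T : Op n} (hT : T ∈ Submodule.span ℂ (Set.range fun k => (Upow θ k : Op n))) :
    PolyTorus θ := ⟨T, hT⟩

/-- `U^k` as an element of the span. -/
def monomial (θ : Matrix (Fin n) (Fin n) ℝ) (k : Fin n → ℤ) : PolyTorus θ :=
  ofMem (Submodule.subset_span ⟨k, rfl⟩)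

end PolyTorus

/-- The Hilbert space `ℋ_θ`: the completion of the span of the `U^k` for `τ(u v⋆)`. -/
abbrev HTheta (θ : Matrix (Fin n) (Fin n) ℝ) : Type := UniformSpace.Completion (PolyTorus θ)

/-- `U^k` as an element of `ℋ_θ`. The Fourier coefficient `h_k` of `h ∈ ℋ_θ` is `inner (U^k) h`. -/
def HTheta.monomial (θ : Matrix (Fin n) (Fin n) ℝ) (k : Fin n → ℤ) : HTheta θ :=
  (PolyTorus.monomial θ k : HTheta θ)

theorem HTheta.ext_coeff {θ : Matrix (Fin n) (Fin n) ℝ} {g h : HTheta θ}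
    (H : ∀ k, ⟪HTheta.monomial θ k, g⟫_ℂ = ⟪HTheta.monomial θ k, h⟫_ℂ) : g = h := by
  have h1 : ∀ (T : Op n) (hT : T ∈ Submodule.span ℂ (Set.range fun k => (Upow θ k : Op n))),
      ⟪(PolyTorus.ofMem hT : HTheta θ), g⟫_ℂ = ⟪(PolyTorus.ofMem hT : HTheta θ), h⟫_ℂ := by
    intro T hT
    induction hT using Submodule.span_induction with
    | mem x hx => obtain ⟨k, rfl⟩ := hx; exact H k
    | zero =>
      have : PolyTorus.ofMem (θ := θ) (Submodule.zero_mem _) = 0 := rfl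
      rw [this, UniformSpace.Completion.coe_zero, inner_zero_left, inner_zero_left]
    | add x y hx hy ihx ihy =>
      have : PolyTorus.ofMem (Submodule.add_mem _ hx hy) =
        PolyTorus.ofMem hx + PolyTorus.ofMem hy := rfl
      rw [this, UniformSpace.Completion.coe_add, inner_add_left, inner_add_left, ihx, ihy]
    | smul c x hx ihx =>
      have : PolyTorus.ofMem (Submodule.smul_mem _ c hx) = c • PolyTorus.ofMem hx := rfl
      rw [this, UniformSpace.Completion.coe_smul, inner_smul_left, inner_smul_left, ihx]
  refine ext_inner_left ℂ fun v => ?_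
  induction v using UniformSpace.Completion.induction_on with
  | hp => exact isClosed_eq (by fun_prop) (by fun_prop)
  | ih u => exact h1 u.1 u.2

/-- The topological dual `𝒜_θ'` of the smooth noncommutative torus. -/
abbrev Dual (θ : Matrix (Fin n) (Fin n) ℝ) : Type := SmoothTorus θ →L[ℂ] ℂ

namespace SmoothTorus

variable {θ : Matrix (Fin n) (Fin n) ℝ}

/-- The embedding of `𝒜_θ` into `𝒜_θ'`: `⟨u, v⟩ = τ(u v)`. -/
def toDual : SmoothTorus θ →ₗ[ℂ] Dual θ where
  toFun u :=
    { toFun := fun v => tau (toOp (u * v))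
      map_add' := fun v w => by rw [mul_add, map_add, map_add]
      map_smul' := fun c v => by rw [mul_smul_comm, map_smul, map_smul]; rfl
      cont := tau.continuous.comp (((ContinuousLinearMap.mul ℂ (Op n)) (toOp u)).continuous.comp continuous_toOp) }
  map_add' u v := by ext w; change tau (toOp ((u + v) * w)) = tau (toOp (u * w)) + tau (toOp (v * w)); rw [add_mul, map_add, map_add]
  map_smul' c u := by ext w; change tau (toOp ((c • u) * w)) = c • tau (toOp (u * w)); rw [smul_mul_assoc, map_smul, map_smul]

end SmoothTorus

/-- The Fourier coefficient `u_k = ⟨u, (U^k)⋆⟩` of `u ∈ 𝒜_θ'`. -/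
def Dual.coeff {θ : Matrix (Fin n) (Fin n) ℝ} (u : Dual θ) (k : Fin n → ℤ) : ℂ :=
  u (star (SmoothTorus.monomial θ k))

/-- `(1 + |k|²)^{s/2}`, the eigenvalue of `Λ^s = (1 + Δ)^{s/2}` on `U^k`. -/
def bracket (s : ℝ) (k : Fin n → ℤ) : ℝ := (1 + ∑ j, (k j : ℝ) ^ 2) ^ (s / 2)

/-- The Sobolev space `ℋ_θ^{(s)}` of all `u ∈ 𝒜_θ'` such that `Λ^s u ∈ ℋ_θ`. Here `Λ^s u` is the
element of `𝒜_θ'` with the Fourier coefficients `(1 + |k|²)^{s/2} u_k`; elements of `ℋ_θ` and of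
`𝒜_θ'` are identified when they have the same Fourier coefficients. -/
def sobolevSubmodule (θ : Matrix (Fin n) (Fin n) ℝ) (s : ℝ) : Submodule ℂ (Dual θ) where
  carrier := {u | ∃ h : HTheta θ, ∀ k, ⟪HTheta.monomial θ k, h⟫_ℂ = bracket s k * u.coeff k}
  zero_mem' := ⟨0, fun k => by simp [Dual.coeff]⟩
  add_mem' := by
    rintro u v ⟨g, hg⟩ ⟨h, hh⟩
    refine ⟨g + h, fun k => ?_⟩
    rw [inner_add_right, hg, hh, Dual.coeff, Dual.coeff, Dual.coeff, add_apply, mul_add]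
  smul_mem' := by
    rintro c u ⟨g, hg⟩
    refine ⟨c • g, fun k => ?_⟩
    rw [inner_smul_right, hg, Dual.coeff, Dual.coeff, smul_apply, smul_eq_mul, mul_left_comm]

/-- The Sobolev space `ℋ_θ^{(s)}` with its own norm (below). -/
def SobolevSpace (θ : Matrix (Fin n) (Fin n) ℝ) (s : ℝ) : Type := sobolevSubmodule θ s

namespace SobolevSpace

variable {θ : Matrix (Fin n) (Fin n) ℝ} {s : ℝ}

instance : AddCommGroup (SobolevSpace θ s) := inferInstanceAs (AddCommGroup (sobolevSubmodule θ s))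
instance : Module ℂ (SobolevSpace θ s) := inferInstanceAs (Module ℂ (sobolevSubmodule θ s))

/-- The inclusion of `ℋ_θ^{(s)}` into `𝒜_θ'`. -/
def toDual : SobolevSpace θ s →ₗ[ℂ] Dual θ := (sobolevSubmodule θ s).subtype

theorem exists_Lambda (u : SobolevSpace θ s) :
    ∃ h : HTheta θ, ∀ k, ⟪HTheta.monomial θ k, h⟫_ℂ = bracket s k * (toDual u).coeff k := u.2

/-- `Λ^s : ℋ_θ^{(s)} → ℋ_θ`. -/
def Lambda (θ : Matrix (Fin n) (Fin n) ℝ) (s : ℝ) : SobolevSpace θ s →ₗ[ℂ] HTheta θ where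
  toFun u := (exists_Lambda u).choose
  map_add' u v := HTheta.ext_coeff fun k => by
    rw [inner_add_right, (exists_Lambda (u + v)).choose_spec, (exists_Lambda u).choose_spec,
      (exists_Lambda v).choose_spec, map_add, ← mul_add]
    rfl
  map_smul' c u := HTheta.ext_coeff fun k => by
    rw [RingHom.id_apply, inner_smul_right, (exists_Lambda (c • u)).choose_spec,
      (exists_Lambda u).choose_spec, map_smul, mul_left_comm]
    rfl

/-- The norm `‖u‖_s = ‖Λ^s u‖` of `ℋ_θ^{(s)}`. (It is a norm, as an element of `𝒜_θ'` is determined by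
its Fourier coefficients; this is not needed to write it down.) -/
instance : SeminormedAddCommGroup (SobolevSpace θ s) :=
  SeminormedAddCommGroup.induced _ _ (Lambda θ s)
instance : NormedSpace ℂ (SobolevSpace θ s) := NormedSpace.induced _ _ _ (Lambda θ s)

theorem norm_def (u : SobolevSpace θ s) : ‖u‖ = ‖Lambda θ s u‖ := rfl

end SobolevSpace

section Symbols

variable {θ : Matrix (Fin n) (Fin n) ℝ}

/-- `y` is the partial derivative `∂_j f(ξ)`: the limit of the difference quotients in the Fréchet
topology. -/
def HasPartialAt (f : Eucl n → SmoothTorus θ) (y : SmoothTorus θ) (j : Fin n) (ξ : Eucl n) : Prop :=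
  Tendsto (fun t : ℝ => ((t⁻¹ : ℝ) : ℂ) • (f (ξ + t • EuclideanSpace.single j 1) - f ξ))
    (𝓝[≠] 0) (𝓝 y)

open Classical in
/-- The partial derivative `∂_j f` (zero where the limit does not exist). -/
def partialDeriv (j : Fin n) (f : Eucl n → SmoothTorus θ) (ξ : Eucl n) : SmoothTorus θ :=
  if h : ∃ y, HasPartialAt f y j ξ then h.choose else 0

theorem HasPartialAt.partialDeriv_eq {f : Eucl n → SmoothTorus θ} {y : SmoothTorus θ} {j : Fin n}
    {ξ : Eucl n} (h : HasPartialAt f y j ξ) : partialDeriv j f ξ = y := by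
  have h' : ∃ y, HasPartialAt f y j ξ := ⟨y, h⟩
  rw [partialDeriv, dif_pos h']
  exact tendsto_nhds_unique h'.choose_spec h

/-- The iterated partial derivative `∂_{j_1} ⋯ ∂_{j_r} f` for the word `j_1 … j_r`. -/
def partialWord (w : List (Fin n)) (f : Eucl n → SmoothTorus θ) : Eucl n → SmoothTorus θ :=
  w.foldr partialDeriv f

/-- `∂^β f = ∂_1^{β_1} ⋯ ∂_n^{β_n} f`. -/
def partialPow (β : Fin n → ℕ) (f : Eucl n → SmoothTorus θ) : Eucl n → SmoothTorus θ :=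
  partialWord (SmoothTorus.word β) f

/-- `f ∈ C^∞(ℝⁿ; 𝒜_θ)`: all iterated partial derivatives exist and are continuous. -/
def IsSmooth (f : Eucl n → SmoothTorus θ) : Prop :=
  ∀ w : List (Fin n), Continuous (partialWord w f) ∧
    ∀ j ξ, ∃ y, HasPartialAt (partialWord w f) y j ξ

theorem IsSmooth.hasPartialAt {f : Eucl n → SmoothTorus θ} (hf : IsSmooth f) (w : List (Fin n))
    (j : Fin n) (ξ : Eucl n) :
    HasPartialAt (partialWord w f) (partialWord (j :: w) f ξ) j ξ := by
  obtain ⟨y, hy⟩ := (hf w).2 j ξ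
  change HasPartialAt _ (partialDeriv j (partialWord w f) ξ) j ξ
  rwa [hy.partialDeriv_eq]

theorem partialWord_zero (w : List (Fin n)) : partialWord w (0 : Eucl n → SmoothTorus θ) = 0 := by
  induction w with
  | nil => rfl
  | cons j w ih =>
    ext1 ξ
    change partialDeriv j (partialWord w 0) ξ = 0
    rw [ih]
    refine HasPartialAt.partialDeriv_eq ?_
    simp [HasPartialAt]

theorem HasPartialAt.add {f g : Eucl n → SmoothTorus θ} {y z : SmoothTorus θ} {j : Fin n}
    {ξ : Eucl n} (hf : HasPartialAt f y j ξ) (hg : HasPartialAt g z j ξ) :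
    HasPartialAt (f + g) (y + z) j ξ := by
  refine (Tendsto.add hf hg).congr fun t => ?_
  rw [← smul_add, Pi.add_apply, Pi.add_apply]
  congr 1
  abel

theorem HasPartialAt.const_smul {f : Eucl n → SmoothTorus θ} {y : SmoothTorus θ} {j : Fin n}
    {ξ : Eucl n} (c : ℂ) (hf : HasPartialAt f y j ξ) : HasPartialAt (c • f) (c • y) j ξ := by
  refine (Tendsto.const_smul hf c).congr fun t => ?_
  rw [smul_comm c, smul_sub]
  rfl

theorem partialWord_add {f g : Eucl n → SmoothTorus θ} (hf : IsSmooth f) (hg : IsSmooth g)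
    (w : List (Fin n)) : partialWord w (f + g) = partialWord w f + partialWord w g := by
  induction w with
  | nil => rfl
  | cons j w ih =>
    ext1 ξ
    change partialDeriv j (partialWord w (f + g)) ξ = _
    rw [ih]
    exact ((hf.hasPartialAt w j ξ).add (hg.hasPartialAt w j ξ)).partialDeriv_eq

theorem partialWord_smul {f : Eucl n → SmoothTorus θ} (c : ℂ) (hf : IsSmooth f)
    (w : List (Fin n)) : partialWord w (c • f) = c • partialWord w f := by
  induction w with
  | nil => rfl
  | cons j w ih =>
    ext1 ξ
    change partialDeriv j (partialWord w (c • f)) ξ = _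
    rw [ih]
    exact ((hf.hasPartialAt w j ξ).const_smul c).partialDeriv_eq

theorem IsSmooth.zero : IsSmooth (0 : Eucl n → SmoothTorus θ) := fun w => by
  rw [partialWord_zero]
  exact ⟨continuous_const, fun j ξ => ⟨0, by simp [HasPartialAt]⟩⟩

theorem IsSmooth.add {f g : Eucl n → SmoothTorus θ} (hf : IsSmooth f) (hg : IsSmooth g) :
    IsSmooth (f + g) := fun w => by
  rw [partialWord_add hf hg]
  exact ⟨(hf w).1.add (hg w).1, fun j ξ =>
    ⟨_, (hf.hasPartialAt w j ξ).add (hg.hasPartialAt w j ξ)⟩⟩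

theorem IsSmooth.const_smul {f : Eucl n → SmoothTorus θ} (c : ℂ) (hf : IsSmooth f) :
    IsSmooth (c • f) := fun w => by
  rw [partialWord_smul c hf]
  exact ⟨(hf w).1.const_smul c, fun j ξ => ⟨_, (hf.hasPartialAt w j ξ).const_smul c⟩⟩

/-- `(1 + |ξ|)^{-m+|β|} ‖δ^α ∂^β ρ(ξ)‖`. -/
def weighted (m : ℝ) (α β : Fin n → ℕ) (ρ : Eucl n → SmoothTorus θ) (ξ : Eucl n) : ℝ :=
  (1 + ‖ξ‖) ^ (-m + ∑ j, (β j : ℝ)) *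
    ‖SmoothTorus.toOp (SmoothTorus.deltaPow α (partialPow β ρ ξ))‖

theorem weighted_nonneg (m : ℝ) (α β : Fin n → ℕ) (ρ : Eucl n → SmoothTorus θ) (ξ : Eucl n) :
    0 ≤ weighted m α β ρ ξ := by
  unfold weighted; positivity

theorem weighted_zero (m : ℝ) (α β : Fin n → ℕ) (ξ : Eucl n) :
    weighted m α β (0 : Eucl n → SmoothTorus θ) ξ = 0 := by
  simp [weighted, partialPow, partialWord_zero]

theorem weighted_add_le (m : ℝ) (α β : Fin n → ℕ) {ρ σ : Eucl n → SmoothTorus θ}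
    (hρ : IsSmooth ρ) (hσ : IsSmooth σ) (ξ : Eucl n) :
    weighted m α β (ρ + σ) ξ ≤ weighted m α β ρ ξ + weighted m α β σ ξ := by
  rw [weighted, weighted, weighted, ← mul_add, partialPow, partialWord_add hρ hσ, Pi.add_apply,
    map_add, map_add]
  exact mul_le_mul_of_nonneg_left (norm_add_le _ _) (by positivity)

theorem weighted_smul (m : ℝ) (α β : Fin n → ℕ) {ρ : Eucl n → SmoothTorus θ} (c : ℂ)
    (hρ : IsSmooth ρ) (ξ : Eucl n) :
    weighted m α β (c • ρ) ξ = ‖c‖ * weighted m α β ρ ξ := by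
  rw [weighted, weighted, partialPow, partialWord_smul c hρ, Pi.smul_apply, map_smul, map_smul,
    norm_smul, mul_left_comm]
  rfl

/-- The standard symbols of order `m`: `‖δ^α ∂^β ρ(ξ)‖ ≤ C_{αβ} (1 + |ξ|)^{m-|β|}`. -/
def symbolSubmodule (θ : Matrix (Fin n) (Fin n) ℝ) (m : ℝ) :
    Submodule ℂ (Eucl n → SmoothTorus θ) where
  carrier := {ρ | IsSmooth ρ ∧ ∀ α β : Fin n → ℕ, ∃ C : ℝ, ∀ ξ : Eucl n,
    ‖SmoothTorus.toOp (SmoothTorus.deltaPow α (partialPow β ρ ξ))‖ ≤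
      C * (1 + ‖ξ‖) ^ (m - ∑ j, (β j : ℝ))}
  zero_mem' := ⟨IsSmooth.zero, fun α β => ⟨0, fun ξ => by simp [partialPow, partialWord_zero]⟩⟩
  add_mem' := by
    rintro ρ σ ⟨hρ, hρ'⟩ ⟨hσ, hσ'⟩
    refine ⟨hρ.add hσ, fun α β => ?_⟩
    obtain ⟨C, hC⟩ := hρ' α β
    obtain ⟨D, hD⟩ := hσ' α β
    refine ⟨C + D, fun ξ => ?_⟩
    rw [partialPow, partialWord_add hρ hσ, Pi.add_apply, map_add, map_add, add_mul]
    exact (norm_add_le _ _).trans (add_le_add (hC ξ) (hD ξ))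
  smul_mem' := by
    rintro c ρ ⟨hρ, hρ'⟩
    refine ⟨hρ.const_smul c, fun α β => ?_⟩
    obtain ⟨C, hC⟩ := hρ' α β
    refine ⟨‖c‖ * C, fun ξ => ?_⟩
    rw [partialPow, partialWord_smul c hρ, Pi.smul_apply, map_smul, map_smul, norm_smul, mul_assoc]
    exact mul_le_mul_of_nonneg_left (hC ξ) (norm_nonneg c)

/-- The space `𝕊^m(ℝⁿ; 𝒜_θ)` of standard symbols, with its own topology (below). -/
def SymbolSpace (θ : Matrix (Fin n) (Fin n) ℝ) (m : ℝ) : Type := symbolSubmodule θ m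

namespace SymbolSpace

variable {m : ℝ}

instance : AddCommGroup (SymbolSpace θ m) := inferInstanceAs (AddCommGroup (symbolSubmodule θ m))
instance : Module ℂ (SymbolSpace θ m) := inferInstanceAs (Module ℂ (symbolSubmodule θ m))

/-- The map `ℝⁿ → 𝒜_θ` underlying a symbol. -/
def toFun : SymbolSpace θ m →ₗ[ℂ] (Eucl n → SmoothTorus θ) := (symbolSubmodule θ m).subtype

theorem isSmooth (ρ : SymbolSpace θ m) : IsSmooth (toFun ρ) := ρ.2.1

theorem bddAbove_weighted (ρ : SymbolSpace θ m) (α β : Fin n → ℕ) :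
    BddAbove (Set.range (weighted m α β (toFun ρ))) := by
  obtain ⟨C, hC⟩ := ρ.2.2 α β
  refine ⟨C, ?_⟩
  rintro _ ⟨ξ, rfl⟩
  have h0 : (0 : ℝ) < 1 + ‖ξ‖ := by positivity
  rw [weighted]
  calc _ ≤ (1 + ‖ξ‖) ^ (-m + ∑ j, (β j : ℝ)) * (C * (1 + ‖ξ‖) ^ (m - ∑ j, (β j : ℝ))) :=
        mul_le_mul_of_nonneg_left (hC ξ) (by positivity)
    _ = C := by
        rw [mul_left_comm, ← Real.rpow_add h0]
        simp

/-- The seminorms `sup_ξ (1 + |ξ|)^{-m+|β|} ‖δ^α ∂^β ρ(ξ)‖` of `𝕊^m`. (Their maxima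
over `|α| + |β| ≤ N`, for `N = 0, 1, 2, …`, generate the same topology.) -/
def seminorms (θ : Matrix (Fin n) (Fin n) ℝ) (m : ℝ) :
    SeminormFamily ℂ (SymbolSpace θ m) ((Fin n → ℕ) × (Fin n → ℕ)) := fun αβ =>
  Seminorm.of (fun ρ => ⨆ ξ, weighted m αβ.1 αβ.2 (toFun ρ) ξ)
    (fun ρ σ => ciSup_le fun ξ => by
      rw [map_add]
      exact (weighted_add_le m _ _ ρ.isSmooth σ.isSmooth ξ).trans
        (add_le_add (le_ciSup (ρ.bddAbove_weighted _ _) ξ) (le_ciSup (σ.bddAbove_weighted _ _) ξ)))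
    (fun c ρ => by
      rw [Real.mul_iSup_of_nonneg (norm_nonneg c)]
      refine iSup_congr fun ξ => ?_
      rw [map_smul]
      exact weighted_smul m _ _ c ρ.isSmooth ξ)

/-- The locally convex topology of `𝕊^m`. -/
instance : TopologicalSpace (SymbolSpace θ m) := (seminorms θ m).moduleFilterBasis.topology

theorem withSeminorms (θ : Matrix (Fin n) (Fin n) ℝ) (m : ℝ) : WithSeminorms (seminorms θ m) :=
  ⟨rfl⟩

end SymbolSpace

end Symbols

section PsiDO

variable {θ : Matrix (Fin n) (Fin n) ℝ}

/-- The oscillating integral `(2π)⁻ⁿ ∬ e^{i s·ξ} a(s, ξ) ds dξ` exists and is equal to `b`. As for any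
integral with values in `𝒜_θ`, this is tested with all `φ ∈ 𝒜_θ'`. The scalar oscillating integral
is the limit, as `ε → 0⁺`, of the integrals regularized by `χ(ε s, ε ξ)`, for every
`χ ∈ C_c^∞(ℝⁿ × ℝⁿ)` with `χ(0, 0) = 1`. -/
def HasOscIntegral (a : Eucl n → Eucl n → SmoothTorus θ) (b : SmoothTorus θ) : Prop :=
  ∀ φ : Dual θ, ∀ χ : Eucl n × Eucl n → ℂ, ContDiff ℝ ∞ χ → HasCompactSupport χ → χ 0 = 1 →
    Tendsto (fun ε : ℝ => (((2 * Real.pi) ^ n : ℝ) : ℂ)⁻¹ * ∫ p : Eucl n × Eucl n,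
      Complex.exp (Complex.I * (inner ℝ p.1 p.2 : ℝ)) * (χ (ε • p) * φ (a p.1 p.2)))
      (𝓝[>] 0) (𝓝 (φ b))

open Classical in
/-- The oscillating integral (zero if it does not exist). -/
def oscIntegral (a : Eucl n → Eucl n → SmoothTorus θ) : SmoothTorus θ :=
  if h : ∃ b, HasOscIntegral a b then h.choose else 0

/-- The amplitude `(s, ξ) ↦ ρ(ξ) α_{-s}(u)`. -/
def amplitude (ρ : Eucl n → SmoothTorus θ) (u : SmoothTorus θ) (s ξ : Eucl n) : SmoothTorus θ :=
  ρ ξ * u.act (-s)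

/-- The pseudodifferential operator `P_ρ u = (2π)⁻ⁿ ∬ e^{i s·ξ} ρ(ξ) α_{-s}(u) ds dξ`. -/
def psiDO (ρ : Eucl n → SmoothTorus θ) (u : SmoothTorus θ) : SmoothTorus θ :=
  oscIntegral (amplitude ρ u)

end PsiDO

section Extensions

variable {θ : Matrix (Fin n) (Fin n) ℝ} {m : ℝ}

/-- `T : ℋ_θ^{(t)} → ℋ_θ^{(s)}` extends `P_ρ : 𝒜_θ → 𝒜_θ`: every `u ∈ 𝒜_θ` is an element `x` of
`ℋ_θ^{(t)}`, and `T x = P_ρ u` (equalities in `𝒜_θ'`). -/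
def ExtendsOnSobolev (ρ : SymbolSpace θ m) {s t : ℝ} (T : SobolevSpace θ t →L[ℂ] SobolevSpace θ s) :
    Prop :=
  ∀ u : SmoothTorus θ, ∃ x : SobolevSpace θ t, SobolevSpace.toDual x = SmoothTorus.toDual u ∧
    SobolevSpace.toDual (T x) = SmoothTorus.toDual (psiDO ρ.toFun u)

/-- `h ∈ ℋ_θ` is the image of `u ∈ 𝒜_θ`, that is, it has the same Fourier coefficients. -/
def IsImage (h : HTheta θ) (u : SmoothTorus θ) : Prop :=
  ∀ k, ⟪HTheta.monomial θ k, h⟫_ℂ = (SmoothTorus.toDual u).coeff k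

/-- `T : ℋ_θ → ℋ_θ` extends `P_ρ : 𝒜_θ → 𝒜_θ`. -/
def ExtendsOnHTheta (ρ : SymbolSpace θ m) (T : HTheta θ →L[ℂ] HTheta θ) : Prop :=
  ∀ u : SmoothTorus θ, ∃ h : HTheta θ, IsImage h u ∧ IsImage (T h) (psiDO ρ.toFun u)

end Extensions

end NCTorus

end

open NCTorus

/-!
In terms of Fourier series, `P_ρ` is an infinite matrix. Write `ρ(ξ) = ∑ ρ_l(ξ) U^l` and
`u = ∑ u_k U^k`. Since `α_{-s}(U^k) = e^{-is·k} U^k`, Fourier inversion evaluates the oscillating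
integral of `ρ_l(ξ) e^{-is·k}` to `ρ_l(k)`, so that `P_ρ u = ∑ ρ_l(k) u_k U^l U^k`, and `U^l U^k` is
a phase times `U^{l+k}`. Applying `δ^α` to `ρ` gives `|ρ_l(ξ)| ≤ C_N (1 + |l|)^{-N} (1 + |ξ|)^m` for
every `N`. By Peetre's inequality the `l`-th diagonal of the matrix of `Λ^s P_ρ Λ^{-s-m}` therefore
decreases rapidly in `l`, and the sum of the diagonals converges in the operator norm of `ℓ²(ℤⁿ)`.
If `m < 0`, then `P_ρ = (P_ρ Λ^{-m}) Λ^m` is compact, because the eigenvalues of `Λ^m` tend to `0`.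
-/

noncomputable section

open scoped ContDiff Topology InnerProductSpace ENNReal
open MeasureTheory Filter

namespace NCTorus

variable {n : ℕ}

/-! ### Weyl operators and the monomials `U^k` -/

section Weyl

/-- The lattice point `k ∈ ℤⁿ` as a vector of `ℝⁿ`. -/
def latticeVec (k : Fin n → ℤ) : Eucl n := WithLp.toLp 2 fun j => (k j : ℝ)

@[simp] theorem latticeVec_apply (k : Fin n → ℤ) (j : Fin n) : latticeVec k j = k j := rfl

theorem latticeVec_zero : latticeVec (0 : Fin n → ℤ) = 0 := by ext j; simp

theorem latticeVec_add (k l : Fin n → ℤ) : latticeVec (k + l) = latticeVec k + latticeVec l := by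
  ext j; simp

theorem latticeVec_neg (k : Fin n → ℤ) : latticeVec (-k) = -latticeVec k := by
  ext j; simp

/-- The phase `e^{i s·k}`, by which `α_s` multiplies `U^k`. -/
def phase (s : Eucl n) (k : Fin n → ℤ) : ℂ :=
  Complex.exp (Complex.I * (inner ℝ s (latticeVec k) : ℝ))

theorem norm_phase (s : Eucl n) (k : Fin n → ℤ) : ‖phase s k‖ = 1 := by
  rw [phase, mul_comm, Complex.norm_exp_ofReal_mul_I]

theorem phase_ne_zero (s : Eucl n) (k : Fin n → ℤ) : phase s k ≠ 0 := Complex.exp_ne_zero _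

theorem phase_zero_right (s : Eucl n) : phase s (0 : Fin n → ℤ) = 1 := by
  simp [phase, latticeVec_zero]

theorem phase_neg_right (s : Eucl n) (k : Fin n → ℤ) : phase s (-k) = (phase s k)⁻¹ := by
  rw [phase, phase, ← Complex.exp_neg, latticeVec_neg, inner_neg_right, Complex.ofReal_neg, mul_neg]

theorem fourier_add_toTorus (a : ℤ) (x : UnitAddCircle) (s : Eucl n) (j : Fin n) :
    fourier a (x + toTorus s j) = Complex.exp (Complex.I * (s j * a : ℝ)) * fourier a x := by
  have hmul : fourier a (x + toTorus s j) = fourier a (toTorus s j) * fourier a x := by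
    simp [fourier_apply, smul_add, AddCircle.toCircle_add, mul_comm]
  rw [hmul, toTorus, fourier_coe_apply]
  congr 2
  have hpi : (Real.pi : ℂ) ≠ 0 := by exact_mod_cast Real.pi_ne_zero
  push_cast
  field_simp

theorem mFourier_add_toTorus (k : Fin n → ℤ) (x : UnitAddTorus (Fin n)) (s : Eucl n) :
    UnitAddTorus.mFourier k (x + toTorus s) = phase s k * UnitAddTorus.mFourier k x := by
  simp only [UnitAddTorus.mFourier, ContinuousMap.coe_mk, Pi.add_apply, fourier_add_toTorus]
  rw [Finset.prod_mul_distrib, ← Complex.exp_sum, ← Finset.mul_sum, ← Complex.ofReal_sum, phase,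
    PiLp.inner_apply]
  simp [mul_comm]

theorem translateₗᵢ_mulCharₗᵢ_eq (s : Eucl n) (k : Fin n → ℤ) (f : L2 n) :
    translateₗᵢ s (mulCharₗᵢ k f) = phase s k • mulCharₗᵢ k (translateₗᵢ s f) := by
  apply Lp.ext
  filter_upwards [translateₗᵢ_coeFn s (mulCharₗᵢ k f),
    (measurePreserving_translate s).quasiMeasurePreserving.ae (mulCharₗᵢ_coeFn k f),
    Lp.coeFn_smul (phase s k) (mulCharₗᵢ k (translateₗᵢ s f)),
    mulCharₗᵢ_coeFn k (translateₗᵢ s f), translateₗᵢ_coeFn s f] with x h1 h2 h3 h4 h5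
  rw [h1, h2, h3, Pi.smul_apply, h4, h5, mFourier_add_toTorus, smul_eq_mul, mul_assoc]

/-- The unitary operator `f ↦ e^{i k·x} f(x + t)`; the Weyl operators of `A_θ` and of its commutant
are of this form. -/
def mulTranslate (k : Fin n → ℤ) (t : Eucl n) : unitary (Op n) :=
  Unitary.linearIsometryEquiv.symm (mulCharEquiv k) * V t

theorem mulTranslate_apply (k : Fin n → ℤ) (t : Eucl n) (f : L2 n) :
    (mulTranslate k t : Op n) f = mulCharₗᵢ k (translateₗᵢ t f) := rfl

theorem mulTranslate_mul (k l : Fin n → ℤ) (t r : Eucl n) :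
    (mulTranslate k t : Op n) * (mulTranslate l r : Op n) =
      phase t l • (mulTranslate (k + l) (t + r) : Op n) := by
  ext1 f
  change mulCharₗᵢ k (translateₗᵢ t (mulCharₗᵢ l (translateₗᵢ r f))) =
    phase t l • mulCharₗᵢ (k + l) (translateₗᵢ (t + r) f)
  rw [translateₗᵢ_mulCharₗᵢ_eq, map_smul, mulCharₗᵢ_add, translateₗᵢ_add]

theorem V_eq_mulTranslate (s : Eucl n) : V s = mulTranslate 0 s := by
  ext1
  ext1 f
  exact (mulCharₗᵢ_zero (translateₗᵢ s f)).symm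

theorem mulTranslate_zero : (mulTranslate 0 0 : unitary (Op n)) = 1 := by
  rw [← V_eq_mulTranslate, V_zero]

theorem star_mulTranslate (k : Fin n → ℤ) (t : Eucl n) :
    star (mulTranslate k t : Op n) = phase t k • (mulTranslate (-k) (-t) : Op n) := by
  refine left_inv_eq_right_inv (Unitary.coe_star_mul_self (mulTranslate k t)) ?_
  rw [mul_smul_comm, mulTranslate_mul, smul_smul, phase_neg_right,
    mul_inv_cancel₀ (phase_ne_zero t k), add_neg_cancel, add_neg_cancel, mulTranslate_zero,
    one_smul, OneMemClass.coe_one]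

theorem commute_mulTranslate {k l : Fin n → ℤ} {t r : Eucl n} (h : phase t l = phase r k) :
    Commute (mulTranslate k t : Op n) (mulTranslate l r : Op n) := by
  rw [commute_iff_eq, mulTranslate_mul, mulTranslate_mul, h, add_comm k, add_comm t]

theorem alpha_mulTranslate (s : Eucl n) (k : Fin n → ℤ) (t : Eucl n) :
    alpha s (mulTranslate k t : Op n) = phase s k • (mulTranslate k t : Op n) := by
  have hcomm : (V s : Op n) * (mulTranslate k t : Op n) =
      phase s k • ((mulTranslate k t : Op n) * (V s : Op n)) := by
    rw [V_eq_mulTranslate, mulTranslate_mul, mulTranslate_mul, phase_zero_right, one_smul,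
      zero_add, add_zero, add_comm]
  rw [alpha, Unitary.conjStarAlgAut_apply, hcomm, smul_mul_assoc, mul_assoc,
    Unitary.mul_star_self_of_mem (V s).2, mul_one]

variable (θ : Matrix (Fin n) (Fin n) ℝ)

/-- The translation vector `π θ k`, additive in `k`. -/
def twist : (Fin n → ℤ) →+ Eucl n where
  toFun k := Real.pi • WithLp.toLp 2 (θ.mulVec fun j => (k j : ℝ))
  map_zero' := by
    ext i; simp [Matrix.mulVec, dotProduct]
  map_add' k l := by
    ext i
    simp [Matrix.mulVec, dotProduct, mul_add, Finset.sum_add_distrib]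

theorem twist_single (j : Fin n) :
    twist θ (Pi.single j 1) = Real.pi • WithLp.toLp 2 (fun i => θ i j) := by
  ext i
  simp [twist, Matrix.mulVec, dotProduct, Pi.single_apply]

theorem inner_twist_transpose (k l : Fin n → ℤ) :
    inner ℝ (twist θ.transpose k) (latticeVec l) = inner ℝ (twist θ l) (latticeVec k) := by
  simp only [twist, AddMonoidHom.coe_mk, ZeroHom.coe_mk, PiLp.inner_apply, PiLp.smul_apply,
    Matrix.mulVec, dotProduct, latticeVec_apply, smul_eq_mul, RCLike.inner_apply, conj_trivial,
    Finset.mul_sum, Matrix.transpose_apply]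
  rw [Finset.sum_comm]
  exact Finset.sum_congr rfl fun i _ => Finset.sum_congr rfl fun j _ => by ring

/-- The Weyl operators `f ↦ e^{i k·x} f(x + π θ k)`, which are the `U^k` up to phases. -/
def weyl (k : Fin n → ℤ) : unitary (Op n) := mulTranslate k (twist θ k)

theorem weyl_single (j : Fin n) : weyl θ (Pi.single j 1) = U θ j := by
  rw [weyl, twist_single]; rfl

theorem weyl_mul (k l : Fin n → ℤ) :
    (weyl θ k : Op n) * (weyl θ l : Op n) = phase (twist θ k) l • (weyl θ (k + l) : Op n) := by
  rw [weyl, weyl, mulTranslate_mul, weyl, map_add]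

theorem weyl_zero : weyl θ 0 = 1 := by rw [weyl, map_zero, mulTranslate_zero]

theorem star_weyl (k : Fin n → ℤ) :
    star (weyl θ k : Op n) = phase (twist θ k) k • (weyl θ (-k) : Op n) := by
  rw [weyl, star_mulTranslate, weyl, map_neg]

/-- The group of pairs `(T, k)` where `T` is a Weyl operator of index `k` up to a phase. -/
def weylGroup : Subgroup (unitary (Op n) × Multiplicative (Fin n → ℤ)) where
  carrier := {p | ∃ c : ℂ, ‖c‖ = 1 ∧ (p.1 : Op n) = c • (weyl θ p.2.toAdd : Op n)}
  mul_mem' := by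
    rintro ⟨S, k⟩ ⟨T, l⟩ ⟨c, hc, hS : (S : Op n) = _⟩ ⟨d, hd, hT : (T : Op n) = _⟩
    refine ⟨c * d * phase (twist θ k.toAdd) l.toAdd, by simp [hc, hd, norm_phase], ?_⟩
    change (S : Op n) * (T : Op n) = _ • (weyl θ (k.toAdd + l.toAdd) : Op n)
    rw [hS, hT, smul_mul_smul_comm, weyl_mul, smul_smul]
  one_mem' := ⟨1, norm_one, by
    change (1 : Op n) = (1 : ℂ) • (weyl θ 0 : Op n)
    rw [weyl_zero, one_smul, OneMemClass.coe_one]⟩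
  inv_mem' := by
    rintro ⟨S, k⟩ ⟨c, hc, hS : (S : Op n) = _⟩
    refine ⟨star c * phase (twist θ k.toAdd) k.toAdd, by simp [hc, norm_phase], ?_⟩
    change star (S : Op n) = _ • (weyl θ (-k.toAdd) : Op n)
    rw [hS, star_smul, star_weyl, smul_smul]

theorem U_mem_weylGroup (j : Fin n) :
    (U θ j, Multiplicative.ofAdd (Pi.single j 1)) ∈ weylGroup θ :=
  ⟨1, norm_one, by rw [one_smul, toAdd_ofAdd, weyl_single]⟩

theorem Upow_mem_weylGroup (k : Fin n → ℤ) :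
    (Upow θ k, Multiplicative.ofAdd k) ∈ weylGroup θ := by
  let generator (j : Fin n) := (U θ j, Multiplicative.ofAdd (Pi.single j 1 : Fin n → ℤ))
  have hprod : (Upow θ k, Multiplicative.ofAdd k) =
      (List.ofFn fun j => generator j ^ k j).prod := by
    refine Prod.ext ?_ ?_
    · rw [← MonoidHom.coe_fst, map_list_prod, List.map_ofFn]
      rfl
    · rw [← MonoidHom.coe_snd, map_list_prod, List.map_ofFn, List.prod_ofFn]
      change k = ∑ j, k j • (Pi.single j (1 : ℤ) : Fin n → ℤ)
      ext i
      simp [Finset.sum_apply, Pi.single_apply]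
  rw [hprod]
  refine Subgroup.list_prod_mem _ fun p hp => ?_
  obtain ⟨j, rfl⟩ := List.mem_ofFn.1 hp
  exact Subgroup.zpow_mem _ (U_mem_weylGroup θ j) _

theorem exists_Upow_eq_smul_weyl (k : Fin n → ℤ) :
    ∃ c : ℂ, ‖c‖ = 1 ∧ (Upow θ k : Op n) = c • (weyl θ k : Op n) :=
  Upow_mem_weylGroup θ k

theorem alpha_Upow (s : Eucl n) (k : Fin n → ℤ) :
    alpha s (Upow θ k : Op n) = phase s k • (Upow θ k : Op n) := by
  obtain ⟨c, -, hc⟩ := exists_Upow_eq_smul_weyl θ k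
  rw [hc, map_smul, weyl, alpha_mulTranslate, smul_comm]

theorem norm_Upow_le (k : Fin n → ℤ) : ‖(Upow θ k : Op n)‖ ≤ 1 :=
  ContinuousLinearMap.opNorm_le_bound _ zero_le_one fun f => by
    rw [one_mul]
    exact (Unitary.norm_map (Upow θ k) f).le

theorem exists_Upow_mul_eq_smul (k l : Fin n → ℤ) :
    ∃ c : ℂ, ‖c‖ = 1 ∧ (Upow θ k : Op n) * (Upow θ l : Op n) = c • (Upow θ (k + l) : Op n) := by
  obtain ⟨a, ha, hk⟩ := exists_Upow_eq_smul_weyl θ k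
  obtain ⟨b, hb, hl⟩ := exists_Upow_eq_smul_weyl θ l
  obtain ⟨c, hc, hkl⟩ := exists_Upow_eq_smul_weyl θ (k + l)
  have hc0 : c ≠ 0 := norm_ne_zero_iff.1 (hc ▸ one_ne_zero)
  refine ⟨a * b * phase (twist θ k) l * c⁻¹, by simp [ha, hb, hc, norm_phase], ?_⟩
  rw [hk, hl, hkl, smul_mul_smul_comm, weyl_mul, smul_smul, smul_smul, inv_mul_cancel_right₀ hc0]

/-- The complex number `c` of modulus `1` such that `U^k U^l = c U^{k+l}`. -/
def cocycle (k l : Fin n → ℤ) : ℂ := (exists_Upow_mul_eq_smul θ k l).choose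

theorem norm_cocycle (k l : Fin n → ℤ) : ‖cocycle θ k l‖ = 1 :=
  (exists_Upow_mul_eq_smul θ k l).choose_spec.1

theorem cocycle_ne_zero (k l : Fin n → ℤ) : cocycle θ k l ≠ 0 :=
  norm_ne_zero_iff.1 (by rw [norm_cocycle]; exact one_ne_zero)

theorem Upow_mul (k l : Fin n → ℤ) :
    (Upow θ k : Op n) * (Upow θ l : Op n) = cocycle θ k l • (Upow θ (k + l) : Op n) :=
  (exists_Upow_mul_eq_smul θ k l).choose_spec.2

theorem Upow_zero : Upow θ 0 = 1 := by
  simp [Upow]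

theorem star_Upow (k : Fin n → ℤ) :
    star (Upow θ k : Op n) = (cocycle θ k (-k))⁻¹ • (Upow θ (-k) : Op n) := by
  refine left_inv_eq_right_inv (Unitary.coe_star_mul_self (Upow θ k)) ?_
  rw [mul_smul_comm, Upow_mul, smul_smul, inv_mul_cancel₀ (cocycle_ne_zero θ k (-k)),
    add_neg_cancel, Upow_zero, one_smul, OneMemClass.coe_one]

end Weyl

section Trace

/-- The constant function `1 ∈ L²(𝕋ⁿ)`, the vector of the state `τ`. -/
abbrev oneL2 (n : ℕ) : L2 n := Lp.const 2 (haar n) (1 : ℂ)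

theorem translateₗᵢ_oneL2 (s : Eucl n) : translateₗᵢ s (oneL2 n) = oneL2 n := by
  apply Lp.ext
  have hone := Lp.coeFn_const (p := 2) (μ := haar n) (1 : ℂ)
  filter_upwards [translateₗᵢ_coeFn s (oneL2 n), hone,
    (measurePreserving_translate s).quasiMeasurePreserving.ae hone] with x h1 h2 h3
  rw [h1, h2, h3, Function.const_apply, Function.const_apply]

theorem mulCharₗᵢ_oneL2 (k : Fin n → ℤ) :
    mulCharₗᵢ k (oneL2 n) = UnitAddTorus.mFourierLp 2 k := by
  apply Lp.ext
  filter_upwards [mulCharₗᵢ_coeFn k (oneL2 n), Lp.coeFn_const (p := 2) (μ := haar n) (1 : ℂ),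
    UnitAddTorus.coeFn_mFourierLp (d := Fin n) 2 k] with x h1 h2 h3
  rw [h1, h2, Function.const_apply, mul_one]
  exact h3.symm

theorem mulTranslate_oneL2 (k : Fin n → ℤ) (t : Eucl n) :
    (mulTranslate k t : Op n) (oneL2 n) = UnitAddTorus.mFourierLp 2 k := by
  rw [mulTranslate_apply, translateₗᵢ_oneL2, mulCharₗᵢ_oneL2]

theorem eq_zero_of_inner_mFourierLp {f : L2 n}
    (h : ∀ k, ⟪(UnitAddTorus.mFourierLp 2 k : L2 n), f⟫_ℂ = 0) : f = 0 := by
  refine (UnitAddTorus.mFourierBasis (d := Fin n)).repr.map_eq_zero_iff.1 ?_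
  ext k
  rw [HilbertBasis.repr_apply_apply, UnitAddTorus.coe_mFourierBasis]
  exact h k

theorem tau_alpha (s : Eucl n) (T : Op n) : tau (alpha s T) = tau T := by
  have hV : (V s : Op n) (oneL2 n) = oneL2 n := translateₗᵢ_oneL2 s
  have hVstar : star (V s : Op n) (oneL2 n) = oneL2 n := by
    nth_rewrite 1 [← hV]
    exact congrArg (fun S : Op n => S (oneL2 n)) (Unitary.coe_star_mul_self (V s))
  calc tau (alpha s T) = ⟪oneL2 n, (V s : Op n) (T (star (V s : Op n) (oneL2 n)))⟫_ℂ := by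
        rw [tau_apply, alpha, Unitary.conjStarAlgAut_apply]; rfl
    _ = ⟪star (V s : Op n) (oneL2 n), T (oneL2 n)⟫_ℂ := by
        rw [ContinuousLinearMap.star_eq_adjoint, ContinuousLinearMap.adjoint_inner_left,
          ← ContinuousLinearMap.star_eq_adjoint, hVstar]
    _ = tau T := by rw [hVstar, tau_apply]

theorem norm_tau_le (T : Op n) : ‖tau T‖ ≤ ‖T‖ := by
  have hone : ‖oneL2 n‖ = 1 := by simp [Lp.norm_const]
  calc ‖tau T‖ ≤ ‖oneL2 n‖ * ‖T (oneL2 n)‖ := by rw [tau_apply]; exact norm_inner_le_norm _ _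
    _ ≤ ‖T‖ := by simpa [hone] using T.le_opNorm (oneL2 n)

variable (θ : Matrix (Fin n) (Fin n) ℝ)

theorem tau_weyl (k : Fin n → ℤ) : tau (weyl θ k : Op n) = if k = 0 then 1 else 0 := by
  have hone : oneL2 n = UnitAddTorus.mFourierLp 2 0 := by rw [← mulCharₗᵢ_oneL2, mulCharₗᵢ_zero]
  change ⟪oneL2 n, (mulTranslate k (twist θ k) : Op n) (oneL2 n)⟫_ℂ = _
  rw [mulTranslate_oneL2, hone]
  simp only [eq_comm (a := k)]
  exact orthonormal_iff_ite.1 (UnitAddTorus.orthonormal_mFourier (d := Fin n)) 0 k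

theorem tau_Upow_of_ne_zero {k : Fin n → ℤ} (hk : k ≠ 0) : tau (Upow θ k : Op n) = 0 := by
  obtain ⟨c, -, hc⟩ := exists_Upow_eq_smul_weyl θ k
  rw [hc, map_smul, tau_weyl, if_neg hk, smul_zero]

theorem tau_Upow_mul_star (k l : Fin n → ℤ) :
    tau ((Upow θ k : Op n) * star (Upow θ l : Op n)) = if k = l then 1 else 0 := by
  split_ifs with hkl
  · rw [hkl, Unitary.mul_star_self_of_mem (Upow θ l).2, ← OneMemClass.coe_one (unitary (Op n)),
      ← weyl_zero θ, tau_weyl, if_pos rfl]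
  · rw [star_Upow, mul_smul_comm, Upow_mul, map_smul, map_smul,
      tau_Upow_of_ne_zero θ (by rwa [← sub_eq_add_neg, sub_ne_zero]), smul_zero, smul_zero]

/-- The operators `f ↦ e^{i k·x} f(x + π θᵀ k)`, which commute with `A_θ`; for an antisymmetric `θ`
they generate the opposite algebra. -/
def rightWeyl (k : Fin n → ℤ) : unitary (Op n) := mulTranslate k (twist θ.transpose k)

theorem commute_rightWeyl_weyl (k l : Fin n → ℤ) :
    Commute (rightWeyl θ k : Op n) (weyl θ l : Op n) :=
  commute_mulTranslate (by rw [phase, phase, inner_twist_transpose])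

theorem star_rightWeyl (k : Fin n → ℤ) :
    star (rightWeyl θ k : Op n) = phase (twist θ.transpose k) k • (rightWeyl θ (-k) : Op n) := by
  rw [rightWeyl, star_mulTranslate, rightWeyl, map_neg]

theorem commute_rightWeyl_of_mem_ncTorus (k : Fin n → ℤ) {T : Op n} (hT : T ∈ ncTorus θ) :
    Commute (rightWeyl θ k : Op n) T := by
  let commutant := StarSubalgebra.centralizer ℂ {(rightWeyl θ k : Op n)}
  have hU : StarAlgebra.adjoin ℂ (Set.range fun j => (U θ j : Op n)) ≤ commutant := by
    rw [StarAlgebra.adjoin_le_iff]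
    rintro _ ⟨j, rfl⟩
    refine (StarSubalgebra.mem_centralizer_iff ℂ).2 ?_
    rintro _ rfl
    dsimp only
    rw [star_rightWeyl, ← weyl_single]
    exact ⟨commute_rightWeyl_weyl θ k _, (commute_rightWeyl_weyl θ (-k) _).smul_left _⟩
  have hclosed : IsClosed (commutant : Set (Op n)) := Set.isClosed_centralizer _
  have hmem : T ∈ commutant := StarSubalgebra.topologicalClosure_minimal hU hclosed hT
  exact ((StarSubalgebra.mem_centralizer_iff ℂ).1 hmem _ rfl).1

/-- The constant `1` is separating for `A_θ`, being cyclic for the commutant. -/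
theorem eq_zero_of_apply_oneL2 {T : Op n} (hT : T ∈ ncTorus θ) (h : T (oneL2 n) = 0) : T = 0 := by
  have hchar (k : Fin n → ℤ) : T (UnitAddTorus.mFourierLp 2 k) = 0 := by
    have hcomm := congrArg (fun S : Op n => S (oneL2 n))
      (commute_rightWeyl_of_mem_ncTorus θ k hT).eq
    change (rightWeyl θ k : Op n) (T (oneL2 n)) = T ((rightWeyl θ k : Op n) (oneL2 n)) at hcomm
    rwa [h, map_zero, rightWeyl, mulTranslate_oneL2, eq_comm] at hcomm
  rw [← star_eq_zero]
  ext1 g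
  refine eq_zero_of_inner_mFourierLp fun k => ?_
  rw [ContinuousLinearMap.star_eq_adjoint, ContinuousLinearMap.adjoint_inner_right, hchar,
    inner_zero_left]

theorem eq_zero_of_tau_mul_Upow {T : Op n} (hT : T ∈ ncTorus θ)
    (h : ∀ k, tau (T * (Upow θ k : Op n)) = 0) : T = 0 := by
  rw [← star_eq_zero]
  refine eq_zero_of_apply_oneL2 θ (star_mem hT) (eq_zero_of_inner_mFourierLp fun k => ?_)
  obtain ⟨c, hc, hUpow⟩ := exists_Upow_eq_smul_weyl θ k
  have hc0 : c ≠ 0 := norm_ne_zero_iff.1 (hc ▸ one_ne_zero)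
  have hweyl : tau (T * (weyl θ k : Op n)) = 0 := by
    have := h k
    rwa [hUpow, mul_smul_comm, map_smul, smul_eq_zero_iff_right hc0] at this
  rw [ContinuousLinearMap.star_eq_adjoint, ContinuousLinearMap.adjoint_inner_right,
    ← inner_conj_symm, ← mulTranslate_oneL2 k (twist θ k)]
  exact (congrArg (starRingEnd ℂ) hweyl).trans (map_zero _)

end Trace

/-! ### Fourier series in `𝒜_θ` -/

section Weight

/-- The weight `1 + |k|` on `ℤⁿ`, with the Euclidean norm, which measures the decay of Fourier
coefficients. -/
def weight (k : Fin n → ℤ) : ℝ := 1 + ‖latticeVec k‖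

theorem one_le_weight (k : Fin n → ℤ) : 1 ≤ weight k := le_add_of_nonneg_right (norm_nonneg _)

theorem weight_pos (k : Fin n → ℤ) : 0 < weight k := one_pos.trans_le (one_le_weight k)

theorem weight_neg (k : Fin n → ℤ) : weight (-k) = weight k := by
  rw [weight, latticeVec_neg, norm_neg, weight]

theorem weight_add_le (k l : Fin n → ℤ) : weight (k + l) ≤ weight k * weight l := by
  have htriangle := norm_add_le (latticeVec k) (latticeVec l)
  have hprod : 0 ≤ ‖latticeVec k‖ * ‖latticeVec l‖ := by positivity
  simp only [weight, latticeVec_add]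
  linarith

theorem norm_latticeVec_le_weight (k : Fin n → ℤ) : ‖latticeVec k‖ ≤ weight k :=
  le_add_of_nonneg_left zero_le_one

theorem abs_intCast_le_weight (k : Fin n → ℤ) (j : Fin n) : |(k j : ℝ)| ≤ weight k :=
  (PiLp.norm_apply_le (latticeVec k) j).trans (norm_latticeVec_le_weight k)

theorem weight_le (k : Fin n → ℤ) : weight k ≤ 1 + ∑ j, |(k j : ℝ)| := by
  have hsum := (EuclideanSpace.basisFun (Fin n) ℝ).sum_repr (latticeVec k)
  refine add_le_add_right ?_ 1
  calc ‖latticeVec k‖ = ‖∑ j, (k j : ℝ) • EuclideanSpace.basisFun (Fin n) ℝ j‖ := by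
        rw [← hsum]; simp
    _ ≤ ∑ j, ‖(k j : ℝ) • EuclideanSpace.basisFun (Fin n) ℝ j‖ := norm_sum_le _ _
    _ = ∑ j, |(k j : ℝ)| := by simp [norm_smul]

theorem weight_pow_le (N : ℕ) (k : Fin n → ℤ) :
    weight k ^ N ≤ (n + 1) ^ N * (1 + ∑ j, |(k j : ℝ)| ^ N) := by
  let entry : Option (Fin n) → ℝ := fun i => i.elim 1 fun j => |(k j : ℝ)|
  have hentry (i : Option (Fin n)) : 0 ≤ entry i := by cases i <;> simp [entry]
  have hsum (f : ℝ → ℝ) : ∑ i, f (entry i) = f 1 + ∑ j, f |(k j : ℝ)| := by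
    rw [Fintype.sum_option]; rfl
  obtain ⟨i, -, hi⟩ := Finset.exists_max_image Finset.univ entry Finset.univ_nonempty
  calc weight k ^ N ≤ (∑ i, entry i) ^ N :=
        pow_le_pow_left₀ (weight_pos k).le ((weight_le k).trans_eq (hsum id).symm) N
    _ ≤ ((n + 1) * entry i) ^ N := by
        refine pow_le_pow_left₀ (Finset.sum_nonneg fun i _ => hentry i) ?_ N
        simpa using Finset.sum_le_card_nsmul Finset.univ entry (entry i) hi
    _ = (n + 1) ^ N * entry i ^ N := mul_pow _ _ _
    _ ≤ (n + 1) ^ N * (1 + ∑ j, |(k j : ℝ)| ^ N) := by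
        refine mul_le_mul_of_nonneg_left ?_ (by positivity)
        rw [← one_pow N, ← hsum (· ^ N)]
        exact Finset.single_le_sum (f := fun i => entry i ^ N)
          (fun i _ => pow_nonneg (hentry i) N) (Finset.mem_univ i)

theorem summable_weight (n : ℕ) : Summable fun k : Fin n → ℤ => (weight k ^ (n + 1))⁻¹ := by
  let basis := (EuclideanSpace.basisFun (Fin n) ℝ).toBasis
  let L := Submodule.span ℤ (Set.range basis)
  have hrank : Module.finrank ℤ L = n := by
    rw [ZLattice.rank ℝ L, finrank_euclideanSpace_fin]
  have hmem (k : Fin n → ℤ) : latticeVec k ∈ L :=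
    basis.mem_span_iff_repr_mem ℤ _ |>.2 fun j => ⟨k j, by simp [basis]⟩
  have hinj : Function.Injective fun k : Fin n → ℤ => (⟨latticeVec k, hmem k⟩ : L) :=
    fun k l hkl => by
      ext j
      simpa using congrArg (fun v : L => (v : Eucl n) j) hkl
  have hsum := (ZLattice.summable_norm_pow_inv L (n + 1) (by omega)).comp_injective hinj
  refine Summable.of_norm_bounded_eventually hsum ?_
  filter_upwards [(Set.finite_singleton (0 : Fin n → ℤ)).compl_mem_cofinite] with k hk
  have hnorm : 0 < ‖latticeVec k‖ := by
    refine norm_pos_iff.2 fun h => hk ?_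
    ext j
    simpa using congrArg (fun v : Eucl n => v j) h
  rw [Real.norm_of_nonneg (inv_nonneg.2 (pow_nonneg (weight_pos k).le _)), ← inv_pow]
  exact pow_le_pow_left₀ (inv_nonneg.2 (weight_pos k).le)
    (inv_anti₀ hnorm (norm_latticeVec_le_weight k)) _

end Weight

section Coefficients

variable {θ : Matrix (Fin n) (Fin n) ℝ}

open SmoothTorus

theorem toOp_monomial (k : Fin n → ℤ) : toOp (monomial θ k) = (Upow θ k : Op n) := rfl

theorem star_monomial (k : Fin n → ℤ) :
    star (monomial θ k) = (cocycle θ k (-k))⁻¹ • monomial θ (-k) :=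
  toOp_injective (star_Upow θ k)

theorem norm_smul_Upow_le (c : ℂ) (k : Fin n → ℤ) : ‖c • (Upow θ k : Op n)‖ ≤ ‖c‖ := by
  rw [norm_smul]
  exact mul_le_of_le_one_right (norm_nonneg c) (norm_Upow_le θ k)

variable (θ) in
/-- The `k`-th Fourier coefficient `T ↦ τ(T (U^k)⋆)` on bounded operators. -/
def opCoeff (k : Fin n → ℤ) : Op n →L[ℂ] ℂ :=
  tau.comp ((ContinuousLinearMap.mul ℂ (Op n)).flip (star (Upow θ k : Op n)))

theorem opCoeff_apply (k : Fin n → ℤ) (T : Op n) :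
    opCoeff θ k T = tau (T * star (Upow θ k : Op n)) := rfl

theorem opCoeff_Upow (k l : Fin n → ℤ) :
    opCoeff θ k (Upow θ l : Op n) = if l = k then 1 else 0 := by
  rw [opCoeff_apply, tau_Upow_mul_star]

theorem norm_opCoeff_le (k : Fin n → ℤ) (T : Op n) : ‖opCoeff θ k T‖ ≤ ‖T‖ :=
  calc ‖opCoeff θ k T‖ ≤ ‖T * star (Upow θ k : Op n)‖ := norm_tau_le _
    _ ≤ ‖T‖ * ‖star (Upow θ k : Op n)‖ := norm_mul_le _ _
    _ ≤ ‖T‖ := mul_le_of_le_one_right (norm_nonneg T) ((norm_star _).trans_le (norm_Upow_le θ k))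

theorem opCoeff_alpha (s : Eucl n) (k : Fin n → ℤ) (T : Op n) :
    opCoeff θ k (alpha s T) = phase s k * opCoeff θ k T := by
  have halpha : alpha s (T * star (Upow θ k : Op n)) =
      star (phase s k) • (alpha s T * star (Upow θ k : Op n)) := by
    rw [map_mul, map_star, alpha_Upow, star_smul, mul_smul_comm]
  have hphase : phase s k * star (phase s k) = 1 := by
    simpa [norm_phase] using Complex.mul_conj' (phase s k)
  rw [opCoeff_apply, opCoeff_apply, ← tau_alpha s (T * _), halpha, map_smul, smul_eq_mul,
    ← mul_assoc, hphase, one_mul]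

theorem eq_zero_of_opCoeff {T : Op n} (hT : T ∈ ncTorus θ) (h : ∀ k, opCoeff θ k T = 0) :
    T = 0 := by
  refine eq_zero_of_tau_mul_Upow θ hT fun k => ?_
  have hcoeff := h (-k)
  rw [opCoeff_apply, star_Upow, neg_neg, mul_smul_comm, map_smul] at hcoeff
  exact (smul_eq_zero_iff_right (inv_ne_zero (cocycle_ne_zero θ _ _))).1 hcoeff

variable (θ) in
/-- The Fourier coefficient `u ↦ u_k` on `𝒜_θ`. -/
def fourierCoeff (k : Fin n → ℤ) : Dual θ where
  toLinearMap := (opCoeff θ k).toLinearMap ∘ₗ toOp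
  cont := (opCoeff θ k).continuous.comp continuous_toOp

theorem coeff_toDual (k : Fin n → ℤ) (u : SmoothTorus θ) :
    (toDual u).coeff k = fourierCoeff θ k u := rfl

theorem fourierCoeff_monomial (k l : Fin n → ℤ) :
    fourierCoeff θ k (monomial θ l) = if l = k then 1 else 0 := opCoeff_Upow k l

theorem fourierCoeff_act (s : Eucl n) (k : Fin n → ℤ) (u : SmoothTorus θ) :
    fourierCoeff θ k (u.act s) = phase s k * fourierCoeff θ k u := opCoeff_alpha s k _

theorem ext_fourierCoeff {u v : SmoothTorus θ}
    (h : ∀ k, fourierCoeff θ k u = fourierCoeff θ k v) : u = v :=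
  toOp_injective (sub_eq_zero.1 (eq_zero_of_opCoeff (sub_mem u.2.1 v.2.1) fun k =>
    (map_sub (fourierCoeff θ k) u v).trans (sub_eq_zero.2 (h k))))

theorem hasDerivAt_opCoeff_alpha (j : Fin n) (k : Fin n → ℤ) (T : Op n) :
    HasDerivAt (fun t : ℝ => opCoeff θ k (alpha (0 + t • EuclideanSpace.single j 1) T))
      (Complex.I * k j * opCoeff θ k T) 0 := by
  have hphase (t : ℝ) : phase (0 + t • EuclideanSpace.single j 1) k =
      Complex.exp (t * (Complex.I * k j)) := by
    simp [phase, inner_smul_left, EuclideanSpace.inner_single_left, mul_left_comm]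
  simp_rw [opCoeff_alpha, hphase]
  refine HasDerivAt.mul_const ?_ _
  simpa using ((hasDerivAt_id (0 : ℝ)).ofReal_comp.mul_const (Complex.I * k j)).cexp

theorem fourierCoeff_delta (j : Fin n) (k : Fin n → ℤ) (u : SmoothTorus θ) :
    fourierCoeff θ k (delta j u) = k j * fourierCoeff θ k u := by
  have hline := hasLineDerivAt_alpha (toOp_mem u) 0 (EuclideanSpace.single j 1)
  have hderiv := (((opCoeff θ k).restrictScalars ℝ).hasFDerivAt.comp_hasDerivAt (0 : ℝ)
    hline).unique (hasDerivAt_opCoeff_alpha j k (toOp u))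
  rw [ContinuousLinearMap.coe_restrictScalars', ← hline.lineDeriv] at hderiv
  calc fourierCoeff θ k (delta j u) = -Complex.I * (Complex.I * k j * opCoeff θ k (toOp u)) := by
        rw [← hderiv]; exact map_smul (opCoeff θ k) _ _
    _ = k j * fourierCoeff θ k u := by
        rw [← mul_assoc, ← mul_assoc, neg_mul, Complex.I_mul_I, neg_neg, one_mul]; rfl

/-- The monomial `k^β = k_1^{β_1} ⋯ k_n^{β_n}`, the eigenvalue of `δ^β` on `U^k`. -/
def multiPow (β : Fin n → ℕ) (k : Fin n → ℤ) : ℂ := ∏ j, (k j : ℂ) ^ β j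

theorem multiPow_single (j : Fin n) (N : ℕ) (k : Fin n → ℤ) :
    multiPow (Pi.single j N) k = (k j : ℂ) ^ N := by
  rw [multiPow, Finset.prod_eq_single j (fun i _ hi => by simp [hi]) (by simp), Pi.single_eq_same]

theorem norm_multiPow_le (β : Fin n → ℕ) (k : Fin n → ℤ) :
    ‖multiPow β k‖ ≤ weight k ^ ∑ j, β j := by
  rw [multiPow, norm_prod, ← Finset.prod_pow_eq_pow_sum]
  refine Finset.prod_le_prod (fun j _ => norm_nonneg _) fun j _ => ?_
  rw [norm_pow, Complex.norm_intCast]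
  exact pow_le_pow_left₀ (abs_nonneg _) (abs_intCast_le_weight k j) _

theorem fourierCoeff_delta_word (w : List (Fin n)) (k : Fin n → ℤ) (u : SmoothTorus θ) :
    fourierCoeff θ k ((w.map delta).prod u) =
      (w.map fun j => (k j : ℂ)).prod * fourierCoeff θ k u := by
  induction w with
  | nil => simp
  | cons j w ih =>
    rw [List.map_cons, List.prod_cons, List.map_cons, List.prod_cons, Module.End.mul_apply,
      fourierCoeff_delta, ih, mul_assoc]

theorem fourierCoeff_deltaPow (β : Fin n → ℕ) (k : Fin n → ℤ) (u : SmoothTorus θ) :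
    fourierCoeff θ k (deltaPow β u) = multiPow β k * fourierCoeff θ k u := by
  rw [deltaPow, fourierCoeff_delta_word, word, List.map_flatMap, List.flatMap_def,
    List.prod_flatten, List.map_map, multiPow, ← List.prod_ofFn, List.ofFn_eq_map]
  simp only [Function.comp_def, List.map_replicate, List.prod_replicate]

theorem deltaPow_monomial (β : Fin n → ℕ) (k : Fin n → ℤ) :
    deltaPow β (monomial θ k) = multiPow β k • monomial θ k := by
  refine ext_fourierCoeff fun l => ?_
  rw [fourierCoeff_deltaPow, map_smul, fourierCoeff_monomial, smul_eq_mul]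
  split_ifs with hl
  · rw [hl]
  · simp

theorem seminorms_apply (β : Fin n → ℕ) (u : SmoothTorus θ) :
    SmoothTorus.seminorms θ β u = ‖toOp (deltaPow β u)‖ := rfl

theorem norm_multiPow_mul_fourierCoeff_le (β : Fin n → ℕ) (k : Fin n → ℤ) (u : SmoothTorus θ) :
    ‖multiPow β k‖ * ‖fourierCoeff θ k u‖ ≤ SmoothTorus.seminorms θ β u := by
  rw [← norm_mul, ← fourierCoeff_deltaPow]
  exact norm_opCoeff_le k _

/-- A continuous seminorm of `𝒜_θ` which bounds `(1 + |k|)^N |u_k|` for all `k`. -/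
def decayBound (N : ℕ) (u : SmoothTorus θ) : ℝ :=
  (n + 1) ^ N * (SmoothTorus.seminorms θ 0 u + ∑ j, SmoothTorus.seminorms θ (Pi.single j N) u)

theorem weight_pow_mul_norm_fourierCoeff_le (N : ℕ) (k : Fin n → ℤ) (u : SmoothTorus θ) :
    weight k ^ N * ‖fourierCoeff θ k u‖ ≤ decayBound N u := by
  calc weight k ^ N * ‖fourierCoeff θ k u‖
      ≤ (n + 1) ^ N * (1 + ∑ j, |(k j : ℝ)| ^ N) * ‖fourierCoeff θ k u‖ :=
        mul_le_mul_of_nonneg_right (weight_pow_le N k) (norm_nonneg _)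
    _ = (n + 1) ^ N * (‖multiPow 0 k‖ * ‖fourierCoeff θ k u‖ +
          ∑ j, ‖multiPow (Pi.single j N) k‖ * ‖fourierCoeff θ k u‖) := by
        rw [mul_assoc, add_mul, Finset.sum_mul]
        simp only [multiPow_single, norm_pow, Complex.norm_intCast]
        simp [multiPow]
    _ ≤ decayBound N u := by
        refine mul_le_mul_of_nonneg_left (add_le_add ?_ (Finset.sum_le_sum fun j _ => ?_))
          (by positivity)
        all_goals exact norm_multiPow_mul_fourierCoeff_le _ k u

end Coefficients

section RapidDecay

open SmoothTorus

variable {θ : Matrix (Fin n) (Fin n) ℝ} {I : Type*} {a : I → ℂ} {κ : I → Fin n → ℤ}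

/-- The family `a` decreases rapidly relative to the frequencies `κ`: `∑ (1 + |κ_i|)^N |a_i|` is
finite for all `N`, which makes `∑ a_i U^{κ_i}` an element of `𝒜_θ`. -/
def RapidDecay (a : I → ℂ) (κ : I → Fin n → ℤ) : Prop :=
  ∀ N : ℕ, Summable fun i => weight (κ i) ^ N * ‖a i‖

theorem weight_pow_mul_norm_nonneg (k : Fin n → ℤ) (N : ℕ) (z : ℂ) : 0 ≤ weight k ^ N * ‖z‖ :=
  mul_nonneg (pow_nonneg (weight_pos k).le N) (norm_nonneg z)

theorem rapidDecay_of_le {a : (Fin n → ℤ) → ℂ}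
    (h : ∀ N : ℕ, ∃ C, ∀ k, weight k ^ N * ‖a k‖ ≤ C) : RapidDecay a id := by
  intro N
  obtain ⟨C, hC⟩ := h (N + (n + 1))
  refine ((summable_weight n).mul_left C).of_nonneg_of_le
    (fun k => weight_pow_mul_norm_nonneg k N _) fun k => ?_
  rw [← div_eq_mul_inv, le_div_iff₀ (pow_pos (weight_pos k) _)]
  calc weight k ^ N * ‖a k‖ * weight k ^ (n + 1) = weight k ^ (N + (n + 1)) * ‖a k‖ := by ring
    _ ≤ C := hC k

theorem rapidDecay_fourierCoeff (u : SmoothTorus θ) :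
    RapidDecay (fun k => fourierCoeff θ k u) id :=
  rapidDecay_of_le fun N => ⟨_, fun k => weight_pow_mul_norm_fourierCoeff_le N k u⟩

theorem RapidDecay.summable (h : RapidDecay a κ) : Summable fun i => ‖a i‖ := by
  simpa using h 0

theorem RapidDecay.summable_norm_smul_Upow (h : RapidDecay a κ) :
    Summable fun i => ‖a i • (Upow θ (κ i) : Op n)‖ :=
  h.summable.of_nonneg_of_le (fun _ => norm_nonneg _) fun i => norm_smul_Upow_le (a i) (κ i)

theorem RapidDecay.mul_multiPow (h : RapidDecay a κ) (β : Fin n → ℕ) :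
    RapidDecay (fun i => multiPow β (κ i) * a i) κ := by
  intro N
  refine (h (N + ∑ j, β j)).of_nonneg_of_le
    (fun i => weight_pow_mul_norm_nonneg (κ i) N _) fun i => ?_
  rw [norm_mul, pow_add, mul_assoc]
  exact mul_le_mul_of_nonneg_left
    (mul_le_mul_of_nonneg_right (norm_multiPow_le β _) (norm_nonneg _))
    (pow_nonneg (weight_pos _).le N)

theorem iteratedDeriv_cexp_I_mul_smul {E : Type*} [NormedAddCommGroup E] [NormedSpace ℂ E]
    (m : ℕ) (v : E) :
    iteratedDeriv m (fun x : ℝ => Complex.exp (Complex.I * x) • v) =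
      fun x : ℝ => (Complex.I ^ m * Complex.exp (Complex.I * x)) • v := by
  induction m with
  | zero => simp
  | succ m ih =>
    rw [iteratedDeriv_succ, ih]
    ext1 x
    have hderiv := ((((hasDerivAt_id x).ofReal_comp.const_mul Complex.I).cexp).const_mul
      (Complex.I ^ m)).smul_const v
    simpa [pow_succ, mul_assoc, mul_left_comm, mul_comm] using hderiv.deriv

theorem contDiff_phase_smul {E : Type*} [NormedAddCommGroup E] [NormedSpace ℂ E]
    (k : Fin n → ℤ) (v : E) : ContDiff ℝ ∞ fun s : Eucl n => phase s k • v :=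
  (contDiff_const.mul (Complex.ofRealCLM.contDiff.comp
    (contDiff_id.inner ℝ contDiff_const))).cexp.smul contDiff_const

theorem norm_iteratedFDeriv_phase_smul_le {E : Type*} [NormedAddCommGroup E] [NormedSpace ℂ E]
    (m : ℕ) (k : Fin n → ℤ) (v : E) (s : Eucl n) :
    ‖iteratedFDeriv ℝ m (fun s : Eucl n => phase s k • v) s‖ ≤ ‖latticeVec k‖ ^ m * ‖v‖ := by
  let wave : ℝ → E := fun x => Complex.exp (Complex.I * x) • v
  let L : Eucl n →L[ℝ] ℝ := innerSL ℝ (latticeVec k)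
  have hcomp : (fun s : Eucl n => phase s k • v) = wave ∘ L := by
    ext1 s
    simp only [wave, L, Function.comp, phase, innerSL_apply_apply, real_inner_comm]
  have hsmooth : ContDiff ℝ ∞ wave :=
    (contDiff_const.mul Complex.ofRealCLM.contDiff).cexp.smul contDiff_const
  have hwave (x : ℝ) : ‖iteratedFDeriv ℝ m wave x‖ = ‖v‖ := by
    rw [norm_iteratedFDeriv_eq_norm_iteratedDeriv, iteratedDeriv_cexp_I_mul_smul, norm_smul,
      norm_mul, norm_pow, Complex.norm_I, mul_comm Complex.I, Complex.norm_exp_ofReal_mul_I,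
      one_pow, one_mul, one_mul]
  rw [hcomp, L.iteratedFDeriv_comp_right hsmooth s (by exact_mod_cast le_top)]
  refine (ContinuousMultilinearMap.norm_compContinuousLinearMap_le _ _).trans_eq ?_
  rw [Finset.prod_const, Finset.card_univ, Fintype.card_fin, hwave, mul_comm,
    show ‖L‖ = ‖latticeVec k‖ from innerSL_apply_norm ..]

theorem RapidDecay.contDiff_alpha_tsum (h : RapidDecay a κ) :
    ContDiff ℝ ∞ fun s : Eucl n => alpha s (∑' i, a i • (Upow θ (κ i) : Op n)) := by
  have hsum := (h.summable_norm_smul_Upow (θ := θ)).of_norm.hasSum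
  have halpha : (fun s : Eucl n => alpha s (∑' i, a i • (Upow θ (κ i) : Op n))) =
      fun s => ∑' i, phase s (κ i) • (a i • (Upow θ (κ i) : Op n)) := by
    ext1 s
    rw [← (hsum.map (alpha s) (continuous_alpha s)).tsum_eq]
    simp only [Function.comp, map_smul, alpha_Upow, smul_comm (phase s _)]
  rw [halpha]
  refine contDiff_tsum (v := fun m i => weight (κ i) ^ m * ‖a i‖)
    (fun i => contDiff_phase_smul _ _) (fun m _ => h m) fun m i s _ => ?_
  exact (norm_iteratedFDeriv_phase_smul_le _ _ _ _).trans
    (mul_le_mul (pow_le_pow_left₀ (norm_nonneg _) (norm_latticeVec_le_weight _) _)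
      (norm_smul_Upow_le _ _) (norm_nonneg _) (pow_nonneg (weight_pos _).le _))

theorem RapidDecay.tsum_mem (h : RapidDecay a κ) :
    ∑' i, a i • (Upow θ (κ i) : Op n) ∈ smoothSubalgebra θ :=
  ⟨(StarSubalgebra.isClosed_topologicalClosure _).mem_of_tendsto
    h.summable_norm_smul_Upow.of_norm.hasSum
    (.of_forall fun _ => sum_mem fun i _ => (ncTorus θ).smul_mem (Upow_mem_smooth θ (κ i)).1 _),
    h.contDiff_alpha_tsum⟩

/-- The sum `∑ a_i U^{κ_i}` of a rapidly decreasing family, as an element of `𝒜_θ`. -/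
def RapidDecay.sum (h : RapidDecay a κ) (θ : Matrix (Fin n) (Fin n) ℝ) : SmoothTorus θ :=
  ⟨∑' i, a i • (Upow θ (κ i) : Op n), h.tsum_mem⟩

theorem RapidDecay.hasSum_toOp (h : RapidDecay a κ) :
    HasSum (fun i => a i • (Upow θ (κ i) : Op n)) (toOp (h.sum θ)) :=
  h.summable_norm_smul_Upow.of_norm.hasSum

theorem RapidDecay.hasSum_fourierCoeff (h : RapidDecay a κ) (k : Fin n → ℤ) :
    HasSum (fun i => a i * if κ i = k then 1 else 0) (fourierCoeff θ k (h.sum θ)) := by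
  have hsum := (h.hasSum_toOp (θ := θ)).mapL (opCoeff θ k)
  simp only [map_smul, opCoeff_Upow, smul_eq_mul] at hsum
  exact hsum

theorem RapidDecay.deltaPow_sum (h : RapidDecay a κ) (β : Fin n → ℕ) :
    deltaPow β (h.sum θ) = (h.mul_multiPow β).sum θ := by
  refine ext_fourierCoeff fun k => ?_
  rw [fourierCoeff_deltaPow]
  refine ((h.hasSum_fourierCoeff k).mul_left _).unique ?_
  convert! (h.mul_multiPow β).hasSum_fourierCoeff k using 1
  ext1 i
  split_ifs with hi
  · rw [hi, mul_one, mul_one]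
  · simp only [mul_zero]

theorem RapidDecay.hasSum (h : RapidDecay a κ) :
    HasSum (fun i => a i • monomial θ (κ i)) (h.sum θ) := by
  refine ((SmoothTorus.withSeminorms θ).tendsto_nhds _ _).2 fun β ε hε => ?_
  filter_upwards [Metric.tendsto_nhds.1 (h.mul_multiPow β).hasSum_toOp ε hε] with F hF
  rw [dist_eq_norm, ← h.deltaPow_sum] at hF
  simpa only [seminorms_apply, map_sub, map_sum, map_smul, deltaPow_monomial, toOp_monomial,
    smul_smul, mul_comm (a _)] using hF

theorem sum_fourierCoeff (u : SmoothTorus θ) : (rapidDecay_fourierCoeff u).sum θ = u := by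
  refine ext_fourierCoeff fun k => ?_
  refine ((rapidDecay_fourierCoeff u).hasSum_fourierCoeff k).unique ?_
  convert! hasSum_ite_eq k (fourierCoeff θ k u) using 2 with l
  by_cases hl : l = k <;> simp [hl]

theorem hasSum_fourier (u : SmoothTorus θ) :
    HasSum (fun k => fourierCoeff θ k u • monomial θ k) u := by
  simpa only [sum_fourierCoeff, id] using (rapidDecay_fourierCoeff u).hasSum (θ := θ)

theorem hasSum_dual (φ : Dual θ) (u : SmoothTorus θ) :
    HasSum (fun k => fourierCoeff θ k u * φ (monomial θ k)) (φ u) := by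
  simpa only [map_smul, smul_eq_mul] using (hasSum_fourier u).mapL φ

theorem rapidDecay_mul (u v : SmoothTorus θ) :
    RapidDecay (fun p : (Fin n → ℤ) × (Fin n → ℤ) =>
      fourierCoeff θ p.1 u * fourierCoeff θ p.2 v * cocycle θ p.1 p.2) fun p => p.1 + p.2 := by
  intro N
  refine ((rapidDecay_fourierCoeff u N).mul_of_nonneg (rapidDecay_fourierCoeff v N)
    (fun k => weight_pow_mul_norm_nonneg k N _)
    fun k => weight_pow_mul_norm_nonneg k N _).of_nonneg_of_le
    (fun p => weight_pow_mul_norm_nonneg _ N _) fun p => ?_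
  rw [norm_mul, norm_mul, norm_cocycle, mul_one, mul_mul_mul_comm, ← mul_pow]
  exact mul_le_mul_of_nonneg_right
    (pow_le_pow_left₀ (weight_pos _).le (weight_add_le _ _) _) (by positivity)

theorem sum_rapidDecay_mul (u v : SmoothTorus θ) : (rapidDecay_mul u v).sum θ = u * v := by
  have hsummable (w : SmoothTorus θ) := (rapidDecay_fourierCoeff w).summable_norm_smul_Upow (θ := θ)
  have htsum (w : SmoothTorus θ) : ∑' k, fourierCoeff θ k w • (Upow θ k : Op n) = toOp w :=
    congrArg toOp (sum_fourierCoeff w)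
  have hprod := (summable_mul_of_summable_norm (hsummable u) (hsummable v)).hasSum
  rw [← tsum_mul_tsum_of_summable_norm (hsummable u) (hsummable v)] at hprod
  simp only [id, htsum, smul_mul_smul_comm, Upow_mul, smul_smul] at hprod
  exact toOp_injective ((rapidDecay_mul u v).hasSum_toOp.unique hprod)

theorem hasSum_mul (u v : SmoothTorus θ) :
    HasSum (fun p : (Fin n → ℤ) × (Fin n → ℤ) =>
      (fourierCoeff θ p.1 u * fourierCoeff θ p.2 v * cocycle θ p.1 p.2) • monomial θ (p.1 + p.2))
      (u * v) := by
  simpa only [sum_rapidDecay_mul] using (rapidDecay_mul u v).hasSum (θ := θ)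

theorem exists_norm_dual_monomial_le (φ : Dual θ) :
    ∃ C : ℝ, ∃ N : ℕ, 0 ≤ C ∧ ∀ k, ‖φ (monomial θ k)‖ ≤ C * weight k ^ N := by
  let q : Seminorm ℂ (SmoothTorus θ) := (normSeminorm ℂ ℂ).comp φ.toLinearMap
  obtain ⟨F, C, -, hC⟩ := Seminorm.bound_of_continuous (SmoothTorus.withSeminorms θ) q
    (continuous_norm.comp φ.continuous)
  refine ⟨C, F.sup fun β => ∑ j, β j, C.2, fun k => (hC (monomial θ k)).trans ?_⟩
  refine mul_le_mul_of_nonneg_left (?_ : F.sup (SmoothTorus.seminorms θ) (monomial θ k) ≤ _) C.2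
  refine Seminorm.finset_sup_apply_le (pow_nonneg (weight_pos k).le _) fun β hβ => ?_
  rw [seminorms_apply, deltaPow_monomial, map_smul, toOp_monomial]
  calc ‖multiPow β k • (Upow θ k : Op n)‖ ≤ weight k ^ ∑ j, β j :=
        (norm_smul_Upow_le _ k).trans (norm_multiPow_le β k)
    _ ≤ weight k ^ F.sup fun β => ∑ j, β j :=
        pow_le_pow_right₀ (one_le_weight k) (Finset.le_sup (f := fun β => ∑ j, β j) hβ)

theorem Dual.ext_coeff {φ ψ : Dual θ} (h : ∀ k, φ.coeff k = ψ.coeff k) : φ = ψ := by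
  have hmonomial (k : Fin n → ℤ) : φ (monomial θ k) = ψ (monomial θ k) := by
    have hcoeff := h (-k)
    rw [Dual.coeff, Dual.coeff, star_monomial, map_smul, map_smul, neg_neg] at hcoeff
    exact smul_right_injective ℂ (inv_ne_zero (cocycle_ne_zero θ _ _)) hcoeff
  ext u
  have hsum := hasSum_dual φ u
  simp_rw [hmonomial] at hsum
  exact hsum.unique (hasSum_dual ψ u)

end RapidDecay

/-! ### Oscillating integrals with polynomially bounded amplitudes -/

section PartialFourier

open scoped FourierTransform

variable {E : Type*} [NormedAddCommGroup E]

theorem slice_eq_zero_of_notMem {χ : E × E → ℂ} {σ : E} (h : σ ∉ Prod.fst '' tsupport χ) (ζ : E) :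
    χ (σ, ζ) = 0 :=
  image_eq_zero_of_notMem_tsupport fun hmem => h ⟨_, hmem, rfl⟩

theorem hasCompactSupport_slice {χ : E × E → ℂ} (hsupp : HasCompactSupport χ) (ζ : E) :
    HasCompactSupport fun σ => χ (σ, ζ) :=
  HasCompactSupport.intro (IsCompact.image hsupp continuous_fst) fun _ h =>
    slice_eq_zero_of_notMem h ζ

variable [InnerProductSpace ℝ E] {χ : E × E → ℂ}

theorem contDiff_slice (hχ : ContDiff ℝ ∞ χ) (ζ : E) : ContDiff ℝ ∞ fun σ => χ (σ, ζ) :=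
  hχ.comp (contDiff_id.prodMk contDiff_const)

theorem norm_iteratedFDeriv_slice_le (hχ : ContDiff ℝ ∞ χ) (j : ℕ) (ζ σ : E) :
    ‖iteratedFDeriv ℝ j (fun σ => χ (σ, ζ)) σ‖ ≤ ‖iteratedFDeriv ℝ j χ (σ, ζ)‖ := by
  let L : E →L[ℝ] E × E := ContinuousLinearMap.inl ℝ E E
  have hslice : (fun σ => χ (σ, ζ)) = (fun p => χ (p + (0, ζ))) ∘ L := by
    ext1 σ; simp [L]
  have hshift : ContDiff ℝ ∞ fun p => χ (p + (0, ζ)) := hχ.comp (contDiff_id.add contDiff_const)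
  rw [hslice, L.iteratedFDeriv_comp_right hshift σ (by exact_mod_cast le_top)]
  refine (ContinuousMultilinearMap.norm_compContinuousLinearMap_le _ _).trans ?_
  rw [Finset.prod_const, iteratedFDeriv_comp_add_right,
    show L σ + (0, ζ) = (σ, ζ) by simp [L]]
  exact mul_le_of_le_one_right (norm_nonneg _)
    (pow_le_one₀ (norm_nonneg _) (ContinuousLinearMap.norm_inl_le_one ℝ E E))

variable [FiniteDimensional ℝ E] [MeasurableSpace E] [BorelSpace E]

theorem exists_integral_iteratedFDeriv_slice_le (hχ : ContDiff ℝ ∞ χ) (hsupp : HasCompactSupport χ)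
    (j : ℕ) : ∃ C, ∀ ζ : E, ∫ σ, ‖iteratedFDeriv ℝ j (fun σ => χ (σ, ζ)) σ‖ ≤ C := by
  obtain ⟨B, hB⟩ := (hsupp.iteratedFDeriv j).exists_bound_of_continuous
    (hχ.continuous_iteratedFDeriv (by exact_mod_cast le_top))
  set K := Prod.fst '' tsupport χ
  have hK : IsCompact K := IsCompact.image hsupp continuous_fst
  refine ⟨∫ σ, K.indicator (fun _ => B) σ, fun ζ => ?_⟩
  refine integral_mono_of_nonneg (.of_forall fun σ => norm_nonneg _)
    ((integrable_indicator_iff hK.measurableSet).2 (integrableOn_const hK.measure_lt_top.ne))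
    (.of_forall fun σ => (norm_iteratedFDeriv_slice_le hχ j ζ σ).trans ?_)
  by_cases hσ : σ ∈ K
  · rw [Set.indicator_of_mem hσ]
    exact hB _
  · rw [Set.indicator_of_notMem hσ, norm_le_zero_iff]
    by_contra hne
    exact hσ ⟨_, support_iteratedFDeriv_subset j hne, rfl⟩

/-- The Fourier transform of `χ` in the first variable, irreducible so that the continuity tactics
do not see through it. -/
@[irreducible]
def partialFourier (χ : E × E → ℂ) (η ζ : E) : ℂ := 𝓕 (fun σ => χ (σ, ζ)) η

theorem partialFourier_eq_fourier (χ : E × E → ℂ) (ζ : E) :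
    (fun η => partialFourier χ η ζ) = 𝓕 fun σ => χ (σ, ζ) := by
  unfold partialFourier; rfl

theorem partialFourier_eq_integral (χ : E × E → ℂ) (η ζ : E) :
    partialFourier χ η ζ = ∫ σ, Real.fourierChar (-inner ℝ σ η) • χ (σ, ζ) := by
  rw [partialFourier, Real.fourier_eq]

theorem exists_norm_pow_mul_partialFourier_le (hχ : ContDiff ℝ ∞ χ) (hsupp : HasCompactSupport χ)
    (N : ℕ) : ∃ C, ∀ η ζ : E, ‖η‖ ^ N * ‖partialFourier χ η ζ‖ ≤ C := by
  choose C hC using exists_integral_iteratedFDeriv_slice_le hχ hsupp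
  refine ⟨2 ^ N * ∑ p ∈ Finset.range 1 ×ˢ Finset.range (N + 1), C p.2, fun η ζ => ?_⟩
  have hslice := contDiff_slice hχ ζ
  have hint (m : ℕ) : Integrable fun σ => ‖iteratedFDeriv ℝ m (fun σ => χ (σ, ζ)) σ‖ :=
    ((hslice.continuous_iteratedFDeriv (by exact_mod_cast le_top)).integrable_of_hasCompactSupport
      ((hasCompactSupport_slice hsupp ζ).iteratedFDeriv m)).norm
  have hfourier := Real.pow_mul_norm_iteratedFDeriv_fourier_le (K := 0) (N := ⊤) (k := 0) (n := N)
    hslice (fun k m hk _ => by simpa [show k = 0 by simpa using hk] using hint m) le_rfl le_top η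
  rw [norm_iteratedFDeriv_zero] at hfourier
  rw [congrFun (partialFourier_eq_fourier χ ζ) η]
  refine hfourier.trans ?_
  simp only [pow_zero, one_mul, Nat.cast_zero, mul_zero, zero_add]
  refine mul_le_mul_of_nonneg_left (Finset.sum_le_sum fun p hp => ?_) (by positivity)
  simpa [show p.1 = 0 by simpa using (Finset.mem_product.1 hp).1] using hC p.2 ζ

theorem exists_one_add_norm_pow_mul_partialFourier_le (hχ : ContDiff ℝ ∞ χ)
    (hsupp : HasCompactSupport χ) (N : ℕ) :
    ∃ C, ∀ η ζ : E, (1 + ‖η‖) ^ N * ‖partialFourier χ η ζ‖ ≤ C := by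
  obtain ⟨C, hC⟩ := exists_norm_pow_mul_partialFourier_le hχ hsupp 0
  obtain ⟨D, hD⟩ := exists_norm_pow_mul_partialFourier_le hχ hsupp N
  refine ⟨2 ^ (N - 1) * (C + D), fun η ζ => ?_⟩
  calc (1 + ‖η‖) ^ N * ‖partialFourier χ η ζ‖
      ≤ 2 ^ (N - 1) * (1 ^ N + ‖η‖ ^ N) * ‖partialFourier χ η ζ‖ :=
        mul_le_mul_of_nonneg_right (add_pow_le zero_le_one (norm_nonneg η) N) (norm_nonneg _)
    _ = 2 ^ (N - 1) *
          (‖η‖ ^ 0 * ‖partialFourier χ η ζ‖ + ‖η‖ ^ N * ‖partialFourier χ η ζ‖) := by ring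
    _ ≤ 2 ^ (N - 1) * (C + D) :=
        mul_le_mul_of_nonneg_left (add_le_add (hC η ζ) (hD η ζ)) (by positivity)

theorem continuous_uncurry_partialFourier (hχ : ContDiff ℝ ∞ χ) (hsupp : HasCompactSupport χ) :
    Continuous fun p : E × E => partialFourier χ p.1 p.2 := by
  obtain ⟨B, hB⟩ := hsupp.exists_bound_of_continuous hχ.continuous
  set K := Prod.fst '' tsupport χ
  have hK : IsCompact K := IsCompact.image hsupp continuous_fst
  have hcont := hχ.continuous
  simp only [partialFourier_eq_integral]
  refine continuous_of_dominated (bound := K.indicator fun _ => B)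
    (fun p => Continuous.aestronglyMeasurable (by fun_prop)) (fun p => .of_forall fun σ => ?_)
    ((integrable_indicator_iff hK.measurableSet).2 (integrableOn_const hK.measure_lt_top.ne))
    (.of_forall fun σ => by fun_prop)
  rw [Circle.norm_smul]
  by_cases hσ : σ ∈ K
  · rw [Set.indicator_of_mem hσ]
    exact hB _
  · rw [Set.indicator_of_notMem hσ, slice_eq_zero_of_notMem hσ, norm_zero]

theorem continuous_partialFourier (hχ : ContDiff ℝ ∞ χ) (hsupp : HasCompactSupport χ)
    {X : Type*} [TopologicalSpace X] {f g : X → E} (hf : Continuous f) (hg : Continuous g) :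
    Continuous fun x => partialFourier χ (f x) (g x) :=
  (continuous_uncurry_partialFourier hχ hsupp).comp (hf.prodMk hg)

variable (E) in
theorem integrable_inv_one_add_norm_pow :
    Integrable fun η : E => ((1 + ‖η‖) ^ (Module.finrank ℝ E + 1))⁻¹ := by
  refine (integrable_one_add_norm (E := E) (μ := volume) (r := Module.finrank ℝ E + 1)
    (by simp)).congr (.of_forall fun η => ?_)
  dsimp only
  rw [Real.rpow_neg (by positivity)]
  exact_mod_cast congrArg Inv.inv (Real.rpow_natCast (1 + ‖η‖) (Module.finrank ℝ E + 1))

theorem integrable_partialFourier (hχ : ContDiff ℝ ∞ χ) (hsupp : HasCompactSupport χ) (ζ : E) :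
    Integrable fun η => partialFourier χ η ζ := by
  obtain ⟨C, hC⟩ := exists_one_add_norm_pow_mul_partialFourier_le hχ hsupp
    (Module.finrank ℝ E + 1)
  refine ((integrable_inv_one_add_norm_pow E).const_mul C).mono'
    (continuous_partialFourier hχ hsupp continuous_id continuous_const).aestronglyMeasurable
    (.of_forall fun η => ?_)
  rw [← div_eq_mul_inv, le_div_iff₀ (by positivity), mul_comm]
  exact hC η ζ

theorem integral_partialFourier (hχ : ContDiff ℝ ∞ χ) (hsupp : HasCompactSupport χ) (ζ : E) :
    ∫ η, partialFourier χ η ζ = χ (0, ζ) := by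
  have hcont := (contDiff_slice hχ ζ).continuous
  have hinv := (hcont.integrable_of_hasCompactSupport
    (hasCompactSupport_slice hsupp ζ)).fourierInv_fourier_eq
    (partialFourier_eq_fourier χ ζ ▸ integrable_partialFourier hχ hsupp ζ) hcont.continuousAt
    (v := 0)
  rw [Real.fourierInv_eq, ← partialFourier_eq_fourier] at hinv
  simpa only [inner_zero_right, AddChar.map_zero_eq_one, one_smul] using hinv

end PartialFourier

section OscillatingIntegral

variable {E : Type*} [NormedAddCommGroup E] [InnerProductSpace ℝ E] [FiniteDimensional ℝ E]
  [MeasurableSpace E] [BorelSpace E] {χ : E × E → ℂ}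

/-- The oscillating integral `(2π)⁻ᵈ ∬ e^{i s·ξ} a(s, ξ) ds dξ`, `d = dim E`, regularized by the
cut-off `χ(ε s, ε ξ)`. -/
def regularizedOscIntegral (χ : E × E → ℂ) (a : E → E → ℂ) (ε : ℝ) : ℂ :=
  (((2 * Real.pi) ^ Module.finrank ℝ E : ℝ) : ℂ)⁻¹ * ∫ p : E × E,
    Complex.exp (Complex.I * (inner ℝ p.1 p.2 : ℝ)) * (χ (ε • p) * a p.1 p.2)

/-- The amplitude `e^{-i s·x} g(ξ)`. -/
def modulated (x : E) (g : E → ℂ) (s ξ : E) : ℂ :=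
  Complex.exp (Complex.I * (inner ℝ (-s) x : ℝ)) * g ξ

omit [FiniteDimensional ℝ E] [MeasurableSpace E] [BorelSpace E] in
theorem norm_modulated (x : E) (g : E → ℂ) (s ξ : E) : ‖modulated x g s ξ‖ = ‖g ξ‖ := by
  rw [modulated, norm_mul, mul_comm Complex.I, Complex.norm_exp_ofReal_mul_I, one_mul]

theorem integrable_regularized_modulated (hχ : Continuous χ) (hsupp : HasCompactSupport χ) (x : E)
    {g : E → ℂ} (hg : Continuous g) {ε : ℝ} (hε : 0 < ε) :
    Integrable fun p : E × E =>
      Complex.exp (Complex.I * (inner ℝ p.1 p.2 : ℝ)) * (χ (ε • p) * modulated x g p.1 p.2) := by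
  simp only [modulated]
  exact Continuous.integrable_of_hasCompactSupport (by fun_prop)
    (hsupp.comp_homeomorph (Homeomorph.smulOfNeZero ε hε.ne')).mul_right.mul_left

omit [FiniteDimensional ℝ E] [MeasurableSpace E] [BorelSpace E] in
theorem fourierChar_rescaled_inner {ε : ℝ} (hε : 0 < ε) (x s ξ : E) :
    (Real.fourierChar (-inner ℝ (ε • s) ((2 * Real.pi * ε)⁻¹ • (x - ξ))) : ℂ) =
      Complex.exp (Complex.I * (inner ℝ s ξ : ℝ)) *
        Complex.exp (Complex.I * (inner ℝ (-s) x : ℝ)) := by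
  rw [Real.fourierChar_apply, ← Complex.exp_add, inner_smul_left, inner_smul_right,
    inner_sub_right, inner_neg_left]
  have hpi : (Real.pi : ℂ) ≠ 0 := by exact_mod_cast Real.pi_pos.ne'
  have hε' : (ε : ℂ) ≠ 0 := by exact_mod_cast hε.ne'
  congr 1
  simp only [conj_trivial]
  push_cast
  field_simp
  ring

theorem integral_regularized_modulated_left (x : E) (g : E → ℂ) {ε : ℝ} (hε : 0 < ε) (ξ : E) :
    ∫ s : E, Complex.exp (Complex.I * (inner ℝ s ξ : ℝ)) *
        (χ (ε • (s, ξ)) * modulated x g s ξ) =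
      (((ε ^ Module.finrank ℝ E)⁻¹ : ℝ) : ℂ) *
        (partialFourier χ ((2 * Real.pi * ε)⁻¹ • (x - ξ)) (ε • ξ) * g ξ) := by
  have hscale := Measure.integral_comp_smul (volume : Measure E) (fun σ =>
    Real.fourierChar (-inner ℝ σ ((2 * Real.pi * ε)⁻¹ • (x - ξ))) • χ (σ, ε • ξ)) ε
  rw [abs_of_pos (by positivity), ← partialFourier_eq_integral, Complex.real_smul] at hscale
  rw [← mul_assoc, ← hscale, ← integral_mul_const]
  refine integral_congr_ae (.of_forall fun s => ?_)
  dsimp only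
  rw [Circle.smul_def, fourierChar_rescaled_inner hε, smul_eq_mul, modulated, Prod.smul_mk]
  ring

/-- Substitute `ξ = x - 2πε η` after integrating over `s`. -/
theorem regularizedOscIntegral_modulated (hχ : Continuous χ) (hsupp : HasCompactSupport χ) (x : E)
    {g : E → ℂ} (hg : Continuous g) {ε : ℝ} (hε : 0 < ε) :
    regularizedOscIntegral χ (modulated x g) ε =
      ∫ η, partialFourier χ η (ε • (x - (2 * Real.pi * ε) • η)) *
        g (x - (2 * Real.pi * ε) • η) := by
  have hr : 0 < 2 * Real.pi * ε := by positivity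
  let inner_integral : E → ℂ := fun ξ =>
    partialFourier χ ((2 * Real.pi * ε)⁻¹ • (x - ξ)) (ε • ξ) * g ξ
  have hsubst : ∫ η, inner_integral (x - (2 * Real.pi * ε) • η) =
      ((((2 * Real.pi * ε) ^ Module.finrank ℝ E)⁻¹ : ℝ) : ℂ) * ∫ ξ, inner_integral ξ := by
    rw [Measure.integral_comp_smul volume (fun η => inner_integral (x - η)),
      integral_sub_left_eq_self, abs_of_pos (by positivity), Complex.real_smul]
  simp only [inner_integral, sub_sub_cancel, smul_smul, inv_mul_cancel₀ hr.ne', one_smul] at hsubst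
  rw [hsubst, regularizedOscIntegral, Measure.volume_eq_prod,
    integral_prod_symm _ (integrable_regularized_modulated hχ hsupp x hg hε)]
  simp_rw [integral_regularized_modulated_left x g hε]
  rw [integral_const_mul, ← mul_assoc]
  congr 1
  push_cast
  rw [mul_pow _ (ε : ℂ), mul_inv]

omit [FiniteDimensional ℝ E] [MeasurableSpace E] [BorelSpace E] in
theorem one_add_norm_sub_smul_le (x η : E) {ε : ℝ} (hε : 0 < ε) (hε1 : ε ≤ 1) :
    1 + ‖x - (2 * Real.pi * ε) • η‖ ≤ 8 * (1 + ‖x‖) * (1 + ‖η‖) := by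
  have hscale : ‖(2 * Real.pi * ε) • η‖ ≤ 8 * ‖η‖ := by
    rw [norm_smul, Real.norm_of_nonneg (by positivity)]
    exact mul_le_mul_of_nonneg_right (by nlinarith [Real.pi_pos, Real.pi_le_four]) (norm_nonneg _)
  have hprod : 0 ≤ ‖x‖ * ‖η‖ := by positivity
  linarith [norm_sub_le x ((2 * Real.pi * ε) • η), norm_nonneg x]

theorem norm_partialFourier_mul_le {M : ℕ} {C A : ℝ}
    (hC : ∀ η ζ : E, (1 + ‖η‖) ^ (M + (Module.finrank ℝ E + 1)) * ‖partialFourier χ η ζ‖ ≤ C)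
    {g : E → ℂ} (hg : ∀ ξ, ‖g ξ‖ ≤ A * (1 + ‖ξ‖) ^ M) (x : E) {ε : ℝ} (hε : 0 < ε) (hε1 : ε ≤ 1)
    (η ζ : E) :
    ‖partialFourier χ η ζ * g (x - (2 * Real.pi * ε) • η)‖ ≤
      C * (8 ^ M * (A * (1 + ‖x‖) ^ M)) * ((1 + ‖η‖) ^ (Module.finrank ℝ E + 1))⁻¹ := by
  have hA : 0 ≤ A := by simpa using (norm_nonneg _).trans (hg 0)
  rw [norm_mul, ← div_eq_mul_inv, le_div_iff₀ (by positivity)]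
  calc ‖partialFourier χ η ζ‖ * ‖g (x - (2 * Real.pi * ε) • η)‖ *
        (1 + ‖η‖) ^ (Module.finrank ℝ E + 1)
      ≤ ‖partialFourier χ η ζ‖ * (A * (8 * (1 + ‖x‖) * (1 + ‖η‖)) ^ M) *
        (1 + ‖η‖) ^ (Module.finrank ℝ E + 1) := by
        gcongr
        exact (hg _).trans (by gcongr; exact one_add_norm_sub_smul_le x η hε hε1)
    _ = (1 + ‖η‖) ^ (M + (Module.finrank ℝ E + 1)) * ‖partialFourier χ η ζ‖ *
        (8 ^ M * (A * (1 + ‖x‖) ^ M)) := by rw [mul_pow, mul_pow, pow_add]; ring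
    _ ≤ C * (8 ^ M * (A * (1 + ‖x‖) ^ M)) :=
        mul_le_mul_of_nonneg_right (hC η ζ) (by positivity)

theorem eventually_mem_Ioc_zero_one : ∀ᶠ ε : ℝ in 𝓝[>] 0, 0 < ε ∧ ε ≤ 1 :=
  Ioc_mem_nhdsGT zero_lt_one

theorem exists_norm_regularizedOscIntegral_modulated_le (hχ : ContDiff ℝ ∞ χ)
    (hsupp : HasCompactSupport χ) (M : ℕ) :
    ∃ C, ∀ {A : ℝ} {g : E → ℂ} (_ : Continuous g) (_ : ∀ ξ, ‖g ξ‖ ≤ A * (1 + ‖ξ‖) ^ M) (x : E)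
      {ε : ℝ} (_ : 0 < ε) (_ : ε ≤ 1),
      ‖regularizedOscIntegral χ (modulated x g) ε‖ ≤ C * (A * (1 + ‖x‖) ^ M) := by
  obtain ⟨C, hC⟩ := exists_one_add_norm_pow_mul_partialFourier_le hχ hsupp
    (M + (Module.finrank ℝ E + 1))
  refine ⟨C * 8 ^ M * ∫ η : E, ((1 + ‖η‖) ^ (Module.finrank ℝ E + 1))⁻¹,
    fun {A g} hg hgrowth x {ε} hε hε1 => ?_⟩
  rw [regularizedOscIntegral_modulated hχ.continuous hsupp x hg hε]
  refine (norm_integral_le_of_norm_le ((integrable_inv_one_add_norm_pow E).const_mul _)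
    (.of_forall fun η => norm_partialFourier_mul_le hC hgrowth x hε hε1 η _)).trans_eq ?_
  rw [integral_const_mul]
  ring

/-- In the limit the integral over `η` in `regularizedOscIntegral_modulated` is Fourier inversion
for `χ(·, 0)` at the origin. -/
theorem tendsto_regularizedOscIntegral_modulated (hχ : ContDiff ℝ ∞ χ) (hsupp : HasCompactSupport χ)
    (hχ0 : χ 0 = 1) {M : ℕ} {A : ℝ} {g : E → ℂ} (hg : Continuous g)
    (hgrowth : ∀ ξ, ‖g ξ‖ ≤ A * (1 + ‖ξ‖) ^ M) (x : E) :
    Tendsto (regularizedOscIntegral χ (modulated x g)) (𝓝[>] 0) (𝓝 (g x)) := by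
  obtain ⟨C, hC⟩ := exists_one_add_norm_pow_mul_partialFourier_le hχ hsupp
    (M + (Module.finrank ℝ E + 1))
  let integrand (ε : ℝ) (η : E) : ℂ :=
    partialFourier χ η (ε • (x - (2 * Real.pi * ε) • η)) * g (x - (2 * Real.pi * ε) • η)
  have hlimit : ∫ η, integrand 0 η = g x := by
    simp only [integrand, zero_smul, mul_zero, sub_zero]
    rw [integral_mul_const, integral_partialFourier hχ hsupp, Prod.mk_zero_zero, hχ0, one_mul]
  have htendsto : Tendsto (fun ε => ∫ η, integrand ε η) (𝓝[>] 0) (𝓝 (∫ η, integrand 0 η)) := by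
    refine tendsto_integral_filter_of_dominated_convergence _ (.of_forall fun ε => ?_)
      (eventually_mem_Ioc_zero_one.mono fun ε hε => .of_forall fun η =>
        norm_partialFourier_mul_le hC hgrowth x hε.1 hε.2 η _)
      ((integrable_inv_one_add_norm_pow E).const_mul _) (.of_forall fun η => ?_)
    · exact ((continuous_partialFourier hχ hsupp continuous_id (by fun_prop)).mul
        (by fun_prop)).aestronglyMeasurable
    · have hcont : Continuous fun ε => integrand ε η :=
        (continuous_partialFourier hχ hsupp continuous_const (by fun_prop)).mul (by fun_prop)
      exact (hcont.tendsto 0).mono_left nhdsWithin_le_nhds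
  rw [hlimit] at htendsto
  exact htendsto.congr' (eventually_mem_Ioc_zero_one.mono fun ε hε =>
    (regularizedOscIntegral_modulated hχ.continuous hsupp x hg hε.1).symm)

variable {I : Type*} [Countable I] {x : I → E} {g : I → E → ℂ} {A : I → ℝ} {M : ℕ}

theorem hasSum_regularizedOscIntegral_modulated (hχ : Continuous χ) (hsupp : HasCompactSupport χ)
    (hg : ∀ i, Continuous (g i)) (hgrowth : ∀ i ξ, ‖g i ξ‖ ≤ A i * (1 + ‖ξ‖) ^ M)
    (hA : Summable A) {ε : ℝ} (hε : 0 < ε) :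
    HasSum (fun i => regularizedOscIntegral χ (modulated (x i) (g i)) ε)
      (regularizedOscIntegral χ (fun s ξ => ∑' i, modulated (x i) (g i) s ξ) ε) := by
  have hint (i : I) := integrable_regularized_modulated hχ hsupp (x i) (hg i) hε
  have hcutoff : Integrable fun p : E × E => ‖χ (ε • p)‖ * (1 + ‖p.2‖) ^ M :=
    Continuous.integrable_of_hasCompactSupport (by fun_prop)
      (hsupp.comp_homeomorph (Homeomorph.smulOfNeZero ε hε.ne')).norm.mul_right
  have hbound (i : I) (p : E × E) : ‖Complex.exp (Complex.I * (inner ℝ p.1 p.2 : ℝ)) *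
      (χ (ε • p) * modulated (x i) (g i) p.1 p.2)‖ ≤ A i * (‖χ (ε • p)‖ * (1 + ‖p.2‖) ^ M) := by
    rw [norm_mul, norm_mul, norm_modulated, mul_comm Complex.I, Complex.norm_exp_ofReal_mul_I,
      one_mul, mul_left_comm]
    exact mul_le_mul_of_nonneg_left (hgrowth i p.2) (norm_nonneg _)
  have hsummable : Summable fun i => ∫ p : E × E,
      ‖Complex.exp (Complex.I * (inner ℝ p.1 p.2 : ℝ)) *
        (χ (ε • p) * modulated (x i) (g i) p.1 p.2)‖ := by
    refine (hA.mul_right (∫ p : E × E, ‖χ (ε • p)‖ * (1 + ‖p.2‖) ^ M)).of_nonneg_of_le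
      (fun i => integral_nonneg fun p => norm_nonneg _) fun i => ?_
    rw [← integral_const_mul]
    exact integral_mono (hint i).norm (hcutoff.const_mul _) (hbound i)
  have hsum := (hasSum_integral_of_summable_integral_norm hint hsummable).mul_left
    ((((2 * Real.pi) ^ Module.finrank ℝ E : ℝ) : ℂ)⁻¹)
  simp only [tsum_mul_left] at hsum
  exact hsum

theorem tendsto_regularizedOscIntegral_tsum_modulated (hχ : ContDiff ℝ ∞ χ)
    (hsupp : HasCompactSupport χ) (hχ0 : χ 0 = 1) (hg : ∀ i, Continuous (g i))
    (hgrowth : ∀ i ξ, ‖g i ξ‖ ≤ A i * (1 + ‖ξ‖) ^ M)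
    (hA : Summable fun i => A i * (1 + ‖x i‖) ^ M) :
    Tendsto (regularizedOscIntegral χ fun s ξ => ∑' i, modulated (x i) (g i) s ξ) (𝓝[>] 0)
      (𝓝 (∑' i, g i (x i))) := by
  have hA0 (i : I) : 0 ≤ A i := by simpa using (norm_nonneg _).trans (hgrowth i 0)
  have hsummable : Summable A := hA.of_nonneg_of_le hA0 fun i =>
    le_mul_of_one_le_right (hA0 i) (one_le_pow₀ (le_add_of_nonneg_right (norm_nonneg _)))
  obtain ⟨C, hC⟩ := exists_norm_regularizedOscIntegral_modulated_le hχ hsupp M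
  refine (tendsto_tsum_of_dominated_convergence (hA.mul_left C)
    (fun i => tendsto_regularizedOscIntegral_modulated hχ hsupp hχ0 (hg i) (hgrowth i) (x i))
    (eventually_mem_Ioc_zero_one.mono fun ε hε i =>
      hC (hg i) (hgrowth i) (x i) hε.1 hε.2)).congr' ?_
  exact eventually_mem_Ioc_zero_one.mono fun ε hε =>
    (hasSum_regularizedOscIntegral_modulated hχ.continuous hsupp hg hgrowth hsummable hε.1).tsum_eq

end OscillatingIntegral

/-! ### Pseudodifferential operators in terms of Fourier coefficients -/

section Quantization

variable {θ : Matrix (Fin n) (Fin n) ℝ} {m : ℝ}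

open SmoothTorus

theorem partialPow_zero (f : Eucl n → SmoothTorus θ) : partialPow 0 f = f := by
  have hword : word (0 : Fin n → ℕ) = [] := by simp [word]
  rw [partialPow, hword]
  rfl

theorem seminorms_symbol_le (ρ : SymbolSpace θ m) (α : Fin n → ℕ) (ξ : Eucl n) :
    SmoothTorus.seminorms θ α (SymbolSpace.toFun ρ ξ) ≤
      SymbolSpace.seminorms θ m (α, 0) ρ * (1 + ‖ξ‖) ^ m := by
  have hpos : 0 < 1 + ‖ξ‖ := by positivity
  have hsup : weighted m α 0 (SymbolSpace.toFun ρ) ξ ≤ SymbolSpace.seminorms θ m (α, 0) ρ :=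
    le_ciSup (ρ.bddAbove_weighted α 0) ξ
  rw [weighted, partialPow_zero] at hsup
  simp only [Pi.zero_apply, Nat.cast_zero, Finset.sum_const_zero, add_zero] at hsup
  rwa [Real.rpow_neg hpos.le, inv_mul_le_iff₀ (Real.rpow_pos_of_pos hpos m), mul_comm] at hsup

/-- A continuous seminorm on `𝕊^m(ℝⁿ; 𝒜_θ)` that controls the decay of order `N` of the Fourier
coefficients of a symbol, uniformly in `ξ`; see `decayBound`. -/
def symbolBound (N : ℕ) (ρ : SymbolSpace θ m) : ℝ :=
  (n + 1) ^ N * (SymbolSpace.seminorms θ m (0, 0) ρ +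
    ∑ j, SymbolSpace.seminorms θ m (Pi.single j N, 0) ρ)

theorem symbolBound_nonneg (N : ℕ) (ρ : SymbolSpace θ m) : 0 ≤ symbolBound N ρ :=
  mul_nonneg (by positivity) (add_nonneg (apply_nonneg _ _)
    (Finset.sum_nonneg fun j _ => apply_nonneg _ _))

theorem decayBound_symbol_le (N : ℕ) (ρ : SymbolSpace θ m) (ξ : Eucl n) :
    decayBound N (SymbolSpace.toFun ρ ξ) ≤ symbolBound N ρ * (1 + ‖ξ‖) ^ m := by
  rw [decayBound, symbolBound, mul_assoc, add_mul, Finset.sum_mul]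
  exact mul_le_mul_of_nonneg_left (add_le_add (seminorms_symbol_le ρ 0 ξ)
    (Finset.sum_le_sum fun j _ => seminorms_symbol_le ρ _ ξ)) (by positivity)

/-- The Fourier coefficient `ρ_l(ξ)` of a symbol. -/
def symbolCoeff (ρ : SymbolSpace θ m) (l : Fin n → ℤ) (ξ : Eucl n) : ℂ :=
  fourierCoeff θ l (SymbolSpace.toFun ρ ξ)

theorem continuous_symbolCoeff (ρ : SymbolSpace θ m) (l : Fin n → ℤ) :
    Continuous (symbolCoeff ρ l) :=
  (fourierCoeff θ l).continuous.comp (ρ.isSmooth []).1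

theorem weight_pow_mul_norm_symbolCoeff_le (N : ℕ) (ρ : SymbolSpace θ m) (l : Fin n → ℤ)
    (ξ : Eucl n) : weight l ^ N * ‖symbolCoeff ρ l ξ‖ ≤ symbolBound N ρ * (1 + ‖ξ‖) ^ m :=
  (weight_pow_mul_norm_fourierCoeff_le N l _).trans (decayBound_symbol_le N ρ ξ)

theorem norm_symbolCoeff_le (N : ℕ) (ρ : SymbolSpace θ m) (l : Fin n → ℤ) (ξ : Eucl n) :
    ‖symbolCoeff ρ l ξ‖ ≤ symbolBound N ρ * (weight l ^ N)⁻¹ * (1 + ‖ξ‖) ^ ⌈|m|⌉₊ := by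
  have hpow : (1 + ‖ξ‖) ^ m ≤ (1 + ‖ξ‖) ^ ⌈|m|⌉₊ := by
    rw [← Real.rpow_natCast]
    exact Real.rpow_le_rpow_of_exponent_le (le_add_of_nonneg_right (norm_nonneg _))
      ((le_abs_self m).trans (Nat.le_ceil _))
  rw [mul_right_comm, ← div_eq_mul_inv, le_div_iff₀ (pow_pos (weight_pos l) N), mul_comm]
  exact (weight_pow_mul_norm_symbolCoeff_le N ρ l ξ).trans
    (mul_le_mul_of_nonneg_left hpow (symbolBound_nonneg N ρ))

theorem summable_weight_add_pow_mul_norm_fourierCoeff (u : SmoothTorus θ) (M N : ℕ) :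
    Summable fun p : (Fin n → ℤ) × (Fin n → ℤ) => (weight p.1 ^ (N + (n + 1)))⁻¹ *
      weight p.2 ^ M * (weight (p.1 + p.2) ^ N * ‖fourierCoeff θ p.2 u‖) := by
  have hweight (N : ℕ) (k : Fin n → ℤ) : 0 < weight k ^ N := pow_pos (weight_pos k) N
  have hproduct := (summable_weight n).mul_of_nonneg (rapidDecay_fourierCoeff u (M + N))
    (fun l => (inv_pos.2 (hweight _ l)).le) fun k => weight_pow_mul_norm_nonneg k _ _
  refine hproduct.of_nonneg_of_le (fun p => mul_nonneg (mul_nonneg (inv_pos.2 (hweight _ _)).le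
    (hweight _ _).le) (weight_pow_mul_norm_nonneg _ N _)) fun ⟨l, k⟩ => ?_
  have hadd : weight (l + k) ^ N ≤ weight l ^ N * weight k ^ N := by
    rw [← mul_pow]
    exact pow_le_pow_left₀ (weight_pos _).le (weight_add_le l k) N
  have hl := (hweight N l).ne'
  calc (weight l ^ (N + (n + 1)))⁻¹ * weight k ^ M * (weight (l + k) ^ N * ‖fourierCoeff θ k u‖)
      ≤ (weight l ^ (N + (n + 1)))⁻¹ * weight k ^ M *
        (weight l ^ N * weight k ^ N * ‖fourierCoeff θ k u‖) :=
        mul_le_mul_of_nonneg_left (mul_le_mul_of_nonneg_right hadd (norm_nonneg _))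
          (mul_nonneg (inv_pos.2 (hweight _ l)).le (hweight M k).le)
    _ = (weight l ^ (n + 1))⁻¹ * (weight k ^ (M + N) * ‖fourierCoeff θ k u‖) := by
        rw [pow_add (weight l), pow_add (weight k)]
        field_simp

theorem rapidDecay_psiDO (ρ : SymbolSpace θ m) (u : SmoothTorus θ) :
    RapidDecay (fun p : (Fin n → ℤ) × (Fin n → ℤ) =>
      symbolCoeff ρ p.1 (latticeVec p.2) * fourierCoeff θ p.2 u * cocycle θ p.1 p.2)
      fun p => p.1 + p.2 := by
  intro N
  refine ((summable_weight_add_pow_mul_norm_fourierCoeff u ⌈|m|⌉₊ N).mul_left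
    (symbolBound (N + (n + 1)) ρ)).of_nonneg_of_le
    (fun p => weight_pow_mul_norm_nonneg _ N _) fun ⟨l, k⟩ => ?_
  rw [norm_mul, norm_mul, norm_cocycle, mul_one, mul_left_comm, ← mul_assoc (symbolBound _ ρ),
    ← mul_assoc (symbolBound _ ρ)]
  exact mul_le_mul_of_nonneg_right (norm_symbolCoeff_le _ ρ l (latticeVec k))
    (weight_pow_mul_norm_nonneg _ N _)

theorem hasSum_dual_amplitude (ρ : SymbolSpace θ m) (u : SmoothTorus θ) (φ : Dual θ)
    (s ξ : Eucl n) :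
    HasSum (fun p : (Fin n → ℤ) × (Fin n → ℤ) => modulated (latticeVec p.2) (fun ξ =>
      symbolCoeff ρ p.1 ξ *
        (fourierCoeff θ p.2 u * cocycle θ p.1 p.2 * φ (monomial θ (p.1 + p.2)))) s ξ)
      (φ (amplitude (SymbolSpace.toFun ρ) u s ξ)) := by
  convert! (hasSum_mul (SymbolSpace.toFun ρ ξ) (u.act (-s))).mapL φ using 1
  ext1 p
  rw [map_smul, fourierCoeff_act, smul_eq_mul, modulated, symbolCoeff, phase]
  ring

theorem hasSum_dual_sum_psiDO (ρ : SymbolSpace θ m) (u : SmoothTorus θ) (φ : Dual θ) :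
    HasSum (fun p : (Fin n → ℤ) × (Fin n → ℤ) => symbolCoeff ρ p.1 (latticeVec p.2) *
      (fourierCoeff θ p.2 u * cocycle θ p.1 p.2 * φ (monomial θ (p.1 + p.2))))
      (φ ((rapidDecay_psiDO ρ u).sum θ)) := by
  simpa only [map_smul, smul_eq_mul, mul_assoc] using (rapidDecay_psiDO ρ u).hasSum.mapL φ

theorem exists_summable_bound_symbolCoeff_mul (ρ : SymbolSpace θ m) (u : SmoothTorus θ)
    (φ : Dual θ) :
    ∃ A : (Fin n → ℤ) × (Fin n → ℤ) → ℝ,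
      (∀ p ξ, ‖symbolCoeff ρ p.1 ξ *
        (fourierCoeff θ p.2 u * cocycle θ p.1 p.2 * φ (monomial θ (p.1 + p.2)))‖ ≤
          A p * (1 + ‖ξ‖) ^ ⌈|m|⌉₊) ∧
      Summable fun p => A p * (1 + ‖latticeVec p.2‖) ^ ⌈|m|⌉₊ := by
  obtain ⟨C, N, -, hC⟩ := exists_norm_dual_monomial_le φ
  let R : (Fin n → ℤ) → ℝ := fun l =>
    symbolBound (N + (n + 1)) ρ * (weight l ^ (N + (n + 1)))⁻¹
  have hR (l : Fin n → ℤ) : 0 ≤ R l :=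
    mul_nonneg (symbolBound_nonneg _ ρ) (inv_nonneg.2 (pow_nonneg (weight_pos l).le _))
  refine ⟨fun p => R p.1 * (C * (weight (p.1 + p.2) ^ N * ‖fourierCoeff θ p.2 u‖)),
    fun p ξ => ?_, ?_⟩
  · have hfactor : ‖fourierCoeff θ p.2 u * cocycle θ p.1 p.2 * φ (monomial θ (p.1 + p.2))‖ ≤
        C * (weight (p.1 + p.2) ^ N * ‖fourierCoeff θ p.2 u‖) := by
      rw [norm_mul, norm_mul, norm_cocycle, mul_one, ← mul_assoc, mul_comm]
      exact mul_le_mul_of_nonneg_right (hC _) (norm_nonneg _)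
    rw [norm_mul, mul_right_comm (R p.1)]
    exact mul_le_mul (norm_symbolCoeff_le _ ρ p.1 ξ) hfactor (norm_nonneg _)
      (mul_nonneg (hR p.1) (by positivity))
  · refine ((summable_weight_add_pow_mul_norm_fourierCoeff u ⌈|m|⌉₊ N).mul_left
      (symbolBound (N + (n + 1)) ρ * C)).congr fun p => ?_
    simp only [R, weight]
    ring

theorem hasOscIntegral_sum (ρ : SymbolSpace θ m) (u : SmoothTorus θ) :
    HasOscIntegral (amplitude (SymbolSpace.toFun ρ) u) ((rapidDecay_psiDO ρ u).sum θ) := by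
  intro φ χ hχ hsupp hχ0
  obtain ⟨A, hgrowth, hA⟩ := exists_summable_bound_symbolCoeff_mul ρ u φ
  have hlimit := tendsto_regularizedOscIntegral_tsum_modulated hχ hsupp hχ0
    (x := fun p : (Fin n → ℤ) × (Fin n → ℤ) => latticeVec p.2) (g := fun p ξ =>
      symbolCoeff ρ p.1 ξ *
        (fourierCoeff θ p.2 u * cocycle θ p.1 p.2 * φ (monomial θ (p.1 + p.2))))
    (fun p => (continuous_symbolCoeff ρ p.1).mul_const _) hgrowth hA
  simp only [(hasSum_dual_sum_psiDO ρ u φ).tsum_eq, (hasSum_dual_amplitude ρ u φ _ _).tsum_eq]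
    at hlimit
  unfold regularizedOscIntegral at hlimit
  simpa only [finrank_euclideanSpace_fin] using hlimit

theorem hasOscIntegral_psiDO (ρ : SymbolSpace θ m) (u : SmoothTorus θ) :
    HasOscIntegral (amplitude (SymbolSpace.toFun ρ) u) (psiDO (SymbolSpace.toFun ρ) u) := by
  have hexists : ∃ b, HasOscIntegral (amplitude (SymbolSpace.toFun ρ) u) b :=
    ⟨_, hasOscIntegral_sum ρ u⟩
  rw [psiDO, oscIntegral, dif_pos hexists]
  exact hexists.choose_spec

theorem HasOscIntegral.unique {a : Eucl n → Eucl n → SmoothTorus θ} {b c : SmoothTorus θ}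
    (hb : HasOscIntegral a b) (hc : HasOscIntegral a c) : b = c := by
  let bump : ContDiffBump (0 : Eucl n × Eucl n) := ⟨1, 2, one_pos, one_lt_two⟩
  let χ : Eucl n × Eucl n → ℂ := fun p => (bump p : ℂ)
  have hχ : ContDiff ℝ ∞ χ := Complex.ofRealCLM.contDiff.comp bump.contDiff
  have hsupp : HasCompactSupport χ :=
    bump.hasCompactSupport.comp_left (g := fun x : ℝ => (x : ℂ)) Complex.ofReal_zero
  have hχ0 : χ 0 = 1 := congrArg ((↑) : ℝ → ℂ)
    (bump.one_of_mem_closedBall (Metric.mem_closedBall_self zero_le_one))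
  exact ext_fourierCoeff fun k =>
    tendsto_nhds_unique (hb _ χ hχ hsupp hχ0) (hc _ χ hχ hsupp hχ0)

theorem psiDO_eq_sum (ρ : SymbolSpace θ m) (u : SmoothTorus θ) :
    psiDO (SymbolSpace.toFun ρ) u = (rapidDecay_psiDO ρ u).sum θ :=
  (hasOscIntegral_psiDO ρ u).unique (hasOscIntegral_sum ρ u)

theorem hasSum_fourierCoeff_psiDO (ρ : SymbolSpace θ m) (u : SmoothTorus θ) (j : Fin n → ℤ) :
    HasSum (fun l => cocycle θ l (j - l) * symbolCoeff ρ l (latticeVec (j - l)) *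
      fourierCoeff θ (j - l) u) (fourierCoeff θ j (psiDO (SymbolSpace.toFun ρ) u)) := by
  have hsum := (rapidDecay_psiDO ρ u).hasSum_fourierCoeff (θ := θ) j
  have hinj : Function.Injective fun l : Fin n → ℤ => (l, j - l) :=
    fun l l' h => (Prod.ext_iff.1 h).1
  rw [← psiDO_eq_sum, ← hinj.hasSum_iff] at hsum
  · convert! hsum using 1
    ext1 l
    simp [mul_comm, mul_left_comm]
  · rintro ⟨l, k⟩ hlk
    rw [if_neg, mul_zero]
    rintro rfl
    exact hlk ⟨l, by simp⟩

end Quantization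

/-! ### Operators on `ℓ^p` spaces -/

section LpOperators

variable {I J 𝕜 : Type*} {p : ℝ≥0∞}

theorem memℓp_comp_injective {E : J → Type*} [∀ j, NormedAddCommGroup (E j)] {f : ∀ j, E j}
    (hf : Memℓp f p) {σ : I → J} (hσ : σ.Injective) : Memℓp (fun i => f (σ i)) p := by
  rcases p.trichotomy with rfl | rfl | hp
  · exact memℓp_zero (hf.finite_dsupport.preimage hσ.injOn)
  · exact memℓp_infty (hf.bddAbove.mono (Set.range_comp_subset_range σ fun j => ‖f j‖))
  · exact memℓp_gen ((hf.summable hp).comp_injective hσ)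

theorem norm_lp_comp_injective_le [Fact (1 ≤ p)] {E : J → Type*} [∀ j, NormedAddCommGroup (E j)]
    (f : lp E p) {σ : I → J} (hσ : σ.Injective) :
    ‖(⟨fun i => f (σ i), memℓp_comp_injective (lp.memℓp f) hσ⟩ : lp (fun i => E (σ i)) p)‖ ≤
      ‖f‖ := by
  rcases p.dichotomy with rfl | hp
  · exact lp.norm_le_of_forall_le (norm_nonneg f) fun i =>
      lp.norm_apply_le_norm ENNReal.top_ne_zero f (σ i)
  · have hp0 := one_pos.trans_le hp
    refine lp.norm_le_of_forall_sum_le hp0 (norm_nonneg f) fun s => ?_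
    simpa only [Finset.sum_map, Function.Embedding.coeFn_mk] using
      lp.sum_rpow_le_norm_rpow hp0 f (s.map ⟨σ, hσ⟩)

variable [NontriviallyNormedField 𝕜]

variable (𝕜 p) in
/-- The pullback of sequences `(x_j) ↦ (x_{σ(i)})` along an injective map `σ`; the translations of
`ℓ²(ℤⁿ)` are an instance. -/
def lpComp [Fact (1 ≤ p)] (E : J → Type*) [∀ j, NormedAddCommGroup (E j)]
    [∀ j, NormedSpace 𝕜 (E j)] {σ : I → J} (hσ : σ.Injective) :
    lp E p →L[𝕜] lp (fun i => E (σ i)) p :=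
  LinearMap.mkContinuous
    { toFun := fun f => ⟨fun i => f (σ i), memℓp_comp_injective (lp.memℓp f) hσ⟩
      map_add' := fun _ _ => rfl
      map_smul' := fun _ _ => rfl } 1
    fun f => (norm_lp_comp_injective_le f hσ).trans_eq (one_mul _).symm

theorem norm_lpComp_le [Fact (1 ≤ p)] (E : J → Type*) [∀ j, NormedAddCommGroup (E j)]
    [∀ j, NormedSpace 𝕜 (E j)] {σ : I → J} (hσ : σ.Injective) : ‖lpComp 𝕜 p E hσ‖ ≤ 1 :=
  LinearMap.mkContinuous_norm_le _ zero_le_one _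

variable [Fact (1 ≤ p)] {E F : I → Type*} [∀ i, NormedAddCommGroup (E i)]
  [∀ i, NormedSpace 𝕜 (E i)] [∀ i, NormedAddCommGroup (F i)] [∀ i, NormedSpace 𝕜 (F i)]
  {T : ∀ i, E i →L[𝕜] F i}

open Classical in
variable (p T) in
/-- The truncation to a finite set of indices of the diagonal operator `lp.mapCLM p T`. -/
def lpTruncation (s : Finset I) : lp E p →L[𝕜] lp F p :=
  ∑ i ∈ s, (lp.singleContinuousLinearMap 𝕜 F p i).comp ((T i).comp (lp.evalCLM 𝕜 E p i))

open Classical in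
theorem lpTruncation_apply (s : Finset I) (x : lp E p) (i : I) :
    lpTruncation p T s x i = if i ∈ s then T i (x i) else 0 := by
  have hsum : lpTruncation p T s x = ∑ j ∈ s, lp.single p j (T j (x j)) := by
    simp only [lpTruncation, sum_apply]
    rfl
  rw [hsum, lp.coeFn_sum, Finset.sum_apply]
  simp only [lp.coeFn_single, Finset.sum_pi_single]

theorem isCompactOperator_lpTruncation (hT : ∀ i, IsCompactOperator (T i)) (s : Finset I) :
    IsCompactOperator (lpTruncation p T s) := by
  classical
  change lpTruncation p T s ∈ compactOperator (RingHom.id 𝕜) (lp E p) (lp F p)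
  exact Submodule.sum_mem _ fun i _ => ((hT i).comp_clm (lp.evalCLM 𝕜 E p i)).clm_comp
    (lp.singleContinuousLinearMap 𝕜 F p i)

theorem norm_mapCLM_sub_lpTruncation_le {K : ℝ} (hK : 0 ≤ K) (hTK : ∀ i, ‖T i‖ ≤ K) {ε : ℝ}
    (hε : 0 ≤ ε) {s : Finset I} (hs : ∀ i ∉ s, ‖T i‖ ≤ ε) :
    ‖lp.mapCLM p T hK hTK - lpTruncation p T s‖ ≤ ε := by
  classical
  have htail : ∀ i, ‖if i ∈ s then 0 else T i‖ ≤ ε := fun i => by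
    split_ifs with hi
    · rwa [norm_zero]
    · exact hs i hi
  convert! lp.norm_mapCLM_le p (fun i => if i ∈ s then 0 else T i) hε htail using 2
  ext x i
  change T i (x i) - lpTruncation p T s x i = (if i ∈ s then 0 else T i) (x i)
  rw [lpTruncation_apply]
  split_ifs
  · exact sub_self _
  · exact sub_zero _

theorem isCompactOperator_mapCLM [∀ i, CompleteSpace (F i)] {K : ℝ} (hK : 0 ≤ K)
    (hTK : ∀ i, ‖T i‖ ≤ K) (hT : ∀ i, IsCompactOperator (T i))
    (hlim : Tendsto (fun i => ‖T i‖) cofinite (𝓝 0)) :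
    IsCompactOperator (lp.mapCLM p T hK hTK) := by
  classical
  suffices hconv : Tendsto (lpTruncation p T) atTop (𝓝 (lp.mapCLM p T hK hTK)) from
    isCompactOperator_of_tendsto hconv (Eventually.of_forall (isCompactOperator_lpTruncation hT))
  rw [Metric.tendsto_atTop]
  intro ε hε
  have hfin : {i | ¬‖T i‖ < ε / 2}.Finite :=
    eventually_cofinite.1 (hlim.eventually (gt_mem_nhds (half_pos hε)))
  refine ⟨hfin.toFinset, fun s hs => ?_⟩
  have hbound : ‖lp.mapCLM p T hK hTK - lpTruncation p T s‖ ≤ ε / 2 :=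
    norm_mapCLM_sub_lpTruncation_le hK hTK (half_pos hε).le fun i hi => by
      by_contra hlarge
      exact hi (hs (hfin.mem_toFinset.2 fun hsmall => hlarge hsmall.le))
  rw [dist_comm, dist_eq_norm]
  exact hbound.trans_lt (half_lt_self hε)

end LpOperators

/-! ### The weights `(1 + |k|²)^{s/2}` -/

section Bracket

theorem bracket_eq_rpow (s : ℝ) (k : Fin n → ℤ) :
    bracket s k = (1 + ‖latticeVec k‖ ^ 2) ^ (s / 2) := by
  rw [EuclideanSpace.real_norm_sq_eq]
  rfl

theorem bracket_pos (s : ℝ) (k : Fin n → ℤ) : 0 < bracket s k := by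
  rw [bracket_eq_rpow]
  positivity

theorem bracket_ne_zero (s : ℝ) (k : Fin n → ℤ) : (bracket s k : ℂ) ≠ 0 := by
  exact_mod_cast (bracket_pos s k).ne'

theorem norm_bracket (s : ℝ) (k : Fin n → ℤ) : ‖(bracket s k : ℂ)‖ = bracket s k := by
  rw [Complex.norm_real, Real.norm_of_nonneg (bracket_pos s k).le]

theorem bracket_add (s t : ℝ) (k : Fin n → ℤ) :
    bracket (s + t) k = bracket s k * bracket t k := by
  rw [bracket_eq_rpow, bracket_eq_rpow, bracket_eq_rpow, add_div, Real.rpow_add (by positivity)]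

theorem bracket_zero (k : Fin n → ℤ) : bracket 0 k = 1 := by
  rw [bracket_eq_rpow, zero_div, Real.rpow_zero]

theorem bracket_neg (s : ℝ) (k : Fin n → ℤ) : bracket (-s) k = (bracket s k)⁻¹ := by
  rw [bracket_eq_rpow, bracket_eq_rpow, neg_div, Real.rpow_neg (by positivity)]

theorem bracket_le_one {s : ℝ} (hs : s ≤ 0) (k : Fin n → ℤ) : bracket s k ≤ 1 := by
  rw [bracket_eq_rpow]
  exact Real.rpow_le_one_of_one_le_of_nonpos (le_add_of_nonneg_right (by positivity))
    (by linarith)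

theorem half_abs_le_ceil (s : ℝ) : |s| / 2 ≤ (⌈|s|⌉₊ : ℝ) :=
  (half_le_self (abs_nonneg s)).trans (Nat.le_ceil _)

theorem bracket_le_weight_pow (s : ℝ) (k : Fin n → ℤ) :
    bracket s k ≤ weight k ^ (2 * ⌈|s|⌉₊) := by
  have hsq : 1 + ‖latticeVec k‖ ^ 2 ≤ weight k ^ 2 := by
    rw [weight]
    nlinarith [norm_nonneg (latticeVec k)]
  have hexp : s / 2 ≤ (⌈|s|⌉₊ : ℝ) := by linarith [half_abs_le_ceil s, le_abs_self s]
  rw [bracket_eq_rpow, pow_mul, ← Real.rpow_natCast _ ⌈|s|⌉₊]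
  exact (Real.rpow_le_rpow_of_exponent_le (le_add_of_nonneg_right (sq_nonneg _)) hexp).trans
    (Real.rpow_le_rpow (by positivity) hsq (by positivity))

theorem rpow_mul_rpow_neg_le {x y c : ℝ} (hx : 0 < x) (hy : 0 < y) (hxy : x ≤ c * y)
    (hyx : y ≤ c * x) (e : ℝ) : x ^ e * y ^ (-e) ≤ c ^ |e| := by
  wlog he : 0 ≤ e generalizing x y e
  · have hswap := this hy hx hyx hxy (-e) (by linarith)
    rwa [neg_neg, abs_neg, mul_comm] at hswap
  rw [Real.rpow_neg hy.le, ← div_eq_mul_inv, ← Real.div_rpow hx.le hy.le, abs_of_nonneg he]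
  exact Real.rpow_le_rpow (div_pos hx hy).le ((div_le_iff₀ hy).2 hxy) he

theorem one_add_norm_add_sq_le {E : Type*} [SeminormedAddCommGroup E] (x y : E) :
    1 + ‖x + y‖ ^ 2 ≤ 2 * (1 + ‖x‖) ^ 2 * (1 + ‖y‖ ^ 2) := by
  have hsq : ‖x + y‖ ^ 2 ≤ (‖x‖ + ‖y‖) ^ 2 := pow_le_pow_left₀ (norm_nonneg _) (norm_add_le x y) 2
  nlinarith [sq_nonneg (‖x‖ - ‖y‖), norm_nonneg x, mul_nonneg (norm_nonneg x) (sq_nonneg ‖y‖),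
    mul_nonneg (sq_nonneg ‖x‖) (sq_nonneg ‖y‖)]

/-- Peetre's inequality. -/
theorem bracket_mul_bracket_neg_sub_le (s : ℝ) (l j : Fin n → ℤ) :
    bracket s j * bracket (-s) (j - l) ≤ 2 ^ ⌈|s|⌉₊ * weight l ^ (2 * ⌈|s|⌉₊) := by
  have hj : 1 + ‖latticeVec j‖ ^ 2 ≤ 2 * weight l ^ 2 * (1 + ‖latticeVec (j - l)‖ ^ 2) := by
    have := one_add_norm_add_sq_le (latticeVec l) (latticeVec (j - l))
    rwa [← latticeVec_add, add_sub_cancel] at this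
  have hjl : 1 + ‖latticeVec (j - l)‖ ^ 2 ≤ 2 * weight l ^ 2 * (1 + ‖latticeVec j‖ ^ 2) := by
    have := one_add_norm_add_sq_le (latticeVec (-l)) (latticeVec j)
    rwa [← latticeVec_add, neg_add_eq_sub, latticeVec_neg, norm_neg] at this
  have hbase : 1 ≤ 2 * weight l ^ 2 := by nlinarith [one_le_weight l]
  have hexp : |s / 2| ≤ (⌈|s|⌉₊ : ℝ) := by
    rw [abs_div, abs_two]
    exact half_abs_le_ceil s
  calc bracket s j * bracket (-s) (j - l)
      ≤ (2 * weight l ^ 2) ^ |s / 2| := by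
        rw [bracket_eq_rpow, bracket_eq_rpow, neg_div]
        exact rpow_mul_rpow_neg_le (by positivity) (by positivity) hj hjl _
    _ ≤ (2 * weight l ^ 2) ^ (⌈|s|⌉₊ : ℝ) := Real.rpow_le_rpow_of_exponent_le hbase hexp
    _ = 2 ^ ⌈|s|⌉₊ * weight l ^ (2 * ⌈|s|⌉₊) := by rw [Real.rpow_natCast, mul_pow, ← pow_mul]

theorem bracket_neg_mul_rpow_le (m : ℝ) (k : Fin n → ℤ) :
    bracket (-m) k * (1 + ‖latticeVec k‖) ^ m ≤ 2 ^ |m / 2| := by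
  have hle : (1 + ‖latticeVec k‖) ^ 2 ≤ 2 * (1 + ‖latticeVec k‖ ^ 2) := by
    nlinarith [sq_nonneg (1 - ‖latticeVec k‖)]
  have hge : 1 + ‖latticeVec k‖ ^ 2 ≤ 2 * (1 + ‖latticeVec k‖) ^ 2 := by
    nlinarith [norm_nonneg (latticeVec k)]
  have hrpow : (1 + ‖latticeVec k‖) ^ m = ((1 + ‖latticeVec k‖) ^ 2) ^ (m / 2) := by
    rw [← Real.rpow_natCast, ← Real.rpow_mul (by positivity)]
    congr 1
    push_cast
    ring
  rw [bracket_eq_rpow, mul_comm, neg_div, hrpow]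
  exact rpow_mul_rpow_neg_le (by positivity) (by positivity) hle hge _

theorem tendsto_norm_latticeVec_cofinite :
    Tendsto (fun k : Fin n → ℤ => ‖latticeVec k‖) cofinite atTop := by
  have hnorm : Tendsto (fun k : Fin n → ℤ => ‖k‖) cofinite atTop := by
    rw [← Filter.cocompact_eq_cofinite]
    exact tendsto_norm_cocompact_atTop
  refine tendsto_atTop_mono (fun k => ?_) hnorm
  refine (pi_norm_le_iff_of_nonneg (norm_nonneg _)).2 fun j => ?_
  exact PiLp.norm_apply_le (latticeVec k) j

theorem tendsto_bracket_cofinite {m : ℝ} (hm : m < 0) :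
    Tendsto (bracket m : (Fin n → ℤ) → ℝ) cofinite (𝓝 0) := by
  have hsq : Tendsto (fun k : Fin n → ℤ => 1 + ‖latticeVec k‖ ^ 2) cofinite atTop :=
    tendsto_atTop_add_const_left _ 1
      ((tendsto_pow_atTop two_ne_zero).comp tendsto_norm_latticeVec_cofinite)
  have hrpow := (tendsto_rpow_neg_atTop (y := -(m / 2)) (by linarith)).comp hsq
  rw [neg_neg] at hrpow
  exact hrpow.congr fun k => (bracket_eq_rpow m k).symm

end Bracket

/-! ### The operators `Λ^s P_ρ Λ^{-s-m}` on `ℓ²(ℤⁿ)` -/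

section Matrix

variable {θ : Matrix (Fin n) (Fin n) ℝ} {m : ℝ}

/-- The Hilbert space `ℓ²(ℤⁿ)`, in which the sequences of Fourier coefficients live. -/
abbrev SeqL2 (n : ℕ) : Type := lp (fun _ : Fin n → ℤ => ℂ) 2

/-- The matrix entry of `Λ^s P_ρ Λ^{-s-m}` in row `j` and column `j - l`, so that `l` numbers the
diagonals. -/
def diagEntry (s : ℝ) (ρ : SymbolSpace θ m) (l j : Fin n → ℤ) : ℂ :=
  bracket s j * bracket (-(s + m)) (j - l) *
    (cocycle θ l (j - l) * symbolCoeff ρ l (latticeVec (j - l)))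

/-- The constant in the decay estimate for `diagEntry`: the first factor comes from Peetre's
inequality, the second from the comparison of `(1 + |k|²)^{m/2}` with `(1 + |k|)^m`. -/
def diagConst (s m : ℝ) : ℝ := 2 ^ ⌈|s|⌉₊ * 2 ^ |m / 2|

theorem diagConst_nonneg (s m : ℝ) : 0 ≤ diagConst s m := by
  unfold diagConst
  positivity

theorem norm_diagEntry (s : ℝ) (ρ : SymbolSpace θ m) (l j : Fin n → ℤ) :
    ‖diagEntry s ρ l j‖ = bracket s j * bracket (-s) (j - l) *
      (bracket (-m) (j - l) * ‖symbolCoeff ρ l (latticeVec (j - l))‖) := by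
  rw [diagEntry, norm_mul, norm_mul, norm_mul, norm_cocycle, norm_bracket, norm_bracket, one_mul,
    neg_add, bracket_add, ← mul_assoc, mul_assoc]

theorem weight_pow_mul_norm_diagEntry_le (s : ℝ) (N : ℕ) (ρ : SymbolSpace θ m)
    (l j : Fin n → ℤ) :
    weight l ^ N * ‖diagEntry s ρ l j‖ ≤ diagConst s m * symbolBound (2 * ⌈|s|⌉₊ + N) ρ := by
  set M := ⌈|s|⌉₊
  set k := j - l
  set c := ‖symbolCoeff ρ l (latticeVec k)‖
  have hm := (bracket_pos (-m) k).le
  have hl := (weight_pos l).le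
  have hρ := symbolBound_nonneg (2 * M + N) ρ
  calc weight l ^ N * ‖diagEntry s ρ l j‖
      = bracket s j * bracket (-s) k * (weight l ^ N * (bracket (-m) k * c)) := by
        rw [norm_diagEntry, mul_left_comm]
    _ ≤ 2 ^ M * weight l ^ (2 * M) * (weight l ^ N * (bracket (-m) k * c)) :=
        mul_le_mul_of_nonneg_right (bracket_mul_bracket_neg_sub_le s l j) (by positivity)
    _ = 2 ^ M * (bracket (-m) k * (weight l ^ (2 * M + N) * c)) := by ring
    _ ≤ 2 ^ M * (bracket (-m) k * (symbolBound (2 * M + N) ρ * (1 + ‖latticeVec k‖) ^ m)) := by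
        gcongr 2 ^ M * (bracket (-m) k * ?_)
        exact weight_pow_mul_norm_symbolCoeff_le _ ρ l _
    _ = 2 ^ M * (bracket (-m) k * (1 + ‖latticeVec k‖) ^ m) * symbolBound (2 * M + N) ρ := by ring
    _ ≤ 2 ^ M * 2 ^ |m / 2| * symbolBound (2 * M + N) ρ := by
        gcongr
        exact bracket_neg_mul_rpow_le m k

/-- The bound for the norm of the `l`-th diagonal of `Λ^s P_ρ Λ^{-s-m}`; it is summable in `l`. -/
def diagBound (s : ℝ) (ρ : SymbolSpace θ m) (l : Fin n → ℤ) : ℝ :=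
  diagConst s m * symbolBound (2 * ⌈|s|⌉₊ + (n + 1)) ρ * (weight l ^ (n + 1))⁻¹

theorem diagBound_nonneg (s : ℝ) (ρ : SymbolSpace θ m) (l : Fin n → ℤ) : 0 ≤ diagBound s ρ l :=
  mul_nonneg (mul_nonneg (diagConst_nonneg s m) (symbolBound_nonneg _ ρ))
    (inv_nonneg.2 (pow_nonneg (weight_pos l).le _))

theorem norm_diagEntry_le (s : ℝ) (ρ : SymbolSpace θ m) (l j : Fin n → ℤ) :
    ‖diagEntry s ρ l j‖ ≤ diagBound s ρ l := by
  rw [diagBound, ← div_eq_mul_inv, le_div_iff₀' (pow_pos (weight_pos l) _)]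
  exact weight_pow_mul_norm_diagEntry_le s (n + 1) ρ l j

theorem norm_diagEntry_smul_id_le (s : ℝ) (ρ : SymbolSpace θ m) (l j : Fin n → ℤ) :
    ‖diagEntry s ρ l j • ContinuousLinearMap.id ℂ ℂ‖ ≤ diagBound s ρ l := by
  rw [norm_smul, ContinuousLinearMap.norm_id, mul_one]
  exact norm_diagEntry_le s ρ l j

/-- The `l`-th diagonal of `Λ^s P_ρ Λ^{-s-m}`: the translation by `l` followed by the
multiplication by `diagEntry s ρ l`. -/
def diagOp (s : ℝ) (ρ : SymbolSpace θ m) (l : Fin n → ℤ) : SeqL2 n →L[ℂ] SeqL2 n :=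
  (lp.mapCLM 2 (fun j => diagEntry s ρ l j • ContinuousLinearMap.id ℂ ℂ) (diagBound_nonneg s ρ l)
    (norm_diagEntry_smul_id_le s ρ l)).comp
      (lpComp ℂ 2 (fun _ => ℂ) (sub_left_injective (b := l)))

theorem diagOp_apply (s : ℝ) (ρ : SymbolSpace θ m) (l : Fin n → ℤ) (x : SeqL2 n)
    (j : Fin n → ℤ) : diagOp s ρ l x j = diagEntry s ρ l j * x (j - l) := rfl

theorem norm_diagOp_le (s : ℝ) (ρ : SymbolSpace θ m) (l : Fin n → ℤ) :
    ‖diagOp s ρ l‖ ≤ diagBound s ρ l := by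
  refine (ContinuousLinearMap.opNorm_comp_le _ _).trans ?_
  exact (mul_le_of_le_one_right (norm_nonneg _) (norm_lpComp_le _ _)).trans
    (lp.norm_mapCLM_le _ _ _ _)

theorem summable_diagBound (s : ℝ) (ρ : SymbolSpace θ m) : Summable (diagBound s ρ) :=
  (summable_weight n).mul_left _

theorem summable_diagOp (s : ℝ) (ρ : SymbolSpace θ m) : Summable (diagOp s ρ) :=
  Summable.of_norm_bounded (summable_diagBound s ρ) (norm_diagOp_le s ρ)

theorem symbolCoeff_add (ρ σ : SymbolSpace θ m) (l : Fin n → ℤ) (ξ : Eucl n) :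
    symbolCoeff (ρ + σ) l ξ = symbolCoeff ρ l ξ + symbolCoeff σ l ξ := by
  rw [symbolCoeff, map_add, Pi.add_apply, map_add]
  rfl

theorem symbolCoeff_smul (c : ℂ) (ρ : SymbolSpace θ m) (l : Fin n → ℤ) (ξ : Eucl n) :
    symbolCoeff (c • ρ) l ξ = c * symbolCoeff ρ l ξ := by
  rw [symbolCoeff, map_smul, Pi.smul_apply, map_smul]
  rfl

theorem diagOp_add (s : ℝ) (ρ σ : SymbolSpace θ m) (l : Fin n → ℤ) :
    diagOp s (ρ + σ) l = diagOp s ρ l + diagOp s σ l := by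
  ext x j
  change diagOp s (ρ + σ) l x j = diagOp s ρ l x j + diagOp s σ l x j
  simp only [diagOp_apply, diagEntry, symbolCoeff_add]
  ring

theorem diagOp_smul (s : ℝ) (c : ℂ) (ρ : SymbolSpace θ m) (l : Fin n → ℤ) :
    diagOp s (c • ρ) l = c • diagOp s ρ l := by
  ext x j
  change diagOp s (c • ρ) l x j = c * diagOp s ρ l x j
  simp only [diagOp_apply, diagEntry, symbolCoeff_smul]
  ring

/-- The operator `Λ^s P_ρ Λ^{-s-m}` on `ℓ²(ℤⁿ)`, as the norm convergent sum of its diagonals. -/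
def matrixOp (s : ℝ) : SymbolSpace θ m →ₗ[ℂ] SeqL2 n →L[ℂ] SeqL2 n where
  toFun ρ := ∑' l, diagOp s ρ l
  map_add' ρ σ := by
    rw [← (summable_diagOp s ρ).tsum_add (summable_diagOp s σ)]
    exact tsum_congr (diagOp_add s ρ σ)
  map_smul' c ρ := by
    rw [RingHom.id_apply, ← (summable_diagOp s ρ).tsum_const_smul]
    exact tsum_congr (diagOp_smul s c ρ)

theorem hasSum_matrixOp_apply (s : ℝ) (ρ : SymbolSpace θ m) (x : SeqL2 n) (j : Fin n → ℤ) :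
    HasSum (fun l => diagEntry s ρ l j * x (j - l)) (matrixOp s ρ x j) :=
  ((summable_diagOp s ρ).hasSum.mapL (ContinuousLinearMap.apply ℂ (SeqL2 n) x)).mapL
    (lp.evalCLM ℂ (fun _ => ℂ) 2 j)

theorem norm_matrixOp_le (s : ℝ) (ρ : SymbolSpace θ m) :
    ‖matrixOp s ρ‖ ≤ diagConst s m * symbolBound (2 * ⌈|s|⌉₊ + (n + 1)) ρ *
      ∑' l : Fin n → ℤ, (weight l ^ (n + 1))⁻¹ := by
  rw [← tsum_mul_left]
  exact tsum_of_norm_bounded (summable_diagBound s ρ).hasSum (norm_diagOp_le s ρ)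

end Matrix

/-! ### Sobolev spaces -/

section FourierIsometries

variable {θ : Matrix (Fin n) (Fin n) ℝ}

open SmoothTorus

theorem orthonormal_monomial : Orthonormal ℂ (HTheta.monomial θ) := by
  rw [orthonormal_iff_ite]
  intro k l
  rw [HTheta.monomial, HTheta.monomial, UniformSpace.Completion.inner_coe, PolyTorus.inner_def]
  change tau ((Upow θ l : Op n) * star (Upow θ k : Op n)) = _
  rw [tau_Upow_mul_star]
  simp only [eq_comm]

theorem orthogonal_span_monomial :
    (Submodule.span ℂ (Set.range (HTheta.monomial θ)))ᗮ = ⊥ := by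
  refine (Submodule.eq_bot_iff _).2 fun h hh => HTheta.ext_coeff fun k => ?_
  rw [inner_zero_right]
  exact Submodule.inner_right_of_mem_orthogonal (Submodule.subset_span (Set.mem_range_self k)) hh

variable (θ) in
/-- The Hilbert basis `(U^k)` of `ℋ_θ`. -/
def monomialBasis : HilbertBasis (Fin n → ℤ) ℂ (HTheta θ) :=
  .mkOfOrthogonalEqBot orthonormal_monomial orthogonal_span_monomial

theorem monomialBasis_repr (h : HTheta θ) (k : Fin n → ℤ) :
    (monomialBasis θ).repr h k = ⟪HTheta.monomial θ k, h⟫_ℂ := by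
  rw [HilbertBasis.repr_apply_apply, monomialBasis, HilbertBasis.coe_mkOfOrthogonalEqBot]

theorem continuous_of_norm_map_le {E F 𝓕 : Type*} [AddGroup E] [TopologicalSpace E]
    [IsTopologicalAddGroup E] [SeminormedAddCommGroup F] [FunLike 𝓕 E F]
    [AddMonoidHomClass 𝓕 E F] (f : 𝓕) {q : E → ℝ} (hq : Continuous q) (hq0 : q 0 = 0)
    (hfq : ∀ x, ‖f x‖ ≤ q x) : Continuous f := by
  refine continuous_of_continuousAt_zero f ?_
  rw [ContinuousAt, map_zero]
  exact squeeze_zero_norm hfq (hq0 ▸ hq.tendsto 0)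

theorem continuous_decayBound (N : ℕ) : Continuous (decayBound (θ := θ) N) := by
  have hseminorm := (SmoothTorus.withSeminorms θ).continuous_seminorm
  exact continuous_const.mul ((hseminorm 0).add (continuous_finsetSum _ fun j _ => hseminorm _))

theorem decayBound_zero (N : ℕ) : decayBound N (0 : SmoothTorus θ) = 0 := by
  simp [decayBound]

section PolynomialGrowth

variable {e : (Fin n → ℤ) → ℂ} {C : ℝ} {N : ℕ}

theorem norm_fourierCoeff_mul_le (he : ∀ k, ‖e k‖ ≤ C * weight k ^ N) (v : SmoothTorus θ)
    (k : Fin n → ℤ) :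
    ‖fourierCoeff θ k v * e k‖ ≤ C * (decayBound (N + (n + 1)) v * (weight k ^ (n + 1))⁻¹) := by
  have hw := weight_pos k
  have hC : 0 ≤ C := nonneg_of_mul_nonneg_left ((norm_nonneg _).trans (he k)) (by positivity)
  rw [← mul_assoc, ← div_eq_mul_inv, le_div_iff₀ (by positivity)]
  calc ‖fourierCoeff θ k v * e k‖ * weight k ^ (n + 1)
      ≤ ‖fourierCoeff θ k v‖ * (C * weight k ^ N) * weight k ^ (n + 1) := by
        rw [norm_mul]
        gcongr
        exact he k
    _ = C * (weight k ^ (N + (n + 1)) * ‖fourierCoeff θ k v‖) := by ring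
    _ ≤ C * decayBound (N + (n + 1)) v := by
        gcongr
        exact weight_pow_mul_norm_fourierCoeff_le _ k v

theorem summable_fourierCoeff_mul (he : ∀ k, ‖e k‖ ≤ C * weight k ^ N) (v : SmoothTorus θ) :
    Summable fun k => fourierCoeff θ k v * e k :=
  Summable.of_norm_bounded (((summable_weight n).mul_left _).mul_left _)
    (norm_fourierCoeff_mul_le he v)

variable (θ) in
/-- The linear functional on `𝒜_θ` that takes prescribed values of polynomial growth at the `U^k`;
it shows that every sequence of polynomial growth is the Fourier series of an element of `𝒜_θ'`. -/
def linearOfGrowth (he : ∀ k, ‖e k‖ ≤ C * weight k ^ N) : SmoothTorus θ →ₗ[ℂ] ℂ where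
  toFun v := ∑' k, fourierCoeff θ k v * e k
  map_add' v w := by
    rw [← (summable_fourierCoeff_mul he v).tsum_add (summable_fourierCoeff_mul he w)]
    exact tsum_congr fun k => by rw [map_add, add_mul]
  map_smul' c v := by
    rw [RingHom.id_apply, ← (summable_fourierCoeff_mul he v).tsum_const_smul]
    exact tsum_congr fun k => by rw [map_smul, smul_mul_assoc]

theorem continuous_linearOfGrowth (he : ∀ k, ‖e k‖ ≤ C * weight k ^ N) :
    Continuous (linearOfGrowth θ he) := by
  refine continuous_of_norm_map_le (linearOfGrowth θ he)
    (q := fun v => C * (decayBound (N + (n + 1)) v * ∑' k : Fin n → ℤ, (weight k ^ (n + 1))⁻¹))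
    (continuous_const.mul ((continuous_decayBound _).mul continuous_const))
    (by simp only [decayBound_zero, zero_mul, mul_zero]) fun v => ?_
  exact tsum_of_norm_bounded (((summable_weight n).hasSum.mul_left _).mul_left C)
    (norm_fourierCoeff_mul_le he v)

theorem linearOfGrowth_monomial (he : ∀ k, ‖e k‖ ≤ C * weight k ^ N) (k : Fin n → ℤ) :
    linearOfGrowth θ he (monomial θ k) = e k := by
  change ∑' l, fourierCoeff θ l (monomial θ k) * e l = e k
  rw [tsum_eq_single k]
  · rw [fourierCoeff_monomial, if_pos rfl, one_mul]
  · intro l hl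
    rw [fourierCoeff_monomial, if_neg hl.symm, zero_mul]

theorem exists_dual_coeff_eq (he : ∀ k, ‖e k‖ ≤ C * weight k ^ N) :
    ∃ φ : Dual θ, ∀ k, φ.coeff k = e k := by
  have hgrowth (k : Fin n → ℤ) : ‖cocycle θ (-k) k * e (-k)‖ ≤ C * weight k ^ N := by
    rw [norm_mul, norm_cocycle, one_mul, ← weight_neg k]
    exact he (-k)
  let φ : Dual θ := ⟨linearOfGrowth θ hgrowth, continuous_linearOfGrowth hgrowth⟩
  refine ⟨φ, fun k => ?_⟩
  have hφ : φ (monomial θ (-k)) = cocycle θ k (-k) * e k := by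
    simpa only [neg_neg] using! linearOfGrowth_monomial hgrowth (-k)
  rw [Dual.coeff, star_monomial, map_smul, hφ, smul_eq_mul,
    inv_mul_cancel_left₀ (cocycle_ne_zero θ _ _)]

end PolynomialGrowth

namespace SobolevSpace

variable {s : ℝ}

theorem inner_Lambda (x : SobolevSpace θ s) (k : Fin n → ℤ) :
    ⟪HTheta.monomial θ k, Lambda θ s x⟫_ℂ = bracket s k * (toDual x).coeff k :=
  (exists_Lambda x).choose_spec k

theorem Lambda_injective : Function.Injective (Lambda θ s) := fun x y hxy =>
  Subtype.val_injective <| Dual.ext_coeff fun k => by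
    refine mul_left_cancel₀ (bracket_ne_zero s k) ?_
    exact (inner_Lambda x k).symm.trans (hxy ▸ inner_Lambda y k)

theorem Lambda_surjective : Function.Surjective (Lambda θ s) := by
  intro h
  have hgrowth (k : Fin n → ℤ) :
      ‖(bracket (-s) k : ℂ) * ⟪HTheta.monomial θ k, h⟫_ℂ‖ ≤
        ‖h‖ * weight k ^ (2 * ⌈|-s|⌉₊) := by
    have hinner : ‖⟪HTheta.monomial θ k, h⟫_ℂ‖ ≤ ‖h‖ := by
      simpa only [orthonormal_monomial.norm_eq_one, one_mul] using
        norm_inner_le_norm (𝕜 := ℂ) (HTheta.monomial θ k) h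
    rw [norm_mul, norm_bracket, mul_comm]
    exact mul_le_mul hinner (bracket_le_weight_pow _ k) (bracket_pos _ k).le (norm_nonneg h)
  obtain ⟨φ, hφ⟩ := exists_dual_coeff_eq (θ := θ) hgrowth
  have hmem (k : Fin n → ℤ) : ⟪HTheta.monomial θ k, h⟫_ℂ = bracket s k * φ.coeff k := by
    rw [hφ, bracket_neg, Complex.ofReal_inv, mul_inv_cancel_left₀ (bracket_ne_zero s k)]
  let x : SobolevSpace θ s := ⟨φ, h, hmem⟩
  exact ⟨x, HTheta.ext_coeff fun k => (inner_Lambda x k).trans (hmem k).symm⟩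

end SobolevSpace

variable (θ) in
/-- The isometry of `ℋ_θ^{(s)}` onto `ℓ²(ℤⁿ)` given by the Fourier coefficients of `Λ^s u`. -/
def sobolevIsometry (s : ℝ) : SobolevSpace θ s ≃ₗᵢ[ℂ] SeqL2 n where
  toLinearEquiv := (LinearEquiv.ofBijective (SobolevSpace.Lambda θ s)
    ⟨SobolevSpace.Lambda_injective, SobolevSpace.Lambda_surjective⟩).trans
      (monomialBasis θ).repr.toLinearEquiv
  norm_map' _ := (monomialBasis θ).repr.norm_map _

theorem sobolevIsometry_apply {s : ℝ} (x : SobolevSpace θ s) (k : Fin n → ℤ) :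
    sobolevIsometry θ s x k = bracket s k * (SobolevSpace.toDual x).coeff k :=
  (monomialBasis_repr _ k).trans (SobolevSpace.inner_Lambda x k)

instance (s : ℝ) : T2Space (SobolevSpace θ s) :=
  .of_injective_continuous (sobolevIsometry θ s).injective (sobolevIsometry θ s).continuous

theorem memℓp_bracket_mul_fourierCoeff (t : ℝ) (u : SmoothTorus θ) :
    Memℓp (fun k => (bracket t k : ℂ) * fourierCoeff θ k u) 2 := by
  refine Memℓp.of_exponent_ge (q := 1) (memℓp_gen ?_) one_le_two
  refine (rapidDecay_fourierCoeff u (2 * ⌈|t|⌉₊)).of_nonneg_of_le (fun k => by positivity)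
    fun k => ?_
  rw [ENNReal.toReal_one, Real.rpow_one, norm_mul, norm_bracket]
  exact mul_le_mul_of_nonneg_right (bracket_le_weight_pow t k) (norm_nonneg _)

/-- The Fourier coefficients of `Λ^t u` for `u ∈ 𝒜_θ`, as an element of `ℓ²(ℤⁿ)`. -/
def smoothSeq (t : ℝ) (u : SmoothTorus θ) : SeqL2 n := ⟨_, memℓp_bracket_mul_fourierCoeff t u⟩

theorem smoothSeq_apply (t : ℝ) (u : SmoothTorus θ) (k : Fin n → ℤ) :
    smoothSeq t u k = bracket t k * fourierCoeff θ k u := rfl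

theorem sobolevIsometry_eq_smoothSeq {t : ℝ} {u : SmoothTorus θ} {x : SobolevSpace θ t} :
    sobolevIsometry θ t x = smoothSeq t u ↔ SobolevSpace.toDual x = SmoothTorus.toDual u := by
  constructor
  · intro hx
    refine Dual.ext_coeff fun k => mul_left_cancel₀ (bracket_ne_zero t k) ?_
    rw [← sobolevIsometry_apply, hx, smoothSeq_apply, coeff_toDual]
  · intro hx
    ext k
    rw [sobolevIsometry_apply, smoothSeq_apply, hx, coeff_toDual]

theorem isImage_iff {h : HTheta θ} {u : SmoothTorus θ} :
    IsImage h u ↔ (monomialBasis θ).repr h = smoothSeq 0 u := by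
  have hcoeff (k : Fin n → ℤ) : smoothSeq 0 u k = (toDual u).coeff k := by
    rw [smoothSeq_apply, bracket_zero, Complex.ofReal_one, one_mul, coeff_toDual]
  simp only [IsImage, lp.ext_iff, funext_iff, monomialBasis_repr, hcoeff]

theorem smoothSeq_monomial [DecidableEq (Fin n → ℤ)] (t : ℝ) (k : Fin n → ℤ) :
    smoothSeq t (monomial θ k) = (bracket t k : ℂ) • (lp.single 2 k (1 : ℂ) : SeqL2 n) := by
  ext l
  rw [smoothSeq_apply, fourierCoeff_monomial, lp.coeFn_smul, Pi.smul_apply, lp.coeFn_single,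
    Pi.single_apply, smul_eq_mul]
  obtain rfl | hlk := eq_or_ne l k
  · rw [if_pos rfl, if_pos rfl]
  · rw [if_neg hlk, if_neg hlk.symm, mul_zero, mul_zero]

variable (θ) in
theorem clm_ext_smoothSeq {E F : Type*} [SeminormedAddCommGroup E] [NormedSpace ℂ E]
    [AddCommGroup F] [Module ℂ F] [TopologicalSpace F] [T2Space F] (t : ℝ) (e : E ≃ₗᵢ[ℂ] SeqL2 n)
    {S T : E →L[ℂ] F}
    (h : ∀ u : SmoothTorus θ, S (e.symm (smoothSeq t u)) = T (e.symm (smoothSeq t u))) :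
    S = T := by
  classical
  let e' : SeqL2 n →L[ℂ] E := e.symm.toContinuousLinearEquiv
  have hcomp : S.comp e' = T.comp e' := by
    refine lp.ext_continuousLinearMap ENNReal.ofNat_ne_top fun k => ?_
    ext
    have hk := h (monomial θ k)
    rw [smoothSeq_monomial, map_smul, map_smul, map_smul] at hk
    exact smul_right_injective F (bracket_ne_zero t k) hk
  ext x
  have hx : S (e.symm (e x)) = T (e.symm (e x)) := DFunLike.congr_fun hcomp (e x)
  rwa [e.symm_apply_apply] at hx

end FourierIsometries

/-! ### Pseudodifferential operators on Sobolev spaces -/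

section Extension

variable {θ : Matrix (Fin n) (Fin n) ℝ} {m : ℝ}

theorem matrixOp_smoothSeq (s : ℝ) (ρ : SymbolSpace θ m) (u : SmoothTorus θ) :
    matrixOp s ρ (smoothSeq (s + m) u) = smoothSeq s (psiDO (SymbolSpace.toFun ρ) u) := by
  ext j
  refine (hasSum_matrixOp_apply s ρ _ j).unique ?_
  rw [smoothSeq_apply]
  convert! (hasSum_fourierCoeff_psiDO ρ u j).mul_left (bracket s j : ℂ) using 1
  ext1 l
  rw [smoothSeq_apply, diagEntry, bracket_neg, Complex.ofReal_inv]
  have := bracket_ne_zero (s + m) (j - l)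
  field_simp

theorem continuous_symbolBound (N : ℕ) : Continuous (symbolBound (θ := θ) (m := m) N) := by
  have hseminorm := (SymbolSpace.withSeminorms θ m).continuous_seminorm
  exact continuous_const.mul ((hseminorm _).add (continuous_finsetSum _ fun j _ => hseminorm _))

theorem symbolBound_zero (N : ℕ) : symbolBound N (0 : SymbolSpace θ m) = 0 := by
  simp [symbolBound]

theorem continuous_matrixOp (s : ℝ) : Continuous (matrixOp (θ := θ) (m := m) s) := by
  have := (SymbolSpace.withSeminorms θ m).topologicalAddGroup
  refine continuous_of_norm_map_le _ ?_ ?_ (norm_matrixOp_le s)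
  · exact (continuous_const.mul (continuous_symbolBound _)).mul continuous_const
  · rw [symbolBound_zero, mul_zero, zero_mul]

/-- The extension of `P_ρ` to Sobolev spaces, as a continuous linear function of the symbol `ρ`. -/
def sobolevOp (s : ℝ) :
    SymbolSpace θ m →L[ℂ] SobolevSpace θ (s + m) →L[ℂ] SobolevSpace θ s :=
  ((sobolevIsometry θ (s + m)).symm.toContinuousLinearEquiv.arrowCongr
    (sobolevIsometry θ s).symm.toContinuousLinearEquiv).toContinuousLinearMap.comp
      ⟨matrixOp s, continuous_matrixOp s⟩

theorem sobolevOp_apply (s : ℝ) (ρ : SymbolSpace θ m) (x : SobolevSpace θ (s + m)) :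
    sobolevOp s ρ x =
      (sobolevIsometry θ s).symm (matrixOp s ρ (sobolevIsometry θ (s + m) x)) := rfl

theorem extendsOnSobolev_iff {s t : ℝ} {ρ : SymbolSpace θ m}
    {T : SobolevSpace θ t →L[ℂ] SobolevSpace θ s} :
    ExtendsOnSobolev ρ T ↔ ∀ u : SmoothTorus θ, T ((sobolevIsometry θ t).symm (smoothSeq t u)) =
      (sobolevIsometry θ s).symm (smoothSeq s (psiDO (SymbolSpace.toFun ρ) u)) := by
  refine forall_congr' fun u => ?_
  simp only [← sobolevIsometry_eq_smoothSeq, ← LinearIsometryEquiv.eq_symm_apply,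
    exists_eq_left]

theorem extendsOnSobolev_sobolevOp (s : ℝ) (ρ : SymbolSpace θ m) :
    ExtendsOnSobolev ρ (sobolevOp s ρ) :=
  extendsOnSobolev_iff.2 fun u => by
    rw [sobolevOp_apply, LinearIsometryEquiv.apply_symm_apply, matrixOp_smoothSeq]

theorem ExtendsOnSobolev.unique {s t : ℝ} {ρ : SymbolSpace θ m}
    {S T : SobolevSpace θ t →L[ℂ] SobolevSpace θ s} (hS : ExtendsOnSobolev ρ S)
    (hT : ExtendsOnSobolev ρ T) : S = T :=
  clm_ext_smoothSeq θ t (sobolevIsometry θ t) fun u =>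
    (extendsOnSobolev_iff.1 hS u).trans (extendsOnSobolev_iff.1 hT u).symm

theorem norm_bracket_smul_id (s : ℝ) (k : Fin n → ℤ) :
    ‖(bracket s k : ℂ) • ContinuousLinearMap.id ℂ ℂ‖ = bracket s k := by
  rw [norm_smul, ContinuousLinearMap.norm_id, mul_one, norm_bracket]

/-- The operator `Λ^m` on `ℓ²(ℤⁿ)` for `m ≤ 0`. -/
def bracketOp (n : ℕ) {m : ℝ} (hm : m ≤ 0) : SeqL2 n →L[ℂ] SeqL2 n :=
  lp.mapCLM 2 (fun k => (bracket m k : ℂ) • ContinuousLinearMap.id ℂ ℂ) zero_le_one fun k =>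
    (norm_bracket_smul_id m k).trans_le (bracket_le_one hm k)

theorem isCompactOperator_bracketOp (hm : m < 0) : IsCompactOperator (bracketOp n hm.le) := by
  refine isCompactOperator_mapCLM _ _ (fun k => ?_) ?_
  · exact isCompactOperator_of_locallyCompactSpace_dom _
  · simpa only [norm_bracket_smul_id] using tendsto_bracket_cofinite hm

theorem bracketOp_smoothSeq (hm : m ≤ 0) (u : SmoothTorus θ) :
    bracketOp n hm (smoothSeq 0 u) = smoothSeq (0 + m) u := by
  ext k
  change (bracket m k : ℂ) * (bracket 0 k * fourierCoeff θ k u) = _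
  rw [smoothSeq_apply, zero_add, bracket_zero, Complex.ofReal_one, one_mul]

/-- The extension of `P_ρ` to `ℋ_θ` for a symbol of order `m ≤ 0`, in the form
`(P_ρ Λ^{-m}) Λ^m`: the second factor is compact if `m < 0`. -/
def hilbertOp (hm : m ≤ 0) (ρ : SymbolSpace θ m) : HTheta θ →L[ℂ] HTheta θ :=
  ((monomialBasis θ).repr.symm.toContinuousLinearEquiv.toContinuousLinearMap.comp
    ((matrixOp 0 ρ).comp (bracketOp n hm))).comp
      (monomialBasis θ).repr.toContinuousLinearEquiv.toContinuousLinearMap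

theorem hilbertOp_apply (hm : m ≤ 0) (ρ : SymbolSpace θ m) (h : HTheta θ) :
    hilbertOp hm ρ h = (monomialBasis θ).repr.symm
      (matrixOp 0 ρ (bracketOp n hm ((monomialBasis θ).repr h))) := rfl

theorem isCompactOperator_hilbertOp (hm : m < 0) (ρ : SymbolSpace θ m) :
    IsCompactOperator (hilbertOp hm.le ρ) :=
  (((isCompactOperator_bracketOp hm).clm_comp (matrixOp 0 ρ)).clm_comp
    (monomialBasis θ).repr.symm.toContinuousLinearEquiv.toContinuousLinearMap).comp_clm
      (monomialBasis θ).repr.toContinuousLinearEquiv.toContinuousLinearMap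

theorem extendsOnHTheta_iff {ρ : SymbolSpace θ m} {T : HTheta θ →L[ℂ] HTheta θ} :
    ExtendsOnHTheta ρ T ↔ ∀ u : SmoothTorus θ, T ((monomialBasis θ).repr.symm (smoothSeq 0 u)) =
      (monomialBasis θ).repr.symm (smoothSeq 0 (psiDO (SymbolSpace.toFun ρ) u)) := by
  refine forall_congr' fun u => ?_
  simp only [isImage_iff, ← LinearIsometryEquiv.eq_symm_apply, exists_eq_left]

theorem extendsOnHTheta_hilbertOp (hm : m ≤ 0) (ρ : SymbolSpace θ m) :
    ExtendsOnHTheta ρ (hilbertOp hm ρ) :=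
  extendsOnHTheta_iff.2 fun u => by
    rw [hilbertOp_apply, LinearIsometryEquiv.apply_symm_apply, bracketOp_smoothSeq,
      matrixOp_smoothSeq]

theorem ExtendsOnHTheta.unique {ρ : SymbolSpace θ m} {S T : HTheta θ →L[ℂ] HTheta θ}
    (hS : ExtendsOnHTheta ρ S) (hT : ExtendsOnHTheta ρ T) : S = T :=
  clm_ext_smoothSeq θ 0 (monomialBasis θ).repr fun u =>
    (extendsOnHTheta_iff.1 hS u).trans (extendsOnHTheta_iff.1 hT u).symm

end Extension

end NCTorus

end

theorem mainTheorem5_general {n : ℕ} (θ : Matrix (Fin n) (Fin n) ℝ) (m : ℝ) :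
    (∀ (ρ : SymbolSpace θ m) (u : SmoothTorus θ),
      HasOscIntegral (amplitude ρ.toFun u) (psiDO ρ.toFun u)) ∧
    (∀ s : ℝ,
      (∀ ρ : SymbolSpace θ m, ∃! T : SobolevSpace θ (s + m) →L[ℂ] SobolevSpace θ s,
        ExtendsOnSobolev ρ T) ∧
      ∃ Φ : SymbolSpace θ m →L[ℂ] (SobolevSpace θ (s + m) →L[ℂ] SobolevSpace θ s),
        ∀ ρ : SymbolSpace θ m, ExtendsOnSobolev ρ (Φ ρ)) ∧
    (m < 0 → ∀ ρ : SymbolSpace θ m,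
      (∃! T : HTheta θ →L[ℂ] HTheta θ, ExtendsOnHTheta ρ T) ∧
      ∀ T : HTheta θ →L[ℂ] HTheta θ, ExtendsOnHTheta ρ T → IsCompactOperator T) := by
  refine ⟨fun ρ u => hasOscIntegral_psiDO ρ u, fun s => ⟨fun ρ => ?_, ?_⟩, fun hm ρ => ⟨?_, ?_⟩⟩
  · exact ⟨sobolevOp s ρ, extendsOnSobolev_sobolevOp s ρ,
      fun T hT => hT.unique (extendsOnSobolev_sobolevOp s ρ)⟩
  · exact ⟨sobolevOp s, extendsOnSobolev_sobolevOp s⟩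
  · exact ⟨hilbertOp hm.le ρ, extendsOnHTheta_hilbertOp hm.le ρ,
      fun T hT => hT.unique (extendsOnHTheta_hilbertOp hm.le ρ)⟩
  · intro T hT
    rw [hT.unique (extendsOnHTheta_hilbertOp hm.le ρ)]
    exact isCompactOperator_hilbertOp hm ρ

theorem mainTheorem5 {n : ℕ} (hn : 2 ≤ n) (θ : Matrix (Fin n) (Fin n) ℝ)
    (hθ : θ.transpose = -θ) (m : ℝ) :
    (∀ (ρ : SymbolSpace θ m) (u : SmoothTorus θ),
      HasOscIntegral (amplitude ρ.toFun u) (psiDO ρ.toFun u)) ∧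
    (∀ s : ℝ,
      (∀ ρ : SymbolSpace θ m, ∃! T : SobolevSpace θ (s + m) →L[ℂ] SobolevSpace θ s,
        ExtendsOnSobolev ρ T) ∧
      ∃ Φ : SymbolSpace θ m →L[ℂ] (SobolevSpace θ (s + m) →L[ℂ] SobolevSpace θ s),
        ∀ ρ : SymbolSpace θ m, ExtendsOnSobolev ρ (Φ ρ)) ∧
    (m < 0 → ∀ ρ : SymbolSpace θ m,
      (∃! T : HTheta θ →L[ℂ] HTheta θ, ExtendsOnHTheta ρ T) ∧
      ∀ T : HTheta θ →L[ℂ] HTheta θ, ExtendsOnHTheta ρ T → IsCompactOperator T) := by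
  exact mainTheorem5_general θ m
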